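/- Let $\mathcal N=\{1,\dots,n\}$ be a set of voters, and let $0$ stand for abstention. A preference profile $P$ consists of a strict linear order $\succ_i$ on $\mathcal N\cup\{0\}$ for every $i\in\mathcal N$. It is single-peaked if for all $i,j,k\in\mathcal N$, $i<j<k$ or $k<j<i$ implies $j\succ_i k$. Voter $i$ is an abstainer if $0\succ_i i$; $\mathcal A$ is the set of abstainers. A delegation function is a map $d:\mathcal N\to\mathcal N\cup\{0\}$; its gurus are $\mathrm{Gu}(d)=\{i\in\mathcal N: d(i)=i\}$. The guru $\mathrm{gu}(i,d)$ of $i$ is the element of $\mathrm{Gu}(d)$ reached from $i$ by following $d$ if there is one, and $0$ otherwise (when the delegations lead to an abstaining voter or into a circuit). An equilibrium is a delegation function $d$ such that for every voter $i$, $\mathrm{gu}(i,d)\succ_i g$ for all $g\in(\mathrm{Gu}(d)\cup\{0,i\})\setminus\{\mathrm{gu}(i,d)\}$. The delegation-acceptability digraph $G_P^*$ has vertex set $\mathcal N\setminus\mathcal A$ and an arc $(i,j)$ whenever $j\succ_i i$ and $j\succ_i 0$. A kernel of a digraph is a set $K$ of vertices with no arc between two of its elements and such that every vertex outside $K$ has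 an arc to some element of $K$. The auxiliary digraph of $G_P^*$ has vertex set $\mathcal N\cup\{s,t\}$ and the following arcs, where $i,j\in\mathcal N\setminus\mathcal A$: $(i,j)$ with $i<j$ if $\{i,j\}$ is a kernel of the subgraph of $G_P^*$ induced by its vertices in $\{i,\dots,j\}$; $(s,j)$ if $\{j\}$ is a kernel of the subgraph induced by its vertices in $\{1,\dots,j\}$; $(i,t)$ if $\{i\}$ is a kernel of the subgraph induced by its vertices in $\{i,\dots,n\}$. Algorithms run on a word RAM with words of $O(\log n)$ bits and unit-cost elementary operations; a profile is given by the preference lists of its voters, and the voters are indexed along the axis of single-peakedness. **Theorem.** For single-peaked profiles $P$ on $n$ voters: 1. the (adjacency matrix of the) auxiliary digraph of $G_P^*$ can be computed in $O(n^2)$ time; 2. MEMB (given also $i\in\mathcal N\setminus\mathcal A$, decide whether there is an equilibrium $d$ with $i\in\mathrm{Gu}(d)$) is solvable in $O(n^2)$ time; 3. each of the following problems is solvable in $O(n^3)$ time: find an equilibrium $d$ that minimizes, among all equilibria, - MINDIS: $\sum_{i\in\mathcal N}(\mathrm{rk}(i,d)-1)$, where $\mathrm{rk}(i,d)$ is the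 rank of $\mathrm{gu}(i,d)$ in the preference list of $i$; - MINMAXVP: $\max_{i\in\mathrm{Gu}(d)}|\{j\in\mathcal N:\mathrm{gu}(j,d)=i\}|$ (read as $0$ if $\mathrm{Gu}(d)=\emptyset$); - MINABST: $|\{i\in\mathcal N:\mathrm{gu}(i,d)=0\}|$. -/

import Mathlib

namespace LiquidDemocracy

/-! ### Preference profiles and delegation functions

Voters are `Fin n`, in the order of the axis (the `k`-th voter is `k - 1 : Fin n`).
`Option (Fin n)` is the set of possible representatives: `none` is abstention and
`some j` is voter `j`. -/

/-- A preference profile: the preference list of every voter, i.e. a strict linear order on the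
voters and abstention, given by the position (`0` = most preferred) of every alternative. -/
structure Profile (n : ℕ) where
  pos : Fin n → Option (Fin n) ≃ Fin (n + 1)

namespace Profile

variable {n : ℕ}

/-- `P.Prefers i g h`: voter `i` strictly prefers `g` to `h`. -/
def Prefers (P : Profile n) (i : Fin n) (g h : Option (Fin n)) : Prop :=
  P.pos i g < P.pos i h

/-- The rank (starting at `1`) of `g` in the preference list of voter `i`. -/
def rank (P : Profile n) (i : Fin n) (g : Option (Fin n)) : ℕ :=
  (P.pos i g : ℕ) + 1

/-- Voter `i` prefers abstention to voting herself. -/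
def IsAbstainer (P : Profile n) (i : Fin n) : Prop :=
  P.Prefers i none (some i)

/-- The profile is single-peaked with respect to the order of the voters. -/
def SinglePeaked (P : Profile n) : Prop :=
  ∀ i j k : Fin n, (i < j ∧ j < k) ∨ (k < j ∧ j < i) → P.Prefers i (some j) (some k)

/-- The acceptable gurus of voter `i`. -/
def acc (P : Profile n) (i : Fin n) : Set (Fin n) :=
  {j | P.Prefers i (some j) (some i) ∧ P.Prefers i (some j) none}

end Profile

/-- A delegation function: `d i = some i` if `i` votes, `d i = some j` if `i` delegates to `j`,
`d i = none` if `i` abstains. -/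
abbrev Delegation (n : ℕ) := Fin n → Option (Fin n)

namespace Delegation

variable {n : ℕ}

/-- The voters who vote. -/
def gurus (d : Delegation n) : Finset (Fin n) :=
  Finset.univ.filter fun i => d i = some i

/-- One step along the delegations (abstention is absorbing). -/
def step (d : Delegation n) (g : Option (Fin n)) : Option (Fin n) :=
  g.bind d

/-- `d.Reaches i j`: following the delegations from `i` one arrives at `j`. -/
def Reaches (d : Delegation n) (i j : Fin n) : Prop :=
  ∃ m : ℕ, d.step^[m] (some i) = some j

open Classical in
/-- The guru of `i`: the voting voter reached from `i` along the delegations if there is one;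
otherwise (the delegations lead to an abstaining voter or into a circuit) abstention. -/
noncomputable def guru (d : Delegation n) (i : Fin n) : Option (Fin n) :=
  if h : ∃ j, j ∈ d.gurus ∧ d.Reaches i j then some h.choose else none

theorem iterate_step_of_mem_gurus (d : Delegation n) {j : Fin n} (hj : j ∈ d.gurus) (m : ℕ) :
    d.step^[m] (some j) = some j := by
  have h : d j = some j := by simpa [gurus] using hj
  exact Function.iterate_fixed (by simpa [step] using h) m

/-- The guru reached from a voter is unique, so that the choice in `guru` is no choice. -/
theorem guru_eq_some_iff (d : Delegation n) (i j : Fin n) :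
    d.guru i = some j ↔ j ∈ d.gurus ∧ d.Reaches i j := by
  have huniq : ∀ {a b : Fin n}, a ∈ d.gurus → b ∈ d.gurus → d.Reaches i a → d.Reaches i b →
      a = b := by
    rintro a b ha hb ⟨m, hm⟩ ⟨k, hk⟩
    have h1 : d.step^[k + m] (some i) = some a := by
      rw [Function.iterate_add_apply, hm, iterate_step_of_mem_gurus d ha]
    have h2 : d.step^[m + k] (some i) = some b := by
      rw [Function.iterate_add_apply, hk, iterate_step_of_mem_gurus d hb]
    rw [Nat.add_comm, h2] at h1
    exact (Option.some.inj h1).symm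
  unfold guru
  split_ifs with h
  · constructor
    · intro e
      rw [← Option.some.inj e]
      exact h.choose_spec
    · intro hj
      rw [huniq h.choose_spec.1 hj.1 h.choose_spec.2 hj.2]
  · constructor
    · intro e
      cases e
    · intro hj
      exact absurd ⟨j, hj⟩ h

/-- Nash-stability for voter `i`: her guru is strictly preferred by her to every other element of
the set consisting of the gurus, abstention and herself. -/
def NashStableFor (P : Profile n) (d : Delegation n) (i : Fin n) : Prop :=
  ∀ g : Option (Fin n), (g = none ∨ g = some i ∨ ∃ k ∈ d.gurus, g = some k) →
    g ≠ d.guru i → P.Prefers i (d.guru i) g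

/-- An equilibrium: a delegation function that is Nash-stable for every voter. -/
def IsEquilibrium (P : Profile n) (d : Delegation n) : Prop :=
  ∀ i, NashStableFor P d i

/-- The total dissatisfaction. -/
noncomputable def dissatisfaction (P : Profile n) (d : Delegation n) : ℕ :=
  ∑ i, (P.rank i (d.guru i) - 1)

open Classical in
/-- The voting power of `i`: the number of voters whose guru is `i`. -/
noncomputable def votingPower (d : Delegation n) (i : Fin n) : ℕ :=
  (Finset.univ.filter fun j => d.guru j = some i).card

/-- The maximal voting power of a guru (`0` if nobody votes). -/
noncomputable def maxVotingPower (d : Delegation n) : ℕ :=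
  d.gurus.sup d.votingPower

open Classical in
/-- The number of voters who end up abstaining. -/
noncomputable def abstentions (d : Delegation n) : ℕ :=
  (Finset.univ.filter fun i => d.guru i = none).card

end Delegation

/-! ### Digraphs -/

/-- `K` is a kernel (independent and absorbing set) of the subgraph of `G` induced by `S`. -/
def IsKernelOn {V : Type*} (G : Digraph V) (S K : Set V) : Prop :=
  K ⊆ S ∧ (∀ u ∈ K, ∀ v ∈ K, ¬ G.Adj u v) ∧ ∀ u ∈ S, u ∉ K → ∃ k ∈ K, G.Adj u k

/-- The voters who are not abstainers. -/
abbrev NonAbstainer {n : ℕ} (P : Profile n) := {i : Fin n // ¬ P.IsAbstainer i}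

/-- The delegation-acceptability digraph, on the non-abstainers. -/
def accDigraph {n : ℕ} (P : Profile n) : Digraph (NonAbstainer P) where
  Adj i j := (j : Fin n) ∈ P.acc i

/-- The vertices of the auxiliary digraph: the voters, a source and a sink. -/
inductive AuxVertex (n : ℕ) where
  | source : AuxVertex n
  | voter (i : Fin n) : AuxVertex n
  | sink : AuxVertex n

/-- The arcs of the auxiliary digraph. The intervals are intervals of non-abstainers, the only
vertices of the delegation-acceptability digraph; abstainers are isolated. -/
inductive AuxArc {n : ℕ} (P : Profile n) : AuxVertex n → AuxVertex n → Prop where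
  | inner (i j : NonAbstainer P) (hij : i < j)
      (h : IsKernelOn (accDigraph P) (Set.Icc i j) {i, j}) : AuxArc P (.voter i) (.voter j)
  | first (j : NonAbstainer P)
      (h : IsKernelOn (accDigraph P) (Set.Iic j) {j}) : AuxArc P .source (.voter j)
  | last (i : NonAbstainer P)
      (h : IsKernelOn (accDigraph P) (Set.Ici i) {i}) : AuxArc P (.voter i) .sink

/-- The auxiliary digraph of the delegation-acceptability digraph of `P`. -/
def auxDigraph {n : ℕ} (P : Profile n) : Digraph (AuxVertex n) where
  Adj := AuxArc P

/-! ### The machine model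

Programs for a word RAM: finitely many registers and arrays (those named in the program), whose
cells hold natural numbers below the word bound. Every elementary operation takes one time unit;
an operation whose result does not fit into a word blocks the run. -/

/-- A memory state: the contents of the registers and of the arrays. -/
structure State where
  reg : ℕ → ℕ
  arr : ℕ → ℕ → ℕ

namespace State

/-- Overwrite register `x` by `v`. -/
def setReg (s : State) (x v : ℕ) : State :=
  { s with reg := Function.update s.reg x v }

/-- Overwrite cell `k` of array `a` by `v`. -/
def setArr (s : State) (a k v : ℕ) : State :=
  { s with arr := Function.update s.arr a (Function.update (s.arr a) k v) }

end State

/-- Arithmetic expressions. -/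
inductive Expr where
  | const (c : ℕ) : Expr
  | reg (x : ℕ) : Expr
  | arr (a : ℕ) (idx : Expr) : Expr
  | add (e f : Expr) : Expr
  | sub (e f : Expr) : Expr
  | mul (e f : Expr) : Expr
  | lt (e f : Expr) : Expr

namespace Expr

/-- The value of an expression (`sub` is truncated, `lt` yields `0` or `1`). -/
def eval (s : State) : Expr → ℕ
  | const c => c
  | reg x => s.reg x
  | arr a idx => s.arr a (idx.eval s)
  | add e f => e.eval s + f.eval s
  | sub e f => e.eval s - f.eval s
  | mul e f => e.eval s * f.eval s
  | lt e f => if e.eval s < f.eval s then 1 else 0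

/-- The values of the expression and of all its subexpressions are below the bound `B`. -/
def Fits (B : ℕ) (s : State) : Expr → Prop
  | const c => c < B
  | reg x => s.reg x < B
  | arr a idx => idx.Fits B s ∧ s.arr a (idx.eval s) < B
  | add e f => e.Fits B s ∧ f.Fits B s ∧ e.eval s + f.eval s < B
  | sub e f => e.Fits B s ∧ f.Fits B s
  | mul e f => e.Fits B s ∧ f.Fits B s ∧ e.eval s * f.eval s < B
  | lt e f => e.Fits B s ∧ f.Fits B s ∧ 1 < B

/-- The number of elementary operations in an expression. -/
def cost : Expr → ℕ
  | const _ => 1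
  | reg _ => 1
  | arr _ idx => idx.cost + 1
  | add e f => e.cost + f.cost + 1
  | sub e f => e.cost + f.cost + 1
  | mul e f => e.cost + f.cost + 1
  | lt e f => e.cost + f.cost + 1

end Expr

/-- Programs. -/
inductive Program where
  | skip : Program
  | assign (x : ℕ) (e : Expr) : Program
  | store (a : ℕ) (idx e : Expr) : Program
  | seq (p q : Program) : Program
  | branch (e : Expr) (p q : Program) : Program
  | loop (e : Expr) (p : Program) : Program

/-- `Exec B p s t s₁`: with word bound `B`, the program `p` started in state `s` halts after
`t` time units in state `s₁`. A test succeeds if its value is not `0`. -/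
inductive Exec (B : ℕ) : Program → State → ℕ → State → Prop where
  | skip (s : State) : Exec B .skip s 1 s
  | assign (s : State) (x : ℕ) (e : Expr) (he : e.Fits B s) :
      Exec B (.assign x e) s (e.cost + 1) (s.setReg x (e.eval s))
  | store (s : State) (a : ℕ) (idx e : Expr) (hi : idx.Fits B s) (he : e.Fits B s) :
      Exec B (.store a idx e) s (idx.cost + e.cost + 1) (s.setArr a (idx.eval s) (e.eval s))
  | seq {p q : Program} {s s₁ s₂ : State} {t₁ t₂ : ℕ} (hp : Exec B p s t₁ s₁)
      (hq : Exec B q s₁ t₂ s₂) : Exec B (.seq p q) s (t₁ + t₂) s₂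
  | branchTrue {e : Expr} {p q : Program} {s s₁ : State} {t : ℕ} (hf : e.Fits B s)
      (he : e.eval s ≠ 0) (hp : Exec B p s t s₁) :
      Exec B (.branch e p q) s (e.cost + 1 + t) s₁
  | branchFalse {e : Expr} {p q : Program} {s s₁ : State} {t : ℕ} (hf : e.Fits B s)
      (he : e.eval s = 0) (hq : Exec B q s t s₁) :
      Exec B (.branch e p q) s (e.cost + 1 + t) s₁
  | loopDone {e : Expr} {p : Program} {s : State} (hf : e.Fits B s) (he : e.eval s = 0) :
      Exec B (.loop e p) s (e.cost + 1) s
  | loopStep {e : Expr} {p : Program} {s s₁ s₂ : State} {t₁ t₂ : ℕ} (hf : e.Fits B s)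
      (he : e.eval s ≠ 0) (hp : Exec B p s t₁ s₁) (hl : Exec B (.loop e p) s₁ t₂ s₂) :
      Exec B (.loop e p) s (e.cost + 1 + t₁ + t₂) s₂

/-- The machine is deterministic: final state and running time are determined by the input. -/
theorem Exec.deterministic {B : ℕ} {p : Program} {s s₁ s₂ : State} {t₁ t₂ : ℕ}
    (h₁ : Exec B p s t₁ s₁) (h₂ : Exec B p s t₂ s₂) : t₁ = t₂ ∧ s₁ = s₂ := by
  induction h₁ generalizing t₂ s₂ with
  | skip s => cases h₂; exact ⟨rfl, rfl⟩
  | assign s x e he => cases h₂; exact ⟨rfl, rfl⟩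
  | store s a idx e hi he => cases h₂; exact ⟨rfl, rfl⟩
  | seq hp hq ihp ihq =>
    cases h₂ with
    | seq hp₂ hq₂ =>
      obtain ⟨rfl, rfl⟩ := ihp hp₂
      obtain ⟨rfl, rfl⟩ := ihq hq₂
      exact ⟨rfl, rfl⟩
  | branchTrue hf he hp ih =>
    cases h₂ with
    | branchTrue _ _ hp₂ => obtain ⟨rfl, rfl⟩ := ih hp₂; exact ⟨rfl, rfl⟩
    | branchFalse _ he₂ _ => exact absurd he₂ he
  | branchFalse hf he hq ih =>
    cases h₂ with
    | branchTrue _ he₂ _ => exact absurd he he₂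
    | branchFalse _ _ hq₂ => obtain ⟨rfl, rfl⟩ := ih hq₂; exact ⟨rfl, rfl⟩
  | loopDone hf he =>
    cases h₂ with
    | loopDone _ _ => exact ⟨rfl, rfl⟩
    | loopStep _ he₂ _ _ => exact absurd he he₂
  | loopStep hf he hp hl ihp ihl =>
    cases h₂ with
    | loopDone _ he₂ => exact absurd he₂ he
    | loopStep _ _ hp₂ hl₂ =>
      obtain ⟨rfl, rfl⟩ := ihp hp₂
      obtain ⟨rfl, rfl⟩ := ihl hl₂
      exact ⟨rfl, rfl⟩

/-- The computational task with instances `I n` of size `n`, input convention `input` and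
correctness condition `Correct` on the final state is solvable in time `O(f(n))`: a single program
solves all instances, with words of `O(log n)` bits. -/
def SolvableInTime (I : ℕ → Type) (input : ∀ n, I n → State) (Correct : ∀ n, I n → State → Prop)
    (f : ℕ → ℝ) : Prop :=
  ∃ (p : Program) (c : ℕ) (T : ℕ → ℕ),
    (fun n => (T n : ℝ)) =O[Filter.atTop] f ∧
    ∀ (n : ℕ) (x : I n), ∃ (t : ℕ) (s : State),
      Exec ((n + 2) ^ c) p (input n x) t s ∧ t ≤ T n ∧ Correct n x s

/-! ### Input and output conventions -/

/-- Abstention is coded by `0`, the voters by `1, …, n`. -/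
def code {n : ℕ} : Option (Fin n) → ℕ
  | none => 0
  | some i => i + 1

/-- Source, voters and sink are coded by `0`, by `1, …, n` and by `n + 1`. -/
def AuxVertex.code {n : ℕ} : AuxVertex n → ℕ
  | .source => 0
  | .voter i => i + 1
  | .sink => n + 1

/-- The `k`-th cell of the concatenation of the preference lists of all voters: the lists have
length `n + 1` each and go from the most to the least preferred alternative. -/
def prefCell {n : ℕ} (P : Profile n) (k : ℕ) : ℕ :=
  if h : k / (n + 1) < n then
    code ((P.pos ⟨k / (n + 1), h⟩).symm ⟨k % (n + 1), Nat.mod_lt _ n.succ_pos⟩)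
  else 0

/-- The input state for a profile: register `0` holds `n`, array `0` holds the preference lists,
and the rest of the memory is `0`. -/
def profileInput (n : ℕ) (P : Profile n) : State where
  reg x := if x = 0 then n else 0
  arr a k := if a = 0 then prefCell P k else 0

/-- The input state for a profile and a voter, whose code is in register `1`. -/
def memberInput (n : ℕ) (P : Profile n) (i : Fin n) : State :=
  (profileInput n P).setReg 1 (code (some i))

/-- Instances: single-peaked profiles on `n` voters. -/
abbrev SPProfile (n : ℕ) := {P : Profile n // P.SinglePeaked}

/-- Instances of the membership problem: a single-peaked profile and a non-abstainer. -/
abbrev MemberInstance (n : ℕ) := (P : SPProfile n) × NonAbstainer P.1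

open Classical in
/-- Array `1` holds the adjacency matrix of the auxiliary digraph, row by row. -/
def OutputsAuxDigraph (n : ℕ) (P : Profile n) (s : State) : Prop :=
  ∀ u v : AuxVertex n,
    s.arr 1 (u.code * (n + 2) + v.code) = if (auxDigraph P).Adj u v then 1 else 0

open Classical in
/-- Register `0` holds the answer (`1` for yes, `0` for no) to the question whether there is an
equilibrium in which `i` is a guru. -/
def OutputsMembership (n : ℕ) (P : Profile n) (i : Fin n) (s : State) : Prop :=
  s.reg 0 = if ∃ d : Delegation n, d.IsEquilibrium P ∧ i ∈ d.gurus then 1 else 0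

/-- Array `1` holds an equilibrium that minimizes `measure` among all equilibria. -/
def OutputsOptimal (n : ℕ) (P : Profile n) (measure : Delegation n → ℕ) (s : State) : Prop :=
  ∃ d : Delegation n, (∀ i : Fin n, s.arr 1 i = code (d i)) ∧ d.IsEquilibrium P ∧
    ∀ d₁ : Delegation n, d₁.IsEquilibrium P → measure d ≤ measure d₁

end LiquidDemocracy

/-! Two artificial vertices `0` and `n + 1` are placed at the ends of the axis; both stand for
abstention and neither accepts anyone. By single-peakedness, whatever a non-abstainer accepts lies
in an interval around her: an arc that jumps over a vertex comes with an arc to that vertex.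
Equilibria and kernels then correspond. Stability of all voters says that the gurus form a kernel of
the delegation-acceptability digraph (`Delegation.IsEquilibrium.partialKernel`). Conversely, if
everybody delegates directly to her best element of a kernel (or abstains), the result is an
equilibrium with these gurus (`PartialKernel.isEquilibrium`). In an equilibrium the set of gurus
determines the guru of every voter, so all three measures are functions of the kernel.

By the interval property, being a kernel is a condition on consecutive elements only: the kernels
are the vertex sets of the paths from `0` to `n + 1` along links (`PartialKernel.insert`,
`PartialKernel.exists_pred`). MEMB is therefore a reachability question in an acyclic digraph. All
links are found in quadratic time, because for a fixed tail the absorption condition reduces to one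
comparison with a running minimum (`run_linkRowCmd`).

A voter compares only abstention and the two kernel elements next to her
(`PrefTable.bestPos_insert`). Dissatisfaction and abstentions are thus sums over the gaps of the
path. The power of a guru depends on her predecessor and her successor, and the measure is a maximum
of such terms. All cases are covered by one dynamic program whose states are pairs `(j, k)` of a
vertex and its successor, with value the minimum over predecessors `i` of `op (f i j) (L i j + R j
k)`; this takes cubic time. The optimum is finite because a kernel exists (`exists_isKernelFinset`).

Time and word size are handled uniformly. Every loop has exactly `n + 2` rounds, so the nesting
depth is the exponent of the running time, and a syntactic check keeps every memory cell below `(n +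
2) ^ 3` (`Cmd.exec_run`, `solvableInTime_of_cmd`). -/

namespace LiquidDemocracy

/-! ### A language of bounded loops -/

/-- Commands whose loops all run through the numbers below the content of register `2`. -/
inductive Cmd where
  | assign (x : ℕ) (e : Expr) : Cmd
  | store (a : ℕ) (idx e : Expr) : Cmd
  | seq (p q : Cmd) : Cmd
  | ite (e : Expr) (p : Cmd) : Cmd
  | iter (x : ℕ) (p : Cmd) : Cmd

namespace Expr

/-- Expressions whose value never exceeds the largest memory cell (or `8`). -/
def small : Expr → Bool
  | const c => c ≤ 8
  | reg _ => true
  | arr _ _ => true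
  | sub e _ => e.small
  | lt _ _ => true
  | _ => false

/-- An exponent for a bound on all intermediate results. -/
def deg : Expr → ℕ
  | const c => c + 1
  | reg _ => 1
  | arr _ idx => idx.deg + 1
  | add e f => e.deg + f.deg + 1
  | sub e f => e.deg + f.deg + 1
  | mul e f => e.deg + f.deg + 1
  | lt e f => e.deg + f.deg + 1

/-- The minimum of `e` and the content of register `3`. -/
def clamp (e : Expr) : Expr := sub (reg 3) (sub (reg 3) e)

/-- The minimum of two expressions. -/
def min (e f : Expr) : Expr := sub e (sub e f)

/-- The maximum of two expressions. -/
def max (e f : Expr) : Expr := add e (sub f e)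

/-- A truncated difference from a register passes the syntactic test `small`. Sums can thus be
stored without endangering the memory bound, and nothing is lost as long as register `3` dominates
them. -/
theorem eval_clamp (s : State) (e : Expr) (h : e.eval s ≤ s.reg 3) :
    e.clamp.eval s = e.eval s := by
  simp only [clamp, eval]; omega

theorem eval_min (s : State) (e f : Expr) : (e.min f).eval s = Min.min (e.eval s) (f.eval s) := by
  simp only [min, eval]; omega

theorem eval_max (s : State) (e f : Expr) : (e.max f).eval s = Max.max (e.eval s) (f.eval s) := by
  simp only [max, eval]; omega

end Expr

/-- All memory cells are at most `M`. -/
def State.BoundedBy (s : State) (M : ℕ) : Prop :=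
  (∀ x, s.reg x ≤ M) ∧ ∀ a k, s.arr a k ≤ M

/-! ### Size of the values of expressions -/

namespace Expr

theorem eval_le_of_small {s : State} {M : ℕ} (hM : 8 ≤ M) (hs : s.BoundedBy M) :
    ∀ {e : Expr}, e.small = true → e.eval s ≤ M
  | const c, h => by simp [small] at h; simp [eval]; omega
  | reg x, _ => hs.1 x
  | arr a idx, _ => hs.2 a _
  | add e f, h => by simp [small] at h
  | mul e f, h => by simp [small] at h
  | sub e f, h => by
      have := eval_le_of_small hM hs (e := e) (by simpa [small] using h)
      simp only [eval]; omega
  | lt e f, _ => by simp only [eval]; split_ifs <;> omega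

theorem eval_le_pow {s : State} {M : ℕ} (hM : 2 ≤ M) (hs : s.BoundedBy M) (e : Expr) :
    e.eval s ≤ M ^ e.deg := by
  have hpos : ∀ k, 1 ≤ M ^ k := fun k => Nat.one_le_pow _ _ (by omega)
  have hself : ∀ k, M ≤ M ^ (k + 1) := fun k => Nat.le_self_pow (by omega) M
  have hadd : ∀ x y a b : ℕ, x ≤ M ^ a → y ≤ M ^ b → x + y ≤ M ^ (a + b + 1) := by
    intro x y a b hx hy
    have h1 : M ^ a ≤ M ^ (a + b) := Nat.pow_le_pow_right (by omega) (by omega)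
    have h2 : M ^ b ≤ M ^ (a + b) := Nat.pow_le_pow_right (by omega) (by omega)
    calc x + y ≤ M ^ (a + b) * 2 := by omega
      _ ≤ M ^ (a + b + 1) := by rw [pow_succ]; gcongr
  induction e with
  | const c =>
    simp only [eval, deg]
    calc c ≤ 2 ^ c := Nat.lt_two_pow_self.le
      _ ≤ M ^ c := Nat.pow_le_pow_left hM c
      _ ≤ M ^ (c + 1) := Nat.pow_le_pow_right (by omega) (by omega)
  | reg x => simpa [eval, deg] using hs.1 x
  | arr a idx ih => exact (hs.2 a _).trans (hself _)
  | add e f ihe ihf => exact hadd _ _ _ _ ihe ihf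
  | sub e f ihe ihf =>
    exact (Nat.sub_le _ _).trans ((Nat.le_add_right _ _).trans (hadd _ _ _ _ ihe ihf))
  | mul e f ihe ihf =>
    simp only [eval, deg]
    calc e.eval s * f.eval s ≤ M ^ e.deg * M ^ f.deg := Nat.mul_le_mul ihe ihf
      _ = M ^ (e.deg + f.deg) := (pow_add _ _ _).symm
      _ ≤ _ := Nat.pow_le_pow_right (by omega) (by omega)
  | lt e f ihe ihf =>
    simp only [eval]
    split_ifs
    · exact hpos _
    · exact Nat.zero_le _

/-- `deg` does not decrease when passing from a subexpression to the whole, so one power of `M`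
dominates all intermediate values. -/
theorem fits_of_boundedBy {s : State} {M B : ℕ} (hM : 2 ≤ M) (hs : s.BoundedBy M) (e : Expr)
    (hB : M ^ e.deg < B) : e.Fits B s := by
  have key : ∀ f : Expr, f.deg ≤ e.deg → f.eval s < B := fun f hf =>
    (eval_le_pow hM hs f).trans_lt ((Nat.pow_le_pow_right (by omega) hf).trans_lt hB)
  have sub : ∀ f : Expr, f.deg ≤ e.deg → f.Fits B s := by
    intro f
    induction f with
    | const c => intro h; exact key _ h
    | reg x => intro h; exact key _ h
    | arr a idx ih => intro h; exact ⟨ih (by simp [deg] at h; omega), key (arr a idx) h⟩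
    | add f g ihf ihg =>
      intro h
      exact ⟨ihf (by simp [deg] at h; omega), ihg (by simp [deg] at h; omega), key (add f g) h⟩
    | sub f g ihf ihg =>
      intro h; exact ⟨ihf (by simp [deg] at h; omega), ihg (by simp [deg] at h; omega)⟩
    | mul f g ihf ihg =>
      intro h
      exact ⟨ihf (by simp [deg] at h; omega), ihg (by simp [deg] at h; omega), key (mul f g) h⟩
    | lt f g ihf ihg =>
      intro h
      refine ⟨ihf (by simp [deg] at h; omega), ihg (by simp [deg] at h; omega), ?_⟩
      have := Nat.one_le_pow e.deg M (by omega)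
      omega
  exact sub e le_rfl

end Expr

/-! ### Memory updates -/

namespace State

@[simp] theorem setReg_reg (s : State) (x v y : ℕ) :
    (s.setReg x v).reg y = if y = x then v else s.reg y := by
  simp [setReg, Function.update_apply]

@[simp] theorem setReg_arr (s : State) (x v : ℕ) : (s.setReg x v).arr = s.arr := rfl

@[simp] theorem setArr_reg (s : State) (a k v : ℕ) : (s.setArr a k v).reg = s.reg := rfl

theorem setArr_arr (s : State) (a k v b l : ℕ) :
    (s.setArr a k v).arr b l = if b = a ∧ l = k then v else s.arr b l := by
  simp only [setArr, Function.update_apply]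
  by_cases h : b = a
  · subst h; simp [Function.update_apply]
  · simp [h]

@[simp] theorem setArr_arr_self (s : State) (a k v l : ℕ) :
    (s.setArr a k v).arr a l = if l = k then v else s.arr a l := by
  simp [setArr_arr]

theorem setArr_arr_ne (s : State) {a b : ℕ} (k v : ℕ) (h : b ≠ a) :
    (s.setArr a k v).arr b = s.arr b := by
  funext l; simp [setArr_arr, h]

theorem BoundedBy.setReg {s : State} {M : ℕ} (hs : s.BoundedBy M) {x v : ℕ} (hv : v ≤ M) :
    (s.setReg x v).BoundedBy M := by
  refine ⟨fun y => ?_, hs.2⟩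
  rw [setReg_reg]
  split_ifs
  exacts [hv, hs.1 y]

theorem BoundedBy.setArr {s : State} {M : ℕ} (hs : s.BoundedBy M) {a k v : ℕ} (hv : v ≤ M) :
    (s.setArr a k v).BoundedBy M := by
  refine ⟨hs.1, fun b l => ?_⟩
  rw [setArr_arr]
  split_ifs
  exacts [hv, hs.2 b l]

end State

/-! ### Semantics, memory bounds and running time of commands -/

namespace Cmd

/-- The program of a command. -/
def compile : Cmd → Program
  | assign x e => .assign x e
  | store a idx e => .store a idx e
  | seq p q => .seq p.compile q.compile
  | ite e p => .branch e p.compile .skip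
  | .iter x p => .seq (.assign x (.const 0)) (.loop (.lt (.reg x) (.reg 2))
      (.seq p.compile (.assign x (.add (.reg x) (.const 1)))))

/-- The effect of a command. -/
def run : Cmd → State → State
  | assign x e, s => s.setReg x (e.eval s)
  | store a idx e, s => s.setArr a (idx.eval s) (e.eval s)
  | seq p q, s => q.run (p.run s)
  | ite e p, s => if e.eval s = 0 then s else p.run s
  | .iter x p, s => Nat.rec (s.setReg x 0) (fun i s' => (p.run s').setReg x (i + 1)) (s.reg 2)

/-- The command never writes register `y`. -/
def keepsReg (y : ℕ) : Cmd → Bool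
  | assign x _ => x != y
  | store _ _ _ => true
  | seq p q => p.keepsReg y && q.keepsReg y
  | ite _ p => p.keepsReg y
  | .iter x p => x != y && p.keepsReg y

/-- The command never writes array `b`. -/
def keepsArr (b : ℕ) : Cmd → Bool
  | assign _ _ => true
  | store a _ _ => a != b
  | seq p q => p.keepsArr b && q.keepsArr b
  | ite _ p => p.keepsArr b
  | .iter _ p => p.keepsArr b

/-- Only small values are assigned, and loop counters are not changed in the loop. -/
def ok : Cmd → Bool
  | assign _ e => e.small
  | store _ _ e => e.small
  | seq p q => p.ok && q.ok
  | ite _ p => p.ok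
  | .iter x p => p.ok && p.keepsReg x

/-- An exponent for a bound on all intermediate results. -/
def deg : Cmd → ℕ
  | assign _ e => e.deg
  | store _ idx e => idx.deg + e.deg
  | seq p q => p.deg + q.deg
  | ite e p => e.deg + p.deg
  | .iter _ p => p.deg + 4

/-- The nesting depth of the loops. -/
def depth : Cmd → ℕ
  | assign _ _ => 0
  | store _ _ _ => 0
  | seq p q => max p.depth q.depth
  | ite _ p => p.depth
  | .iter _ p => p.depth + 1

/-- The constant factor of the running time. -/
def factor : Cmd → ℕ
  | assign _ e => e.cost + 1
  | store _ idx e => idx.cost + e.cost + 1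
  | seq p q => p.factor + q.factor
  | ite e p => e.cost + 2 + p.factor
  | .iter _ p => p.factor + 14

/-- Together with `run_arr` this is the frame rule: for concrete commands the hypothesis is a
computation, usually closed by `rfl`. -/
theorem run_reg {y : ℕ} : ∀ {c : Cmd}, c.keepsReg y = true → ∀ s, (c.run s).reg y = s.reg y
  | assign x e, h, s => by
      have : y ≠ x := by rintro rfl; simp [keepsReg] at h
      simp [run, this]
  | store a idx e, _, s => rfl
  | seq p q, h, s => by
      simp only [keepsReg, Bool.and_eq_true] at h
      simp only [run]
      rw [run_reg h.2, run_reg h.1]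
  | ite e p, h, s => by
      simp only [run]
      split_ifs
      exacts [rfl, run_reg (c := p) h s]
  | .iter x p, h, s => by
      simp only [keepsReg, Bool.and_eq_true, bne_iff_ne] at h
      simp only [run]
      induction s.reg 2 with
      | zero => simp [h.1.symm]
      | succ k ih => simp only [State.setReg_reg, h.1.symm, if_false]; rw [run_reg h.2, ih]

theorem run_arr {b : ℕ} : ∀ {c : Cmd}, c.keepsArr b = true → ∀ s, (c.run s).arr b = s.arr b
  | assign x e, _, s => rfl
  | store a idx e, h, s => by
      have : b ≠ a := by rintro rfl; simp [keepsArr] at h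
      simp [run, State.setArr_arr_ne _ _ _ this]
  | seq p q, h, s => by
      simp only [keepsArr, Bool.and_eq_true] at h
      simp only [run]
      rw [run_arr h.2, run_arr h.1]
  | ite e p, h, s => by
      simp only [run]
      split_ifs
      exacts [rfl, run_arr (c := p) h s]
  | .iter x p, h, s => by
      simp only [run]
      induction s.reg 2 with
      | zero => rfl
      | succ k ih => simp only [State.setReg_arr]; rw [run_arr (c := p) h, ih]

/-- The invariant rule for loops. -/
theorem run_for {x : ℕ} {p : Cmd} {s : State} (I : ℕ → State → Prop) (h0 : I 0 (s.setReg x 0))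
    (hstep : ∀ i < s.reg 2, ∀ s₁ : State, s₁.reg x = i → I i s₁ →
      I (i + 1) ((p.run s₁).setReg x (i + 1))) :
    I (s.reg 2) ((Cmd.iter x p).run s) := by
  simp only [run]
  have key : ∀ k ≤ s.reg 2,
      I k (Nat.rec (s.setReg x 0) (fun i s' => (p.run s').setReg x (i + 1)) k) := by
    intro k
    induction k with
    | zero => intro _; exact h0
    | succ k ih =>
      intro hk
      refine hstep k (by omega) _ ?_ (ih (by omega))
      cases k <;> simp
  exact key _ le_rfl

/-- Halting, running time and memory bound must be proved together: the bound `M` on all cells is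
what makes every expression fit into a word, and it has to survive each subcommand. Register `2` is
never written, so every loop has `W` rounds. -/
theorem exec_run {B W M : ℕ} (hM : 8 ≤ M) (hW : 1 ≤ W) (hWM : W ≤ M) :
    ∀ (c : Cmd) (s : State), c.ok = true → c.keepsReg 2 = true → s.BoundedBy M →
      s.reg 2 = W → M ^ c.deg < B →
      ∃ t, Exec B c.compile s t (c.run s) ∧ t ≤ c.factor * W ^ c.depth ∧
        (c.run s).BoundedBy M := by
  intro c
  have hmono : ∀ {a b : ℕ}, a ≤ b → M ^ a ≤ M ^ b := fun h => Nat.pow_le_pow_right (by omega) h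
  have hWpow : ∀ {a b : ℕ}, a ≤ b → W ^ a ≤ W ^ b := fun h => Nat.pow_le_pow_right hW h
  induction c with
  | assign x e =>
    intro s hok _ hs _ hB
    refine ⟨_, .assign s x e (e.fits_of_boundedBy (by omega) hs hB), by simp [factor, depth], ?_⟩
    exact hs.setReg (Expr.eval_le_of_small hM hs hok)
  | store a idx e =>
    intro s hok _ hs _ hB
    refine ⟨_, .store s a idx e
      (idx.fits_of_boundedBy (by omega) hs ((hmono (by simp [deg])).trans_lt hB))
      (e.fits_of_boundedBy (by omega) hs ((hmono (by simp [deg])).trans_lt hB)),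
      by simp [factor, depth], ?_⟩
    exact hs.setArr (Expr.eval_le_of_small hM hs hok)
  | seq p q ihp ihq =>
    intro s hok hk hs h2 hB
    simp only [ok, Bool.and_eq_true] at hok
    simp only [keepsReg, Bool.and_eq_true] at hk
    obtain ⟨t₁, he₁, ht₁, hb₁⟩ :=
      ihp s hok.1 hk.1 hs h2 ((hmono (by simp [deg])).trans_lt hB)
    obtain ⟨t₂, he₂, ht₂, hb₂⟩ := ihq (p.run s) hok.2 hk.2 hb₁ (by rw [run_reg hk.1, h2])
      ((hmono (by simp [deg])).trans_lt hB)
    refine ⟨_, .seq he₁ he₂, ?_, hb₂⟩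
    simp only [factor, depth, add_mul]
    refine Nat.add_le_add (ht₁.trans ?_) (ht₂.trans ?_)
    · exact Nat.mul_le_mul_left _ (hWpow (le_max_left _ _))
    · exact Nat.mul_le_mul_left _ (hWpow (le_max_right _ _))
  | ite e p ih =>
    intro s hok hk hs h2 hB
    have hf : e.Fits B s := e.fits_of_boundedBy (by omega) hs ((hmono (by simp [deg])).trans_lt hB)
    have h1 : 1 ≤ W ^ p.depth := Nat.one_le_pow _ _ hW
    have h3 : e.cost + 2 ≤ (e.cost + 2) * W ^ p.depth := Nat.le_mul_of_pos_right _ h1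
    simp only [factor, depth, add_mul _ p.factor]
    by_cases h0 : e.eval s = 0
    · refine ⟨e.cost + 1 + 1, ?_, by omega, ?_⟩
      · simpa [run, h0, compile] using Exec.branchFalse (p := p.compile) hf h0 (.skip s)
      · simpa [run, h0] using hs
    · obtain ⟨t, he, ht, hb⟩ := ih s hok hk hs h2 ((hmono (by simp [deg])).trans_lt hB)
      refine ⟨e.cost + 1 + t, ?_, by omega, ?_⟩
      · simpa [run, h0, compile] using Exec.branchTrue (q := .skip) hf h0 he
      · simpa [run, h0] using hb
  | iter x p ih =>
    intro s hok hk hs h2 hB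
    simp only [ok, Bool.and_eq_true] at hok
    simp only [keepsReg, Bool.and_eq_true, bne_iff_ne] at hk
    have hBp : M ^ p.deg < B := (hmono (by simp [deg])).trans_lt hB
    have hB4 : M ^ 4 < B := (hmono (by simp [deg])).trans_lt hB
    have hMB : M ^ 1 < B := (hmono (by simp [deg])).trans_lt hB
    -- The incremented counter is the only value written that the test `small` does not cover; the
    -- summand `4` in the degree of a loop makes room for it.
    have hMM : M + M ≤ M ^ 4 := by
      calc M + M = M * 2 := by ring
        _ ≤ M * M ^ 3 := Nat.mul_le_mul_left _ (by
          calc 2 ≤ M := by omega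
            _ ≤ M ^ 3 := Nat.le_self_pow (by omega) M)
        _ = M ^ 4 := by ring
    rw [pow_one] at hMB
    set q : Program := .seq p.compile (.assign x (.add (.reg x) (.const 1))) with hq
    set st : ℕ → State :=
      fun k => Nat.rec (s.setReg x 0) (fun i s' => (p.run s').setReg x (i + 1)) k with hst
    have hx : ∀ k, (st k).reg x = k := fun k => by cases k <;> simp [hst]
    have hst2 : ∀ k, (st k).reg 2 = W := by
      intro k
      induction k with
      | zero => simp [hst, hk.1.symm, h2]
      | succ k ihk =>
        simp only [hst, State.setReg_reg, hk.1.symm, if_false]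
        rw [run_reg hk.2]; exact ihk
    have hbd : ∀ k ≤ W, (st k).BoundedBy M ∧ (k < W → ∃ t,
        Exec B q (st k) t (st (k + 1)) ∧ t ≤ p.factor * W ^ p.depth + 4) := by
      have hstep : ∀ k < W, (st k).BoundedBy M → (st (k + 1)).BoundedBy M ∧ ∃ t,
          Exec B q (st k) t (st (k + 1)) ∧ t ≤ p.factor * W ^ p.depth + 4 := by
        intro k hkW hb
        obtain ⟨t, he, ht, hb'⟩ := ih (st k) hok.1 hk.2 hb (hst2 k) hBp
        have hxk : (p.run (st k)).reg x = k := by rw [run_reg hok.2, hx]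
        refine ⟨hb'.setReg (by omega), t + 4, .seq he ?_, by omega⟩
        have := Exec.assign (B := B) (p.run (st k)) x (.add (.reg x) (.const 1))
          ⟨by simp only [Expr.Fits, hxk]; omega, by simp only [Expr.Fits]; omega,
            by simp only [Expr.eval, hxk]; omega⟩
        simpa [Expr.eval, hxk, Expr.cost] using this
      have hall : ∀ k ≤ W, (st k).BoundedBy M := by
        intro k
        induction k with
        | zero => intro _; exact hs.setReg (Nat.zero_le _)
        | succ k ihk => intro h; exact (hstep k (by omega) (ihk (by omega))).1
      exact fun k hkW => ⟨hall k hkW, fun h => (hstep k h (hall k hkW)).2⟩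
    have hfit : ∀ k ≤ W, (Expr.lt (.reg x) (.reg 2)).Fits B (st k) := by
      intro k hkW
      refine ⟨?_, ?_, by omega⟩
      · simp only [Expr.Fits, hx]; omega
      · simp only [Expr.Fits, hst2]; omega
    have hloop : ∀ j ≤ W, ∃ t, Exec B (.loop (.lt (.reg x) (.reg 2)) q) (st (W - j)) t (st W) ∧
        t ≤ j * (p.factor * W ^ p.depth + 8) + 4 := by
      intro j
      induction j with
      | zero =>
        intro _
        refine ⟨_, .loopDone (hfit _ (by omega)) ?_, by simp [Expr.cost]⟩
        simp only [Expr.eval, hx, hst2]; simp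
      | succ j ihj =>
        intro hj
        obtain ⟨t₂, he₂, ht₂⟩ := ihj (by omega)
        obtain ⟨t₁, he₁, ht₁⟩ := (hbd (W - (j + 1)) (by omega)).2 (by omega)
        rw [show W - (j + 1) + 1 = W - j by omega] at he₁
        refine ⟨_, .loopStep (hfit _ (by omega)) ?_ he₁ he₂, ?_⟩
        · simp only [Expr.eval, hx, hst2]; rw [if_pos (by omega)]; omega
        · simp only [Expr.cost]
          rw [add_mul j 1]
          omega
    obtain ⟨t, he, ht⟩ := hloop W le_rfl
    rw [Nat.sub_self] at he
    have hrun : (Cmd.iter x p).run s = st W := by simp only [run, hst, h2]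
    rw [hrun]
    refine ⟨2 + t, .seq (.assign s x (.const 0) (by simp only [Expr.Fits]; omega)) he, ?_,
      (hbd W le_rfl).1⟩
    have h1 : 1 ≤ W ^ p.depth := Nat.one_le_pow _ _ hW
    simp only [factor, depth, pow_succ]
    have h4 : W ≤ W ^ p.depth * W := Nat.le_mul_of_pos_left _ h1
    -- Each round costs `8` beyond the body (`4` for the test, `4` for the increment); initializing
    -- costs `2` and the last test `4`. As `1 ≤ W`, the total overhead is at most `14 * W`, the
    -- constant in `factor`.
    calc 2 + t ≤ p.factor * (W ^ p.depth * W) + 8 * W + 6 := by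
          refine (Nat.add_le_add_left ht 2).trans (le_of_eq ?_); ring
      _ ≤ (p.factor + 14) * (W ^ p.depth * W) := by rw [add_mul]; omega

end Cmd

/-! ### Solving a task by a command -/

/-- Initialization: register `2` is set to `n + 2` and register `3` to its third power. -/
def setup : Program :=
  .seq (.assign 2 (.add (.reg 0) (.const 2)))
    (.assign 3 (.mul (.mul (.reg 2) (.reg 2)) (.reg 2)))

/-- The state after the initialization. -/
def State.setup (s : State) : State :=
  (s.setReg 2 (s.reg 0 + 2)).setReg 3 ((s.reg 0 + 2) ^ 3)

theorem exec_setup {B n : ℕ} {s : State} (hs : s.reg 0 = n) (hB : (n + 2) ^ 3 < B) :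
    Exec B setup s 10 s.setup := by
  have h1 : n + 2 ≤ (n + 2) ^ 3 := Nat.le_self_pow (by omega) _
  have h2 : (n + 2) * (n + 2) ≤ (n + 2) ^ 3 := by
    rw [← sq]; exact Nat.pow_le_pow_right (by omega) (by omega)
  have h3 : (n + 2) * (n + 2) * (n + 2) = (n + 2) ^ 3 := by ring
  have e1 := Exec.assign (B := B) s 2 (.add (.reg 0) (.const 2))
    ⟨by simp only [Expr.Fits]; omega, by simp only [Expr.Fits]; omega,
      by simp only [Expr.eval]; omega⟩
  have e2 := Exec.assign (B := B) (s.setReg 2 (s.reg 0 + 2)) 3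
    (.mul (.mul (.reg 2) (.reg 2)) (.reg 2))
    ⟨⟨by simp [Expr.Fits, hs]; omega, by simp [Expr.Fits, hs]; omega,
      by simp [Expr.eval, hs]; omega⟩, by simp [Expr.Fits, hs]; omega,
      by simp [Expr.eval, hs]; omega⟩
  have e3 := Exec.seq e1 e2
  simp only [Expr.cost, Expr.eval, State.setReg_reg, if_true, hs, h3] at e3
  simpa [setup, State.setup, hs] using e3

/-- This reduces a task to the functional correctness of a command: the remaining conditions on the
command are decidable checks of its syntax. -/
theorem solvableInTime_of_cmd {I : ℕ → Type} {input : ∀ n, I n → State}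
    {Correct : ∀ n, I n → State → Prop} {d : ℕ} (c : Cmd) (hok : c.ok = true)
    (hkeep : c.keepsReg 2 = true) (hd : c.depth ≤ d)
    (hn : ∀ n x, (input n x).reg 0 = n) (hbd : ∀ n x, (input n x).BoundedBy (n + 1))
    (hc : ∀ n x, Correct n x (c.run (input n x).setup)) :
    SolvableInTime I input Correct (fun n => (n : ℝ) ^ d) := by
  -- Cells are bounded by `(n + 2) ^ 3` and intermediate results by its `c.deg`-th power; the extra
  -- `4` gives strict inequality and covers the initialization, which takes `10` time units.
  refine ⟨.seq setup c.compile, 3 * c.deg + 4, fun n => (10 + c.factor) * (n + 2) ^ d, ?_, ?_⟩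
  · refine Asymptotics.IsBigO.of_bound ((10 + c.factor) * 3 ^ d : ℝ) ?_
    filter_upwards [Filter.eventually_ge_atTop 1] with n h1
    have h1' : (1 : ℝ) ≤ n := by exact_mod_cast h1
    rw [Real.norm_of_nonneg (by positivity), Real.norm_of_nonneg (by positivity)]
    push_cast
    rw [mul_assoc, ← mul_pow]
    gcongr
    linarith
  · intro n x
    have hp : ∀ {a b : ℕ}, a ≤ b → (n + 2) ^ a ≤ (n + 2) ^ b :=
      fun h => Nat.pow_le_pow_right (by omega) h
    have h3 : (n + 2) ^ 3 < (n + 2) ^ (3 * c.deg + 4) :=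
      Nat.pow_lt_pow_right (by omega) (by omega)
    have h8 : 8 ≤ (n + 2) ^ 3 := by
      calc 8 = 2 ^ 3 := by norm_num
        _ ≤ _ := Nat.pow_le_pow_left (by omega) 3
    have hW : n + 2 ≤ (n + 2) ^ 3 := Nat.le_self_pow (by omega) _
    have hb : (input n x).setup.BoundedBy ((n + 2) ^ 3) := by
      have hb0 : (input n x).BoundedBy ((n + 2) ^ 3) :=
        ⟨fun y => ((hbd n x).1 y).trans (by omega), fun a k => ((hbd n x).2 a k).trans (by omega)⟩
      simp only [State.setup, hn]
      exact (hb0.setReg hW).setReg le_rfl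
    obtain ⟨t, he, ht, -⟩ := c.exec_run (B := (n + 2) ^ (3 * c.deg + 4)) (W := n + 2) h8 (by omega)
      hW (input n x).setup hok hkeep hb (by simp [State.setup, hn])
      (by rw [← pow_mul]; exact Nat.pow_lt_pow_right (by omega) (by omega))
    refine ⟨_, _, .seq (exec_setup (hn n x) h3) he, ?_, hc n x⟩
    have h1 : 1 ≤ (n + 2) ^ d := Nat.one_le_pow _ _ (by omega)
    have h2 : c.factor * (n + 2) ^ c.depth ≤ c.factor * (n + 2) ^ d :=
      Nat.mul_le_mul_left _ (hp hd)
    show 10 + t ≤ (10 + c.factor) * (n + 2) ^ d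
    rw [add_mul]
    omega

/-! ### Kernels of interval digraphs on the line -/

/-- `K` is a kernel of the digraph `arc` on `S`. -/
structure IsKernelFinset (arc : ℕ → ℕ → Prop) (S K : Finset ℕ) : Prop where
  subset : K ⊆ S
  indep : ∀ k ∈ K, ∀ l ∈ K, ¬ arc k l
  absorb : ∀ u ∈ S, u ∉ K → ∃ k ∈ K, arc u k

/-- Digraphs in which the out-neighbours of every vertex form an interval around it have
kernels. -/
theorem exists_isKernelFinset {arc : ℕ → ℕ → Prop} (hirr : ∀ u, ¬ arc u u)
    (hbet : ∀ u g x, arc u g → (u < x ∧ x < g ∨ g < x ∧ x < u) → arc u x) (S : Finset ℕ) :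
    ∃ K, IsKernelFinset arc S K := by
  classical
  induction S using Finset.strongInduction with
  | H S ih =>
  rcases S.eq_empty_or_nonempty with rfl | hS
  · exact ⟨∅, by simp, by simp, by simp⟩
  set m := S.max' hS with hm
  have hmS : m ∈ S := S.max'_mem hS
  have hlem : ∀ u ∈ S, u ≤ m := fun u hu => S.le_max' u hu
  have hsub : S.erase m ⊂ S := Finset.erase_ssubset hmS
  obtain ⟨K₀, hK₀⟩ := ih _ hsub
  rcases K₀.eq_empty_or_nonempty with rfl | hK₀ne
  · have hall : ∀ u ∈ S, u = m := by
      intro u hu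
      by_contra hne
      obtain ⟨k, hk, -⟩ := hK₀.absorb u (Finset.mem_erase.2 ⟨hne, hu⟩) (by simp)
      simp at hk
    refine ⟨{m}, by simpa using hmS, by simpa using hirr m, fun u hu hn => ?_⟩
    exact absurd (by simpa using hall u hu) hn
  -- Take the largest vertex `i` below the maximum `m` at which some kernel of an initial segment
  -- can end. The proof then depends on the arcs between `i` and `m`.
  let good : ℕ → Prop := fun i => ∃ K, IsKernelFinset arc (S.filter (· ≤ i)) K ∧ i ∈ K
  have hgood₀ : good (K₀.max' hK₀ne) := by
    refine ⟨K₀, ⟨fun k hk => ?_, hK₀.indep, fun u hu hn => ?_⟩, K₀.max'_mem _⟩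
    · exact Finset.mem_filter.2 ⟨Finset.mem_of_mem_erase (hK₀.subset hk), K₀.le_max' k hk⟩
    · have hlt : K₀.max' hK₀ne < m := by
        have := hK₀.subset (K₀.max'_mem hK₀ne)
        exact lt_of_le_of_ne (hlem _ (Finset.mem_of_mem_erase this)) (Finset.ne_of_mem_erase this)
      rw [Finset.mem_filter] at hu
      exact hK₀.absorb u (Finset.mem_erase.2 ⟨by omega, hu.1⟩) hn
  have hne : ((S.erase m).filter good).Nonempty :=
    ⟨_, Finset.mem_filter.2 ⟨hK₀.subset (K₀.max'_mem hK₀ne), hgood₀⟩⟩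
  set i := ((S.erase m).filter good).max' hne with hi
  have himem := ((S.erase m).filter good).max'_mem hne
  rw [← hi, Finset.mem_filter, Finset.mem_erase] at himem
  obtain ⟨⟨him, hiS⟩, K, hK, hiK⟩ := himem
  have him' : i < m := lt_of_le_of_ne (hlem i hiS) him
  have hmax : ∀ x ∈ S, x < m → good x → x ≤ i := fun x hx hxm hg =>
    Finset.le_max' _ x (Finset.mem_filter.2 ⟨Finset.mem_erase.2 ⟨hxm.ne, hx⟩, hg⟩)
  have hKle : ∀ k ∈ K, k ∈ S ∧ k ≤ i := fun k hk => Finset.mem_filter.1 (hK.subset hk)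
  -- The kernel `K₀` of `S` without `m` ends at or before `i`, so `u` has an arc to a vertex that is
  -- not to the right of `i`, and hence to `i`. Thus `K` absorbs everything except possibly `m`.
  have hgap : ∀ u ∈ S, i < u → u < m → arc u i := by
    intro u hu hiu hum
    have hle : ∀ k ∈ K₀, k ≤ i := fun k hk => by
      have h1 := hK₀.subset (K₀.max'_mem hK₀ne)
      have h2 := hmax _ (Finset.mem_of_mem_erase h1)
        (lt_of_le_of_ne (hlem _ (Finset.mem_of_mem_erase h1)) (Finset.ne_of_mem_erase h1)) hgood₀
      exact (K₀.le_max' k hk).trans h2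
    obtain ⟨k, hk, hak⟩ := hK₀.absorb u (Finset.mem_erase.2 ⟨hum.ne, hu⟩)
      (fun h => by have := hle u h; omega)
    rcases (hle k hk).eq_or_lt with rfl | h
    · exact hak
    · exact hbet u k i hak (Or.inr ⟨h, hiu⟩)
  have hKabs : ∀ u ∈ S, u ≠ m → u ∉ K → ∃ k ∈ K, arc u k := by
    intro u hu hum hn
    by_cases h : u ≤ i
    · exact hK.absorb u (Finset.mem_filter.2 ⟨hu, h⟩) hn
    · exact ⟨i, hiK, hgap u hu (by omega) (lt_of_le_of_ne (hlem u hu) hum)⟩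
  by_cases hmi : arc m i
  · refine ⟨K, fun k hk => (hKle k hk).1, hK.indep, fun u hu hn => ?_⟩
    by_cases h : u = m
    · exact ⟨i, hiK, h ▸ hmi⟩
    · exact hKabs u hu h hn
  by_cases him2 : arc i m
  -- Put `m` into the kernel and take a kernel of the vertices that `m` does not absorb; only an arc
  -- from `m` into `K'` can spoil independence.
  · obtain ⟨K', hK'⟩ := ih ((S.erase m).filter fun u => ¬ arc u m)
      (lt_of_le_of_lt (Finset.filter_subset _ _) hsub)
    have hK'S : ∀ k ∈ K', (k ≠ m ∧ k ∈ S) ∧ ¬ arc k m := fun k hk => by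
      simpa using hK'.subset hk
    by_cases hl : ∃ l ∈ K', arc m l
    · exfalso
      obtain ⟨l, hlK, hml⟩ := hl
      -- Such an arc would make the maximum `k` of `K'` good and larger than `i`: a vertex before
      -- `k` with an arc to `m` has an arc to `k` as well, so `K'` is a kernel of the initial
      -- segment up to `k`.
      set k := K'.max' ⟨l, hlK⟩ with hk
      have hkK : k ∈ K' := K'.max'_mem _
      obtain ⟨⟨hkm, hkS⟩, hkarc⟩ := hK'S k hkK
      have hkm' : k < m := lt_of_le_of_ne (hlem k hkS) hkm
      have hmk : arc m k := by
        rcases (K'.le_max' l hlK).eq_or_lt with h | h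
        · rw [hk, ← h]; exact hml
        · exact hbet m l k hml (Or.inr ⟨h, hkm'⟩)
      have hik : i < k := by
        by_contra h
        rcases (not_lt.1 h).eq_or_lt with h | h
        · exact hmi (h ▸ hmk)
        · exact hmi (hbet m k i hmk (Or.inr ⟨h, him'⟩))
      have : good k := by
        refine ⟨K', ⟨fun x hx => ?_, hK'.indep, fun u hu hn => ?_⟩, hkK⟩
        · exact Finset.mem_filter.2 ⟨(hK'S x hx).1.2, K'.le_max' x hx⟩
        · rw [Finset.mem_filter] at hu
          by_cases hum : arc u m
          · refine ⟨k, hkK, hbet u m k hum (Or.inl ⟨lt_of_le_of_ne hu.2 ?_, hkm'⟩)⟩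
            rintro rfl
            exact hkarc hum
          · refine hK'.absorb u ?_ hn
            simp only [Finset.mem_filter, Finset.mem_erase]
            exact ⟨⟨by omega, hu.1⟩, hum⟩
      have := hmax k hkS hkm' this
      omega
    · push Not at hl
      refine ⟨insert m K', ?_, ?_, ?_⟩
      · intro x hx
        rcases Finset.mem_insert.1 hx with rfl | hx
        exacts [hmS, (hK'S x hx).1.2]
      · intro k hk l hl'
        rcases Finset.mem_insert.1 hk with rfl | hk <;>
          rcases Finset.mem_insert.1 hl' with rfl | hl'
        exacts [hirr _, hl l hl', (hK'S k hk).2, hK'.indep k hk l hl']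
      · intro u hu hn
        rw [Finset.mem_insert, not_or] at hn
        by_cases hum : arc u m
        · exact ⟨m, by simp, hum⟩
        · obtain ⟨k, hk, hak⟩ := hK'.absorb u (by simp [hu, hn.1, hum]) hn.2
          exact ⟨k, by simp [hk], hak⟩
  -- With no arc between `i` and `m` there is none between `m` and any element of `K`, since all of
  -- them lie behind `i`.
  · refine ⟨insert m K, ?_, ?_, ?_⟩
    · intro x hx
      rcases Finset.mem_insert.1 hx with rfl | hx
      exacts [hmS, (hKle x hx).1]
    · intro k hk l hl
      rcases Finset.mem_insert.1 hk with rfl | hk <;> rcases Finset.mem_insert.1 hl with rfl | hl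
      · exact hirr _
      · intro h
        rcases (hKle l hl).2.eq_or_lt with rfl | hlt
        · exact hmi h
        · exact hmi (hbet _ _ _ h (Or.inr ⟨hlt, him'⟩))
      · intro h
        rcases (hKle k hk).2.eq_or_lt with rfl | hlt
        · exact him2 h
        · exact hK.indep k hk i hiK (hbet _ _ _ h (Or.inl ⟨hlt, him'⟩))
      · exact hK.indep k hk l hl
    · intro u hu hn
      rw [Finset.mem_insert, not_or] at hn
      obtain ⟨k, hk, hak⟩ := hKabs u hu hn.1 hn.2
      exact ⟨k, by simp [hk], hak⟩

/-! ### Tables of positions -/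

/-- The table of the positions of the alternatives (`0`: abstention, `1, …, n`: the voters,
`n + 1`: abstention again) in the preference lists of the voters `1, …, n`; the rows `0` and `n + 1`
belong to the source and the sink of the auxiliary digraph. -/
structure PrefTable (n : ℕ) (pos : ℕ → ℕ → ℕ) : Prop where
  outside : ∀ u g, u = 0 ∨ n < u → pos u g = 0
  top : ∀ u, pos u (n + 1) = pos u 0
  right : ∀ u j k, 0 < u → u < j → j < k → k ≤ n → pos u j < pos u k
  left : ∀ u j k, 0 < k → k < j → j < u → u ≤ n → pos u j < pos u k
  inj : ∀ u g h, 0 < u → u ≤ n → g ≤ n → h ≤ n → pos u g = pos u h → g = h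
  le : ∀ u g, pos u g ≤ n

/-- An arc of the delegation-acceptability digraph (for a non-abstainer `u`). -/
def Arc (pos : ℕ → ℕ → ℕ) (u g : ℕ) : Prop := pos u g < pos u u

/-- The voter `u` is not an abstainer. -/
def Active (pos : ℕ → ℕ → ℕ) (u : ℕ) : Prop := ¬ pos u 0 < pos u u

instance (pos : ℕ → ℕ → ℕ) (u g : ℕ) : Decidable (Arc pos u g) :=
  inferInstanceAs (Decidable (_ < _))

instance (pos : ℕ → ℕ → ℕ) (u : ℕ) : Decidable (Active pos u) :=
  inferInstanceAs (Decidable (¬ _))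

/-- The arcs of the auxiliary digraph, including an arc from the source to the sink if all voters
are abstainers. -/
def Link (pos : ℕ → ℕ → ℕ) (i j : ℕ) : Prop :=
  i < j ∧ Active pos i ∧ Active pos j ∧ ¬ Arc pos i j ∧ ¬ Arc pos j i ∧
    ∀ u, i < u → u < j → Active pos u → Arc pos u i ∨ Arc pos u j

/-- `K` contains `0` and `j` and is a kernel of the subgraph on `0, …, j`. -/
structure PartialKernel (pos : ℕ → ℕ → ℕ) (j : ℕ) (K : Finset ℕ) : Prop where
  zero_mem : 0 ∈ K
  mem : j ∈ K
  le : ∀ k ∈ K, k ≤ j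
  active : ∀ k ∈ K, Active pos k
  indep : ∀ k ∈ K, ∀ l ∈ K, ¬ Arc pos k l
  absorb : ∀ u ≤ j, Active pos u → u ∉ K → ∃ k ∈ K, Arc pos u k

section

variable {n : ℕ} {pos : ℕ → ℕ → ℕ}

theorem not_arc_self (u : ℕ) : ¬ Arc pos u u := lt_irrefl _

theorem PrefTable.not_arc_outside (hT : PrefTable n pos) {u g : ℕ} (hu : u = 0 ∨ n < u) :
    ¬ Arc pos u g := by
  simp [Arc, hT.outside u _ hu]

theorem PrefTable.active_outside (hT : PrefTable n pos) {u : ℕ} (hu : u = 0 ∨ n < u) :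
    Active pos u := by
  simp [Active, hT.outside u _ hu]

/-- This is the form in which single-peakedness is mostly used. The head `g` cannot be one of the
two ends, because those count as abstention and `u` is active; hence it is a voter, and `x` is
nearer to `u`. -/
theorem PrefTable.arc_of_between (hT : PrefTable n pos) {u g x : ℕ} (hu : Active pos u)
    (hg : g ≤ n + 1) (h : Arc pos u g) (hx : u < x ∧ x < g ∨ g < x ∧ x < u) : Arc pos u x := by
  have h0 : ¬ (u = 0 ∨ n < u) := fun h' => hT.not_arc_outside h' h
  have hg0 : g ≠ 0 := fun h' => hu (h' ▸ h)
  have hgn : g ≠ n + 1 := by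
    rintro rfl
    unfold Arc at h
    rw [hT.top] at h
    exact hu h
  rcases hx with hx | hx
  · exact (hT.right u x g (by omega) hx.1 hx.2 (by omega)).trans h
  · exact (hT.left u x g (by omega) hx.1 hx.2 (by omega)).trans h

/-- The two ends have no outgoing arcs, so absorption forces them into every kernel of the active
vertices. -/
theorem PrefTable.exists_partialKernel (hT : PrefTable n pos) :
    ∃ K, PartialKernel pos (n + 1) K := by
  classical
  obtain ⟨K, hK⟩ := exists_isKernelFinset
    (arc := fun u g => Active pos u ∧ g ≤ n + 1 ∧ Arc pos u g)
    (fun u h => not_arc_self u h.2.2)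
    (fun u g x h hx => ⟨h.1, by
      have h0 : ¬ (u = 0 ∨ n < u) := fun h' => hT.not_arc_outside h' h.2.2
      have := h.2.1
      omega, hT.arc_of_between h.1 h.2.1 h.2.2 hx⟩)
    ((Finset.range (n + 2)).filter (Active pos))
  have hmem : ∀ k ∈ K, k ≤ n + 1 ∧ Active pos k := fun k hk => by
    have := hK.subset hk
    rw [Finset.mem_filter, Finset.mem_range] at this
    exact ⟨by omega, this.2⟩
  have hout : ∀ u, u ≤ n + 1 → (u = 0 ∨ n < u) → u ∈ K := by
    intro u hu hu'
    by_contra hn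
    obtain ⟨k, hk, -, -, h⟩ := hK.absorb u
      (Finset.mem_filter.2 ⟨Finset.mem_range.2 (by omega), hT.active_outside hu'⟩) hn
    exact hT.not_arc_outside hu' h
  refine ⟨K, hout 0 (by omega) (by simp), hout _ le_rfl (by omega), fun k hk => (hmem k hk).1,
    fun k hk => (hmem k hk).2, fun k hk l hl h => ?_, fun u hu ha hn => ?_⟩
  · exact hK.indep k hk l hl ⟨(hmem k hk).2, (hmem l hl).1, h⟩
  · obtain ⟨k, hk, -, -, h⟩ := hK.absorb u
      (Finset.mem_filter.2 ⟨Finset.mem_range.2 (by omega), ha⟩) hn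
    exact ⟨k, hk, h⟩

theorem PrefTable.partialKernel_zero (hT : PrefTable n pos) : PartialKernel pos 0 {0} where
  zero_mem := by simp
  mem := by simp
  le := by simp
  active := by simpa using hT.active_outside (Or.inl rfl)
  indep := by simpa using not_arc_self 0
  absorb := by
    intro u hu _ hn
    simp at hn
    omega

/-- An arc between `j` and an element of `K` other than `i` would jump over `i`. It would then yield
an arc from `j` to `i`, or one inside `K`, and both are excluded. -/
theorem PartialKernel.insert (hT : PrefTable n pos) {i j : ℕ} {K : Finset ℕ}
    (hK : PartialKernel pos i K) (hij : Link pos i j) (hj : j ≤ n + 1) :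
    PartialKernel pos j (insert j K) := by
  obtain ⟨hlt, hi, hja, hnij, hnji, hgap⟩ := hij
  refine ⟨by simp [hK.zero_mem], by simp, fun k hk => ?_, fun k hk => ?_, fun k hk l hl => ?_,
    fun u hu ha hn => ?_⟩
  · rcases Finset.mem_insert.1 hk with rfl | hk
    · exact le_rfl
    · exact (hK.le k hk).trans hlt.le
  · rcases Finset.mem_insert.1 hk with rfl | hk
    exacts [hja, hK.active k hk]
  · rcases Finset.mem_insert.1 hk with rfl | hkK <;> rcases Finset.mem_insert.1 hl with rfl | hlK
    · exact not_arc_self _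
    · intro h
      rcases (hK.le l hlK).eq_or_lt with rfl | hl'
      · exact hnji h
      · exact hnji (hT.arc_of_between hja (by omega) h (Or.inr ⟨hl', hlt⟩))
    · intro h
      rcases (hK.le k hkK).eq_or_lt with rfl | hk'
      · exact hnij h
      · exact hK.indep k hkK i hK.mem
          (hT.arc_of_between (hK.active k hkK) hj h (Or.inl ⟨hk', hlt⟩))
    · exact hK.indep k hkK l hlK
  · rw [Finset.mem_insert, not_or] at hn
    by_cases hui : u ≤ i
    · obtain ⟨k, hk, h⟩ := hK.absorb u hui ha hn.2
      exact ⟨k, by simp [hk], h⟩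
    · rcases hgap u (by omega) (by omega) ha with h | h
      · exact ⟨i, by simp [hK.mem], h⟩
      · exact ⟨j, by simp, h⟩

/-- The predecessor is the largest element of `K` other than `j`. A vertex before it that was
absorbed by `j` is absorbed by the predecessor, and a vertex after it that was absorbed from further
left is absorbed by the predecessor, too. -/
theorem PartialKernel.exists_pred (hT : PrefTable n pos) {j : ℕ} {K : Finset ℕ}
    (hK : PartialKernel pos j K) (hj : j ≤ n + 1) (h0 : 0 < j) :
    ∃ i K', PartialKernel pos i K' ∧ Link pos i j ∧ K = Insert.insert j K' := by
  have hne : (K.erase j).Nonempty := ⟨0, Finset.mem_erase.2 ⟨by omega, hK.zero_mem⟩⟩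
  set i := (K.erase j).max' hne with hi
  have hiK := Finset.mem_erase.1 ((K.erase j).max'_mem hne)
  rw [← hi] at hiK
  have hlt : i < j := lt_of_le_of_ne (hK.le i hiK.2) hiK.1
  have hle : ∀ k ∈ K, k ≠ j → k ≤ i := fun k hk hkj =>
    (K.erase j).le_max' k (Finset.mem_erase.2 ⟨hkj, hk⟩)
  refine ⟨i, K.erase j, ⟨Finset.mem_erase.2 ⟨by omega, hK.zero_mem⟩, Finset.mem_erase.2 hiK,
    fun k hk => (K.erase j).le_max' k hk, fun k hk => hK.active k (Finset.mem_of_mem_erase hk),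
    fun k hk l hl => hK.indep k (Finset.mem_of_mem_erase hk) l (Finset.mem_of_mem_erase hl),
    fun u hu ha hn => ?_⟩, ⟨hlt, hK.active i hiK.2, hK.active j hK.mem,
      hK.indep i hiK.2 j hK.mem, hK.indep j hK.mem i hiK.2, fun u hu huj ha => ?_⟩,
      (Finset.insert_erase hK.mem).symm⟩
  · have huK : u ∉ K := fun h => hn (Finset.mem_erase.2 ⟨by omega, h⟩)
    obtain ⟨k, hk, h⟩ := hK.absorb u (by omega) ha huK
    by_cases hkj : k = j
    · subst hkj
      have hui : u ≠ i := fun h' => huK (h' ▸ hiK.2)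
      exact ⟨i, Finset.mem_erase.2 hiK,
        hT.arc_of_between ha hj h (Or.inl ⟨by omega, hlt⟩)⟩
    · exact ⟨k, Finset.mem_erase.2 ⟨hkj, hk⟩, h⟩
  · have huK : u ∉ K := fun h => by have := hle u h (by omega); omega
    obtain ⟨k, hk, h⟩ := hK.absorb u (by omega) ha huK
    by_cases hkj : k = j
    · exact Or.inr (hkj ▸ h)
    · left
      rcases (hle k hk hkj).eq_or_lt with h' | h'
      · exact h' ▸ h
      · exact hT.arc_of_between ha ((hle k hk hkj).trans (by omega)) h (Or.inr ⟨h', hu⟩)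

/-! ### Reachability -/

/-- The second vertex can be reached from the first by links. -/
abbrev Reach (pos : ℕ → ℕ → ℕ) : ℕ → ℕ → Prop := Relation.ReflTransGen (Link pos)

theorem PartialKernel.exists_of_reach (hT : PrefTable n pos) {i j : ℕ} {K : Finset ℕ}
    (hK : PartialKernel pos i K) (hij : Reach pos i j) (hj : j ≤ n + 1) :
    ∃ K', PartialKernel pos j K' ∧ K ⊆ K' := by
  induction hij with
  | refl => exact ⟨K, hK, subset_rfl⟩
  | tail _ h ih =>
    obtain ⟨K', hK', hsub⟩ := ih (h.1.le.trans hj)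
    exact ⟨_, hK'.insert hT h hj, hsub.trans (Finset.subset_insert _ _)⟩

theorem PartialKernel.reach (hT : PrefTable n pos) {i j : ℕ} {K : Finset ℕ}
    (hK : PartialKernel pos j K) (hi : i ∈ K) (hj : j ≤ n + 1) : Reach pos i j := by
  induction j using Nat.strong_induction_on generalizing K with
  | _ j ih =>
  by_cases hij : i = j
  · exact hij ▸ .refl
  have := hK.le i hi
  obtain ⟨m, K', hK', hm, rfl⟩ := hK.exists_pred hT hj (by omega)
  exact (ih m hm.1 hK' (by simpa [hij] using hi) (hm.1.le.trans hj)).tail hm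

/-- Kernels are paths from end to end, and a path to `i` can be joined with any path from `i`
because the link condition is local. -/
theorem PrefTable.exists_partialKernel_mem_iff (hT : PrefTable n pos) {i : ℕ} (hi : i ≤ n + 1) :
    (∃ K, PartialKernel pos (n + 1) K ∧ i ∈ K) ↔ Reach pos 0 i ∧ Reach pos i (n + 1) := by
  constructor
  · rintro ⟨K, hK, hiK⟩
    refine ⟨?_, hK.reach hT hiK le_rfl⟩
    clear hi
    -- The last vertex has to vary for the induction, which strips the kernel from the right.
    suffices ∀ j ≤ n + 1, ∀ K, PartialKernel pos j K → ∀ i ∈ K, Reach pos 0 i from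
      this _ le_rfl K hK i hiK
    intro j
    induction j using Nat.strong_induction_on with
    | _ j ih =>
    intro hj K hK i hi
    by_cases hij : i = j
    · exact hij ▸ hK.reach hT hK.zero_mem hj
    have := hK.le i hi
    obtain ⟨m, K', hK', hm, rfl⟩ := hK.exists_pred hT hj (by omega)
    exact ih m hm.1 (hm.1.le.trans hj) K' hK' i (by simpa [hij] using hi)
  · rintro ⟨h0, h1⟩
    obtain ⟨K, hK, -⟩ := hT.partialKernel_zero.exists_of_reach hT h0 hi
    obtain ⟨K', hK', hsub⟩ := hK.exists_of_reach hT h1 le_rfl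
    exact ⟨K', hK', hsub hK.mem⟩

/-! ### Valued paths -/

/-- `ValuedPath E op L R j k K v`: there is an `E`-path from `0` to `j` with vertex set `K` whose
value is `v` if the next vertex is `k`. The value is combined by `op` from the contributions
`L i j + R j k` of the vertices `j` with predecessor `i` and successor `k`. -/
inductive ValuedPath (E : ℕ → ℕ → Prop) (op L R : ℕ → ℕ → ℕ) : ℕ → ℕ → Finset ℕ → ℕ → Prop where
  | base (k : ℕ) : ValuedPath E op L R 0 k {0} 0
  | step {i j : ℕ} {K : Finset ℕ} {v : ℕ} (k : ℕ) (h : ValuedPath E op L R i j K v)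
      (hij : E i j) : ValuedPath E op L R j k (insert j K) (op v (L i j + R j k))

/-- The measure `m j k K` of the partial kernels `K` on `0, …, j` with next element `k` is computed
along paths; the next element of the last one is by convention `0`. -/
structure PathMeasure (n : ℕ) (pos : ℕ → ℕ → ℕ) (op L R : ℕ → ℕ → ℕ)
    (m : ℕ → ℕ → Finset ℕ → ℕ) : Prop where
  zero : ∀ k, m 0 k {0} = 0
  insert : ∀ i j k K, PartialKernel pos i K → Link pos i j → j ≤ n + 1 → k ≤ n + 1 →
    (Link pos j k ∨ k = 0) → m j k (insert j K) = op (m i j K) (L i j + R j k)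

/-- With its converse `PartialKernel.valuedPath`, this translates minimizing a measure over kernels
into minimizing the value of a path. -/
theorem ValuedPath.partialKernel (hT : PrefTable n pos) {op L R : ℕ → ℕ → ℕ}
    {m : ℕ → ℕ → Finset ℕ → ℕ} (hm : PathMeasure n pos op L R m) {j k v : ℕ} {K : Finset ℕ}
    (h : ValuedPath (Link pos) op L R j k K v) (hj : j ≤ n + 1) (hk : k ≤ n + 1)
    (hjk : Link pos j k ∨ k = 0) : PartialKernel pos j K ∧ v = m j k K := by
  induction h with
  | base k => exact ⟨hT.partialKernel_zero, (hm.zero k).symm⟩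
  | step k h hij ih =>
    obtain ⟨hK, rfl⟩ := ih (hij.1.le.trans hj) hj (Or.inl hij)
    exact ⟨hK.insert hT hij hj, (hm.insert _ _ _ _ hK hij hj hk hjk).symm⟩

theorem PartialKernel.valuedPath (hT : PrefTable n pos) {op L R : ℕ → ℕ → ℕ}
    {m : ℕ → ℕ → Finset ℕ → ℕ} (hm : PathMeasure n pos op L R m) {j : ℕ} {K : Finset ℕ}
    (hK : PartialKernel pos j K) {k : ℕ} (hj : j ≤ n + 1) (hk : k ≤ n + 1)
    (hjk : Link pos j k ∨ k = 0) : ValuedPath (Link pos) op L R j k K (m j k K) := by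
  induction j using Nat.strong_induction_on generalizing K k with
  | _ j ih =>
  rcases Nat.eq_zero_or_pos j with rfl | h0
  · have : K = {0} := by
      ext x
      rw [Finset.mem_singleton]
      exact ⟨fun hx => by have := hK.le x hx; omega, fun hx => hx ▸ hK.mem⟩
    subst this
    rw [hm.zero]
    exact .base k
  · obtain ⟨i, K', hK', hij, rfl⟩ := hK.exists_pred hT hj h0
    rw [hm.insert i j k K' hK' hij hj hk hjk]
    exact .step k (ih i hij.1 hK' (hij.1.le.trans hj) hj (Or.inl hij)) hij

/-! ### The three measures -/

/-- The position of the best element of `K` (or abstention) in the list of `u`. -/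
def bestPos (pos : ℕ → ℕ → ℕ) (u : ℕ) (K : Finset ℕ) : ℕ := K.fold min (pos u 0) (pos u)

theorem le_bestPos {u c : ℕ} {K : Finset ℕ} :
    c ≤ bestPos pos u K ↔ c ≤ pos u 0 ∧ ∀ g ∈ K, c ≤ pos u g := Finset.le_fold_min c

/-- The share of voter `u` in an additive cost, between the consecutive elements `i` and `j`. -/
def localCost (pos φ : ℕ → ℕ → ℕ) (u i j : ℕ) : ℕ :=
  φ u (min (pos u 0) (min (pos u i) (pos u j)))

/-- For voters up to `i` the new element `j` is hidden behind `i`, or is abstention if it is the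
right end; at `u = i` the absence of an arc from `i` to `j` is needed. For voters between `i` and
`j` all older elements are hidden behind `i`. -/
theorem PrefTable.bestPos_insert (hT : PrefTable n pos) {i j u : ℕ} {K : Finset ℕ}
    (hK : PartialKernel pos i K) (hij : Link pos i j) (hj : j ≤ n + 1) (hu0 : 0 < u)
    (hun : u ≤ n) (huj : u ≤ j) :
    bestPos pos u (insert j K) =
      if u ≤ i then bestPos pos u K else min (pos u 0) (min (pos u i) (pos u j)) := by
  refine eq_of_forall_le_iff fun c => ?_
  rw [le_bestPos]
  split_ifs with h
  · rw [le_bestPos]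
    refine ⟨fun hc => ⟨hc.1, fun g hg => hc.2 g (by simp [hg])⟩, fun hc => ⟨hc.1, fun g hg => ?_⟩⟩
    rcases Finset.mem_insert.1 hg with rfl | hg
    · by_cases hgn : g = n + 1
      · rw [hgn, hT.top]; exact hc.1
      · refine (hc.2 i hK.mem).trans ?_
        rcases h.eq_or_lt with rfl | h
        · exact not_lt.1 hij.2.2.2.1
        · exact (hT.right u i g hu0 h hij.1 (by omega)).le
    · exact hc.2 g hg
  · rw [le_min_iff, le_min_iff]
    refine ⟨fun hc => ⟨hc.1, hc.2 i (by simp [hK.mem]), hc.2 j (by simp)⟩,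
      fun hc => ⟨hc.1, fun g hg => ?_⟩⟩
    rcases Finset.mem_insert.1 hg with rfl | hg
    · exact hc.2.2
    · rcases Nat.eq_zero_or_pos g with rfl | hg0
      · exact hc.1
      · rcases (hK.le g hg).eq_or_lt with rfl | hgi
        · exact hc.2.1
        · exact hc.2.1.trans (hT.left u i g hg0 hgi (by omega) hun).le

/-- An additive measure: the total cost of the voters up to `j`. -/
def sumMeasure (n : ℕ) (pos φ : ℕ → ℕ → ℕ) (j _k : ℕ) (K : Finset ℕ) : ℕ :=
  ∑ u ∈ (Finset.range (n + 2)).filter (fun u => 0 < u ∧ u ≤ n ∧ u ≤ j), φ u (bestPos pos u K)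

/-- The contribution of the voters in `(i, j]`. -/
def sumLeft (n : ℕ) (c : ℕ → ℕ → ℕ → ℕ) (i j : ℕ) : ℕ :=
  ∑ u ∈ (Finset.range (n + 2)).filter (fun u => u ≤ n ∧ i < u ∧ u ≤ j), c u i j

/-- The contribution of the voters in `(j, k)`. -/
def sumRight (n : ℕ) (c : ℕ → ℕ → ℕ → ℕ) (j k : ℕ) : ℕ :=
  ∑ u ∈ (Finset.range (n + 2)).filter (fun u => u ≤ n ∧ j < u ∧ u < k), c u j k

/-- The voters in `(i, j]` are charged to the link from `i` to `j`; their costs are settled at this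
moment, so nothing depends on the next vertex. -/
theorem PrefTable.pathMeasure_sum (hT : PrefTable n pos) (φ : ℕ → ℕ → ℕ) :
    PathMeasure n pos (· + ·) (sumLeft n (localCost pos φ)) (sumRight n fun _ _ _ => 0)
      (sumMeasure n pos φ) where
  zero k := by
    unfold sumMeasure
    rw [Finset.sum_eq_zero]
    intro u hu
    simp at hu
    omega
  insert i j k K hK hij hj _ _ := by
    have hlt := hij.1
    simp only [sumRight, Finset.sum_const_zero, add_zero, sumMeasure, sumLeft]
    rw [← Finset.sum_filter_add_sum_filter_not
      ((Finset.range (n + 2)).filter fun u => 0 < u ∧ u ≤ n ∧ u ≤ j) (fun u => u ≤ i)]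
    rw [Finset.filter_filter, Finset.filter_filter]
    congr 1
    · refine Finset.sum_congr (Finset.filter_congr fun u _ => by omega) fun u hu => ?_
      simp only [Finset.mem_filter] at hu
      rw [hT.bestPos_insert hK hij hj (by omega) (by omega) (by omega), if_pos (by omega)]
    · refine Finset.sum_congr (Finset.filter_congr fun u _ => by omega) fun u hu => ?_
      simp only [Finset.mem_filter] at hu
      rw [hT.bestPos_insert hK hij hj (by omega) (by omega) (by omega), if_neg (by omega),
        localCost]

/-- Voter `u` strictly prefers `x` to abstention and to all other elements of `K`. -/
def Best (pos : ℕ → ℕ → ℕ) (u x : ℕ) (K : Finset ℕ) : Prop :=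
  pos u x < pos u 0 ∧ ∀ g ∈ K, g ≠ x → pos u x < pos u g

instance (u x : ℕ) (K : Finset ℕ) : Decidable (Best pos u x K) :=
  inferInstanceAs (Decidable (_ ∧ _))

/-- The number of voters below `k` or up to `j` whose best element is `x`. -/
def power (n : ℕ) (pos : ℕ → ℕ → ℕ) (j k x : ℕ) (K : Finset ℕ) : ℕ :=
  ((Finset.range (n + 2)).filter
    fun u => 0 < u ∧ u ≤ n ∧ (u ≤ j ∨ u < k) ∧ Best pos u x (insert k K)).card

/-- The maximal power of an element of `K`. -/
def powerMeasure (n : ℕ) (pos : ℕ → ℕ → ℕ) (j k : ℕ) (K : Finset ℕ) : ℕ :=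
  K.sup fun x => power n pos j k x K

/-- Voter `u` supports `x` rather than `y` or abstention. -/
def support (pos : ℕ → ℕ → ℕ) (u x y : ℕ) : ℕ :=
  if pos u x < pos u 0 ∧ pos u x < pos u y then 1 else 0

/-- Once its successor is known, the power of an element is final: no voter from `j` on has the
earlier `x` as best element, and for a voter before `j` the next vertex `k` is hidden behind `j`, or
is abstention. -/
theorem PrefTable.power_insert_of_mem (hT : PrefTable n pos) {i j k x : ℕ} {K : Finset ℕ}
    (hK : PartialKernel pos i K) (hij : Link pos i j) (hj : j ≤ n + 1) (hk : k ≤ n + 1)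
    (hjk : Link pos j k ∨ k = 0) (hx : x ∈ K) :
    power n pos j k x (insert j K) = power n pos i j x K := by
  have hlt := hij.1
  have hxi := hK.le x hx
  unfold power
  congr 1
  refine Finset.filter_congr fun u _ => ?_
  constructor
  · rintro ⟨h0, hn, -, hb⟩
    refine ⟨h0, hn, Or.inr ?_, hb.1, fun g hg => hb.2 g (Finset.mem_insert_of_mem hg)⟩
    by_contra hju
    have h1 := hb.2 j (by simp) (by omega)
    have hx0 : x ≠ 0 := by rintro rfl; exact lt_irrefl _ hb.1
    rcases (not_lt.1 hju).eq_or_lt with rfl | h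
    · have h2 : ¬ Arc pos j x := (hK.insert hT hij hj).indep j (by simp) x (by simp [hx])
      exact h2 h1
    · have := hT.left u j x (by omega) (by omega) h hn
      omega
  · rintro ⟨h0, hn, hu, hb⟩
    have huj : u < j := by omega
    refine ⟨h0, hn, Or.inl huj.le, hb.1, fun g hg hgx => ?_⟩
    rcases Finset.mem_insert.1 hg with rfl | hg
    · rcases hjk with hjk | rfl
      · by_cases hgn : g = n + 1
        · rw [hgn, hT.top]; exact hb.1
        · exact (hb.2 j (by simp) (by omega)).trans
            (hT.right u j g h0 huj hjk.1 (by omega))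
      · exact hb.1
    · exact hb.2 g hg hgx

/-- The supporters of `j` lie strictly between its neighbours `i` and `k`. Those up to `j` need only
compare with `i`, those after `j` only with `k`, and both with abstention. -/
theorem PrefTable.power_insert_self (hT : PrefTable n pos) {i j k : ℕ} {K : Finset ℕ}
    (hK : PartialKernel pos i K) (hij : Link pos i j) (hj : j ≤ n + 1) (hk : k ≤ n + 1)
    (hjk : Link pos j k ∨ k = 0) :
    power n pos j k j (insert j K) =
      sumLeft n (fun u i j => support pos u j i) i j + sumRight n (support pos) j k := by
  have hlt := hij.1
  unfold power sumLeft sumRight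
  rw [← Finset.card_filter_add_card_filter_not (fun u => u ≤ j), Finset.filter_filter,
    Finset.filter_filter, Finset.card_filter, Finset.card_filter, Finset.sum_filter,
    Finset.sum_filter]
  have hKj : ∀ g ∈ insert k (insert j K), g ≠ j → g = k ∨ g ∈ K := by
    intro g hg hgj
    simpa [hgj] using hg
  congr 1
  · refine Finset.sum_congr rfl fun u _ => ?_
    simp only [support, ← ite_and]
    congr 1
    rw [eq_iff_iff]
    constructor
    · rintro ⟨⟨h0, hn, -, hb⟩, huj⟩
      have hb1 := hb.2 i (by simp [hK.mem]) (by omega)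
      refine ⟨⟨hn, ?_, huj⟩, hb.1, hb1⟩
      by_contra hiu
      rcases (not_lt.1 hiu).eq_or_lt with rfl | h
      · exact hij.2.2.2.1 hb1
      · have hjn : j ≠ n + 1 := by
          rintro rfl
          have := hb.1
          rw [hT.top] at this
          exact lt_irrefl _ this
        have := hT.right u i j h0 h hlt (by omega)
        omega
    · rintro ⟨⟨hn, hiu, huj⟩, hb0, hb1⟩
      refine ⟨⟨by omega, hn, Or.inl huj, hb0, fun g hg hgj => ?_⟩, huj⟩
      rcases hKj g hg hgj with rfl | hg
      · rcases hjk with hjk | rfl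
        · by_cases hgn : g = n + 1
          · rw [hgn, hT.top]; exact hb0
          · rcases huj.eq_or_lt with rfl | huj
            -- For the voter `j` herself, the missing arc to `k` gives only a weak inequality;
            -- distinct alternatives have distinct positions.
            · refine lt_of_le_of_ne (not_lt.1 hjk.2.2.2.1) fun h => ?_
              exact hgj (hT.inj u _ _ (by omega) hn hn (by omega) h).symm
            · exact hT.right u j g (by omega) huj hjk.1 (by omega)
        · exact hb0
      · rcases Nat.eq_zero_or_pos g with rfl | hg0
        · exact hb0
        · rcases (hK.le g hg).eq_or_lt with rfl | hgi
          · exact hb1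
          · exact hb1.trans (hT.left u i g hg0 hgi hiu hn)
  · refine Finset.sum_congr rfl fun u _ => ?_
    simp only [support, ← ite_and]
    congr 1
    rw [eq_iff_iff]
    constructor
    · rintro ⟨⟨h0, hn, hu, hb⟩, huj⟩
      have huk : u < k := by omega
      exact ⟨⟨hn, by omega, huk⟩, hb.1, hb.2 k (by simp) (by omega)⟩
    · rintro ⟨⟨hn, hju, huk⟩, hb0, hb1⟩
      refine ⟨⟨by omega, hn, Or.inr huk, hb0, fun g hg hgj => ?_⟩, by omega⟩
      rcases hKj g hg hgj with rfl | hg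
      · exact hb1
      · rcases Nat.eq_zero_or_pos g with rfl | hg0
        · exact hb0
        · exact hT.left u j g hg0 (by have := hK.le g hg; omega) hju hn

/-- The power of `j` depends on its successor `k`, which is why values of paths are indexed by a
vertex together with the next one. -/
theorem PrefTable.pathMeasure_power (hT : PrefTable n pos) :
    PathMeasure n pos max (sumLeft n fun u i j => support pos u j i) (sumRight n (support pos))
      (powerMeasure n pos) where
  zero k := by
    simp only [powerMeasure, Finset.sup_singleton, power, Finset.card_eq_zero]
    refine Finset.filter_eq_empty_iff.2 fun u _ h => ?_
    exact lt_irrefl _ h.2.2.2.1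
  insert i j k K hK hij hj hk hjk := by
    unfold powerMeasure
    rw [Finset.sup_insert, max_comm, hT.power_insert_self hK hij hj hk hjk]
    congr 1
    exact Finset.sup_congr rfl fun x hx => hT.power_insert_of_mem hK hij hj hk hjk hx

end

/-! ### Two-dimensional tables -/

/-- Array `a`, read as a table with rows of length `W`. -/
def State.tab (s : State) (W a i j : ℕ) : ℕ := s.arr a (i * W + j)

/-- The entry of table `a` in row `e` and column `f`; the row length is in register `2`. -/
def Expr.cell (a : ℕ) (e f : Expr) : Expr := .arr a (.add (.mul e (.reg 2)) f)

/-- Write the entry of table `a` in row `e` and column `f`. -/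
def Cmd.put (a : ℕ) (e f v : Expr) : Cmd := .store a (.add (.mul e (.reg 2)) f) v

theorem eval_cell {s : State} {W : ℕ} (h2 : s.reg 2 = W) (a : ℕ) (e f : Expr) :
    (Expr.cell a e f).eval s = s.tab W a (e.eval s) (f.eval s) := by
  simp [Expr.cell, Expr.eval, State.tab, h2]

theorem mul_add_inj_of_lt {W i j k l : ℕ} (hj : j < W) (hl : l < W) :
    i * W + j = k * W + l ↔ i = k ∧ j = l := by
  constructor
  · intro h
    have h1 : (i * W + j) / W = i := by
      rw [mul_comm, Nat.mul_add_div (by omega), Nat.div_eq_of_lt hj, add_zero]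
    have h2 : (k * W + l) / W = k := by
      rw [mul_comm, Nat.mul_add_div (by omega), Nat.div_eq_of_lt hl, add_zero]
    have : i = k := by rw [← h1, h, h2]
    subst this
    exact ⟨rfl, by omega⟩
  · rintro ⟨rfl, rfl⟩; rfl

theorem tab_put {s : State} {W : ℕ} (h2 : s.reg 2 = W) {a b i j : ℕ} {e f v : Expr}
    (hf : f.eval s < W) (hj : j < W) :
    ((Cmd.put a e f v).run s).tab W b i j =
      if b = a ∧ i = e.eval s ∧ j = f.eval s then v.eval s else s.tab W b i j := by
  simp only [Cmd.put, Cmd.run, State.tab, State.setArr_arr, Expr.eval, h2]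
  simp only [mul_add_inj_of_lt hj hf]

@[simp] theorem tab_setReg (s : State) (x v W a i j : ℕ) :
    (s.setReg x v).tab W a i j = s.tab W a i j := rfl

theorem Cmd.run_ite (e : Expr) (p : Cmd) (s : State) :
    (Cmd.ite e p).run s = if e.eval s = 0 then s else p.run s := rfl

theorem Cmd.run_seq (p q : Cmd) (s : State) : (Cmd.seq p q).run s = q.run (p.run s) := rfl

theorem Cmd.run_assign (x : ℕ) (e : Expr) (s : State) :
    (Cmd.assign x e).run s = s.setReg x (e.eval s) := rfl

theorem Cmd.run_store (a : ℕ) (i e : Expr) (s : State) :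
    (Cmd.store a i e).run s = s.setArr a (i.eval s) (e.eval s) := rfl

@[simp] theorem reg_put (s : State) (a : ℕ) (e f v : Expr) :
    ((Cmd.put a e f v).run s).reg = s.reg := rfl

/-- The invariant rule for loops, with the registers and arrays that do not change. -/
theorem Cmd.run_for_frame {x : ℕ} {p : Cmd} {s : State} {W : ℕ} (hW : s.reg 2 = W)
    (I : ℕ → State → Prop) (h0 : I 0 (s.setReg x 0))
    (hstep : ∀ i < W, ∀ s₁ : State, s₁.reg x = i →
      (∀ y, (Cmd.iter x p).keepsReg y = true → s₁.reg y = s.reg y) →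
      (∀ b, p.keepsArr b = true → s₁.arr b = s.arr b) → I i s₁ →
      I (i + 1) ((p.run s₁).setReg x (i + 1))) :
    I W ((Cmd.iter x p).run s) := by
  subst hW
  refine (Cmd.run_for (fun i s₁ => (∀ y, (Cmd.iter x p).keepsReg y = true → s₁.reg y = s.reg y) ∧
    (∀ b, p.keepsArr b = true → s₁.arr b = s.arr b) ∧ I i s₁) ⟨fun y hy => ?_, fun b _ => rfl, h0⟩
    fun i hi s₁ hx hI => ⟨fun y hy => ?_, fun b hb => ?_, hstep i hi s₁ hx hI.1 hI.2.1 hI.2.2⟩).2.2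
  · simp only [keepsReg, Bool.and_eq_true, bne_iff_ne] at hy
    simp [hy.1.symm]
  · have hy' := hy
    simp only [keepsReg, Bool.and_eq_true, bne_iff_ne] at hy'
    rw [State.setReg_reg, if_neg hy'.1.symm, run_reg hy'.2, hI.1 y hy]
  · rw [State.setReg_arr, run_arr hb, hI.2.1 b hb]

/-! ### The table of positions -/

/-- The table `2` of the positions contains `pos`. -/
def HasTable (n : ℕ) (pos : ℕ → ℕ → ℕ) (s : State) : Prop :=
  ∀ u g, u < n + 2 → g < n + 2 → s.tab (n + 2) 2 u g = pos u g

/-- Array `0` lists the alternatives by position. -/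
def HasLists (n : ℕ) (pos : ℕ → ℕ → ℕ) (s : State) : Prop :=
  ∀ u r, u < n → r < n + 1 →
    s.arr 0 (u * (n + 1) + r) ≤ n ∧ pos (u + 1) (s.arr 0 (u * (n + 1) + r)) = r

/-- Invert the preference lists. -/
def invertCmd : Cmd :=
  .iter 4 (.iter 5 (.ite (.lt (.reg 4) (.reg 0)) (.ite (.lt (.reg 5) (.add (.reg 0) (.const 1)))
    (.put 2 (.add (.reg 4) (.const 1))
      (.arr 0 (.add (.mul (.reg 4) (.add (.reg 0) (.const 1))) (.reg 5))) (.reg 5)))))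

/-- Copy the position of abstention into the last column. -/
def topCmd : Cmd :=
  .iter 4 (.put 2 (.reg 4) (.add (.reg 0) (.const 1)) (.cell 2 (.reg 4) (.const 0)))

section

variable {n : ℕ} {pos : ℕ → ℕ → ℕ} {s : State}

theorem run_invertCmd (hT : PrefTable n pos) (h0 : s.reg 0 = n) (h2 : s.reg 2 = n + 2)
    (hl : HasLists n pos s) (hz : ∀ k, s.arr 2 k = 0) :
    ∀ u g, u < n + 2 → g < n + 2 →
      (invertCmd.run s).tab (n + 2) 2 u g = if g ≤ n then pos u g else 0 := by
  have key := Cmd.run_for_frame h2 (x := 4) (p := .iter 5 (.ite (.lt (.reg 4) (.reg 0))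
    (.ite (.lt (.reg 5) (.add (.reg 0) (.const 1)))
    (.put 2 (.add (.reg 4) (.const 1))
      (.arr 0 (.add (.mul (.reg 4) (.add (.reg 0) (.const 1))) (.reg 5))) (.reg 5)))))
    -- The outer rows and the last column keep their initial zeros: correct for the rows of the two
    -- ends, while the column is filled by `topCmd`. Round `i` writes row `i + 1`, since voters are
    -- numbered from `1` in the table.
    (fun i s₁ => ∀ u g, u < n + 2 → g < n + 2 → s₁.tab (n + 2) 2 u g =
      if g ≤ n ∧ 0 < u ∧ u ≤ i ∧ u ≤ n then pos u g else 0) ?_ ?_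
  · intro u g hu hg
    have := key u g hu hg
    rw [invertCmd, this]
    by_cases hgn : g ≤ n
    · by_cases hout : u = 0 ∨ n < u
      · rw [if_neg (by omega), if_pos hgn, hT.outside u g hout]
      · rw [if_pos (by omega), if_pos hgn]
    · rw [if_neg (by omega), if_neg hgn]
  · intro u g _ _
    rw [if_neg (by omega), tab_setReg, State.tab, hz]
  · intro i hi s₁ h4 hr ha hI
    have hr0 := hr 0 rfl
    have hr2 := hr 2 rfl
    have ha0 := ha 0 rfl
    have inner := Cmd.run_for_frame (s := s₁) (hr2.trans h2) (x := 5)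
      (p := .ite (.lt (.reg 4) (.reg 0)) (.ite (.lt (.reg 5) (.add (.reg 0) (.const 1)))
      (.put 2 (.add (.reg 4) (.const 1))
        (.arr 0 (.add (.mul (.reg 4) (.add (.reg 0) (.const 1))) (.reg 5))) (.reg 5))))
      (fun r s₂ => ∀ u g, u < n + 2 → g < n + 2 → s₂.tab (n + 2) 2 u g =
        if g ≤ n ∧ 0 < u ∧ u ≤ n ∧ (u ≤ i ∨ u = i + 1 ∧ pos u g < r) then pos u g else 0) ?_ ?_
    · intro u g hu hg
      rw [tab_setReg, inner u g hu hg]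
      have := hT.le u g
      congr 1
      rw [eq_iff_iff]
      omega
    · intro u g hu hg
      rw [tab_setReg, hI u g hu hg]
      congr 1
      rw [eq_iff_iff]
      omega
    · intro r hrW s₂ h5 hr' ha' hI' u g hu hg
      have e0 : s₂.reg 0 = n := (hr' 0 rfl).trans (hr0.trans h0)
      have e2 : s₂.reg 2 = n + 2 := (hr' 2 rfl).trans (hr2.trans h2)
      have e4 : s₂.reg 4 = i := (hr' 4 rfl).trans h4
      have ea : s₂.arr 0 = s.arr 0 := (ha' 0 rfl).trans ha0
      simp only [tab_setReg, Cmd.run, Expr.eval, e0, e4, h5]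
      by_cases hin : i < n
      · by_cases hrn : r < n + 1
        · obtain ⟨hle, hpos⟩ := hl i r hin hrn
          simp only [hin, hrn, if_true, one_ne_zero, if_false]
          rw [tab_put e2 (by simp only [Expr.eval, e4, e0, h5, ea]; omega) hg, hI' u g hu hg]
          simp only [Expr.eval, e4, e0, h5, ea, true_and]
          by_cases hc : u = i + 1 ∧ g = s.arr 0 (i * (n + 1) + r)
          · obtain ⟨rfl, rfl⟩ := hc
            simp only [and_self, if_true]
            rw [if_pos ⟨hle, by omega, by omega, Or.inr ⟨trivial, by omega⟩⟩, hpos]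
          · rw [if_neg hc]
            congr 1
            rw [eq_iff_iff]
            refine and_congr_right fun hgn => and_congr_right fun hu0 => and_congr_right fun hun =>
              or_congr_right (and_congr_right fun hui => ?_)
            have : pos u g ≠ r := by
              intro h
              refine hc ⟨hui, hT.inj u _ _ hu0 hun hgn hle ?_⟩
              rw [h, hui, hpos]
            omega
        · simp only [hin, hrn, if_true, one_ne_zero, if_false]
          rw [hI' u g hu hg]
          have := hT.le u g
          congr 1
          rw [eq_iff_iff]
          omega
      · simp only [hin, if_true, if_false]
        rw [hI' u g hu hg]
        congr 1
        rw [eq_iff_iff]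
        omega

theorem run_topCmd (hT : PrefTable n pos) (h0 : s.reg 0 = n) (h2 : s.reg 2 = n + 2)
    (hs : ∀ u g, u < n + 2 → g < n + 2 → s.tab (n + 2) 2 u g = if g ≤ n then pos u g else 0) :
    HasTable n pos (topCmd.run s) := by
  have key := Cmd.run_for_frame h2 (x := 4)
    (p := .put 2 (.reg 4) (.add (.reg 0) (.const 1)) (.cell 2 (.reg 4) (.const 0)))
    (fun i s₁ => ∀ u g, u < n + 2 → g < n + 2 → s₁.tab (n + 2) 2 u g =
      if g ≤ n ∨ u < i then pos u g else 0) ?_ ?_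
  · intro u g hu hg
    rw [topCmd, key u g hu hg, if_pos (Or.inr hu)]
  · intro u g hu hg
    rw [tab_setReg, hs u g hu hg]
    simp
  · intro i hi s₁ h4 hr _ hI u g hu hg
    have e0 : s₁.reg 0 = n := (hr 0 rfl).trans h0
    have e2 : s₁.reg 2 = n + 2 := (hr 2 rfl).trans h2
    rw [tab_setReg, tab_put e2 (by simp only [Expr.eval, e0]; omega) hg, hI u g hu hg,
      eval_cell e2]
    simp only [Expr.eval, e0, h4, true_and]
    by_cases hc : u = i ∧ g = n + 1
    · obtain ⟨rfl, rfl⟩ := hc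
      rw [if_pos ⟨rfl, rfl⟩, hI _ _ hi (by omega), if_pos (by simp), if_pos (by omega), hT.top]
    · rw [if_neg hc]
      congr 1
      rw [eq_iff_iff]
      omega

/-- Compute the table of positions. -/
def tableCmd : Cmd := .seq invertCmd topCmd

theorem run_tableCmd (hT : PrefTable n pos) (h0 : s.reg 0 = n) (h2 : s.reg 2 = n + 2)
    (hl : HasLists n pos s) (hz : ∀ k, s.arr 2 k = 0) : HasTable n pos (tableCmd.run s) :=
  run_topCmd hT ((Cmd.run_reg rfl s).trans h0) ((Cmd.run_reg rfl s).trans h2)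
    (run_invertCmd hT h0 h2 hl hz)

theorem HasTable.congr {s₁ : State} (hs : HasTable n pos s) (h : s₁.arr 2 = s.arr 2) :
    HasTable n pos s₁ := by
  intro u g hu hg
  rw [← hs u g hu hg, State.tab, State.tab, h]

/-! ### The auxiliary digraph -/

/-- Store in array `3` the last voter to whom a voter may delegate. -/
def extentCmd : Cmd :=
  .iter 4 (.iter 5 (.ite (.lt (.reg 4) (.reg 5))
    (.ite (.lt (.cell 2 (.reg 4) (.reg 5)) (.cell 2 (.reg 4) (.reg 4)))
      (.store 3 (.reg 4) (.reg 5)))))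

/-- Array `3` determines the arcs to the right. -/
def HasExtent (n : ℕ) (pos : ℕ → ℕ → ℕ) (s : State) : Prop :=
  ∀ u y, u < y → y < n + 2 → Active pos u → (y ≤ s.arr 3 u ↔ Arc pos u y)

/-- By the interval property the arcs of an active voter to the right are described by a single
threshold. Later heads overwrite earlier ones, so the last one survives; the initial `0` means that
there is none. -/
theorem run_extentCmd (hT : PrefTable n pos) (h2 : s.reg 2 = n + 2) (hs : HasTable n pos s)
    (hz : ∀ k, s.arr 3 k = 0) : HasExtent n pos (extentCmd.run s) := by
  have key := Cmd.run_for_frame h2 (x := 4) (p := .iter 5 (.ite (.lt (.reg 4) (.reg 5))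
    (.ite (.lt (.cell 2 (.reg 4) (.reg 5)) (.cell 2 (.reg 4) (.reg 4)))
      (.store 3 (.reg 4) (.reg 5)))))
    (fun i s₁ => ∀ u y, u < y →
      (y ≤ s₁.arr 3 u ↔ ∃ g, y ≤ g ∧ g < n + 2 ∧ u < i ∧ Arc pos u g)) ?_ ?_
  · intro u y huy hy ha
    rw [extentCmd, key u y huy]
    constructor
    · rintro ⟨g, hyg, hg, -, h⟩
      rcases hyg.eq_or_lt with rfl | hyg
      · exact h
      · exact hT.arc_of_between ha (by omega) h (Or.inl ⟨huy, hyg⟩)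
    · exact fun h => ⟨y, le_rfl, hy, by omega, h⟩
  · intro u y huy
    rw [State.setReg_arr, hz]
    exact ⟨fun h => by omega, fun ⟨g, _, _, h, _⟩ => by omega⟩
  · intro i hi s₁ h4 hr ha hI
    have inner := Cmd.run_for_frame (s := s₁) ((hr 2 rfl).trans h2) (x := 5)
      (p := .ite (.lt (.reg 4) (.reg 5))
      (.ite (.lt (.cell 2 (.reg 4) (.reg 5)) (.cell 2 (.reg 4) (.reg 4)))
        (.store 3 (.reg 4) (.reg 5))))
      (fun x s₂ => ∀ u y, u < y → (y ≤ s₂.arr 3 u ↔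
        ∃ g, y ≤ g ∧ g < n + 2 ∧ (u < i ∨ u = i ∧ g < x) ∧ Arc pos u g)) ?_ ?_
    · intro u y huy
      rw [State.setReg_arr, inner u y huy]
      refine exists_congr fun g => and_congr_right fun _ => and_congr_right fun _ =>
        and_congr_left fun _ => by omega
    · intro u y huy
      rw [State.setReg_arr, hI u y huy]
      simp
    · intro x hx s₂ h5 hr' ha' hI' u y huy
      have e2 : s₂.reg 2 = n + 2 := (hr' 2 rfl).trans ((hr 2 rfl).trans h2)
      have e4 : s₂.reg 4 = i := (hr' 4 rfl).trans h4
      have et : HasTable n pos s₂ := hs.congr ((ha' 2 rfl).trans (ha 2 rfl))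
      have hskip : (¬ (i < x ∧ Arc pos i x)) → (y ≤ s₂.arr 3 u ↔
          ∃ g, y ≤ g ∧ g < n + 2 ∧ (u < i ∨ u = i ∧ g < x + 1) ∧ Arc pos u g) := by
        intro hno
        rw [hI' u y huy]
        refine exists_congr fun g => and_congr_right fun hyg => and_congr_right fun _ =>
          and_congr_left fun harc => or_congr_right (and_congr_right fun hui => ?_)
        have : g ≠ x := fun h => hno ⟨by omega, hui ▸ h ▸ harc⟩
        omega
      simp only [Cmd.run, State.setReg_arr, Expr.eval, eval_cell e2, e4, h5]
      rw [et i x hi hx, et i i hi hi]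
      by_cases hix : i < x
      · by_cases hix' : pos i x < pos i i
        · simp only [hix, hix', if_true, one_ne_zero, if_false, State.setArr_arr_self]
          by_cases hui : u = i
          · subst hui
            rw [if_pos rfl]
            constructor
            · exact fun h => ⟨x, h, hx, Or.inr ⟨rfl, by omega⟩, hix'⟩
            · rintro ⟨g, hyg, -, hg, -⟩
              omega
          · rw [if_neg hui, hI' u y huy]
            simp [hui]
        · simp only [hix, hix', if_true, one_ne_zero, if_false]
          exact hskip fun h => hix' h.2
      · simp only [hix, if_true, if_false]
        exact hskip fun h => hix h.1

/-- The conditions for a link from register `4` to register `5`, when register `6` holds the minimal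
extent of the voters between that may not delegate to the former. -/
def linkExpr : Expr :=
  .lt (.add (.lt (.cell 2 (.reg 4) (.const 0)) (.cell 2 (.reg 4) (.reg 4)))
    (.add (.lt (.cell 2 (.reg 5) (.const 0)) (.cell 2 (.reg 5) (.reg 5)))
    (.add (.lt (.cell 2 (.reg 4) (.reg 5)) (.cell 2 (.reg 4) (.reg 4)))
    (.add (.lt (.cell 2 (.reg 5) (.reg 4)) (.cell 2 (.reg 5) (.reg 5)))
      (.lt (.reg 6) (.reg 5)))))) (.const 1)

/-- The loop through the possible heads of links from register `4`. -/
def linkRowCmd : Cmd :=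
  .iter 5 (.ite (.lt (.reg 4) (.reg 5)) (.seq (.put 1 (.reg 4) (.reg 5) linkExpr)
    (.ite (.lt (.add (.lt (.cell 2 (.reg 5) (.const 0)) (.cell 2 (.reg 5) (.reg 5)))
      (.lt (.cell 2 (.reg 5) (.reg 4)) (.cell 2 (.reg 5) (.reg 5)))) (.const 1))
      (.assign 6 (.min (.reg 6) (.arr 3 (.reg 5)))))))

/-- Compute the adjacency matrix of the links in array `1`. -/
def linkCmd : Cmd := .iter 4 (.seq (.assign 6 (.reg 3)) linkRowCmd)

open Classical in
/-- Array `1` contains the adjacency matrix of the links. -/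
def HasLinks (n : ℕ) (pos : ℕ → ℕ → ℕ) (s : State) : Prop :=
  ∀ i j, i < n + 2 → j < n + 2 → s.tab (n + 2) 1 i j = if Link pos i j then 1 else 0

-- Fix the tail `i`. Those active vertices after `i` that have no arc to `i` must all be absorbed by
-- the head `j`, which means that `j` does not exceed the minimum of their extents. Register `6`
-- holds this minimum for the vertices passed so far, so each pair costs constant time; its start
-- value, at least `n + 2`, is the empty minimum.
open Classical in
theorem run_linkRowCmd {i : ℕ} (hi : i < n + 2) (h2 : s.reg 2 = n + 2)
    (h3 : n + 2 ≤ s.reg 6) (h4 : s.reg 4 = i) (hs : HasTable n pos s) (he : HasExtent n pos s)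
    (hz : ∀ j < n + 2, s.tab (n + 2) 1 i j = 0) :
    ∀ a b, a < n + 2 → b < n + 2 → (linkRowCmd.run s).tab (n + 2) 1 a b =
      if a = i then (if Link pos i b then 1 else 0) else s.tab (n + 2) 1 a b := by
  have key := Cmd.run_for_frame h2 (x := 5) (p := .ite (.lt (.reg 4) (.reg 5))
    (.seq (.put 1 (.reg 4) (.reg 5) linkExpr)
    (.ite (.lt (.add (.lt (.cell 2 (.reg 5) (.const 0)) (.cell 2 (.reg 5) (.reg 5)))
      (.lt (.cell 2 (.reg 5) (.reg 4)) (.cell 2 (.reg 5) (.reg 5)))) (.const 1))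
      (.assign 6 (.min (.reg 6) (.arr 3 (.reg 5)))))))
    (fun x s₁ => (∀ y, y < n + 2 → (y ≤ s₁.reg 6 ↔
        ∀ u, i < u → u < x → Active pos u → ¬ Arc pos u i → y ≤ s.arr 3 u)) ∧
      ∀ a b, a < n + 2 → b < n + 2 → s₁.tab (n + 2) 1 a b =
        if a = i ∧ b < x then (if Link pos i b then 1 else 0) else s.tab (n + 2) 1 a b) ?_ ?_
  · intro a b ha hb
    rw [linkRowCmd, key.2 a b ha hb]
    simp [hb]
  · refine ⟨fun y hy => ?_, fun a b _ _ => by simp⟩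
    simp
    omega
  · intro x hx s₁ h5 hr ha ⟨hI, hI'⟩
    have e2 : s₁.reg 2 = n + 2 := (hr 2 rfl).trans h2
    have e4 : s₁.reg 4 = i := (hr 4 rfl).trans h4
    have et : HasTable n pos s₁ := hs.congr (ha 2 rfl)
    have e3 : s₁.arr 3 = s.arr 3 := ha 3 rfl
    by_cases hix : i < x
    swap
    · simp only [Cmd.run, Expr.eval, e4, h5, hix, if_false, if_true, State.setReg_reg,
        tab_setReg]
      refine ⟨fun y hy => ?_, fun a b ha hb => ?_⟩
      · rw [if_neg (by omega), hI y hy]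
        exact forall_congr' fun u => forall_congr' fun h => by
          constructor <;> intro _ <;> omega
      · rw [hI' a b ha hb]
        by_cases hc : a = i ∧ b = x
        · obtain ⟨rfl, rfl⟩ := hc
          have : ¬ Link pos a b := fun h => hix h.1
          simp [this, hz b hb]
        · congr 1
          rw [eq_iff_iff]
          omega
    · set s₂ := (Cmd.put 1 (.reg 4) (.reg 5) linkExpr).run s₁ with hs₂
      have f2 : s₂.reg 2 = n + 2 := e2
      have f4 : s₂.reg 4 = i := e4
      have f5 : s₂.reg 5 = x := h5
      have f3 : s₂.arr 3 = s.arr 3 := e3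
      have ft : HasTable n pos s₂ := et.congr rfl
      -- The summands of the expression are the indicators of the violated conditions, so their sum
      -- is below `1` exactly for a link.
      have hval : linkExpr.eval s₁ = if Link pos i x then 1 else 0 := by
        simp only [linkExpr, Expr.eval, eval_cell e2, e4, h5]
        rw [et i 0 hi (by omega), et i i hi hi, et x 0 hx (by omega), et x x hx hx,
          et i x hi hx, et x i hx hi]
        congr 1
        rw [eq_iff_iff]
        have h6 : ¬ s₁.reg 6 < x ↔
            ∀ u, i < u → u < x → Active pos u → Arc pos u i ∨ Arc pos u x := by
          rw [not_lt, hI x hx]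
          refine forall_congr' fun u => forall_congr' fun _ => forall_congr' fun hux =>
            forall_congr' fun hu => ?_
          rw [← he u x hux hx hu]
          tauto
        rw [Link, ← h6, Active, Active, Arc, Arc]
        split_ifs <;> simp_all
      have htab : ∀ a b, a < n + 2 → b < n + 2 → s₂.tab (n + 2) 1 a b =
          if a = i ∧ b < x + 1 then (if Link pos i b then 1 else 0) else s.tab (n + 2) 1 a b := by
        intro a b ha hb
        rw [hs₂, tab_put e2 (by simpa only [Expr.eval, h5] using hx) hb, hI' a b ha hb, hval]
        simp only [Expr.eval, e4, h5, true_and]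
        by_cases hc : a = i ∧ b = x
        · obtain ⟨rfl, rfl⟩ := hc
          simp
        · rw [if_neg hc]
          congr 1
          rw [eq_iff_iff]
          omega
      have hne : (if i < x then 1 else 0) ≠ 0 := by simp [hix]
      simp only [Cmd.run, Expr.eval, e4, h5, if_neg hne]
      simp only [← hs₂, eval_cell f2, Expr.eval, f4, f5, ft x 0 hx (by omega), ft x x hx hx,
        ft x i hx hi]
      have hmin : (Expr.min (.reg 6) (.arr 3 (.reg 5))).eval s₂ = min (s₁.reg 6) (s.arr 3 x) := by
        rw [Expr.eval_min]
        simp only [Expr.eval, f5, f3]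
        rfl
      by_cases hx' : Active pos x ∧ ¬ Arc pos x i
      · have h1 : ¬ pos x 0 < pos x x := hx'.1
        have h2' : ¬ pos x i < pos x x := hx'.2
        simp only [h1, h2', if_false, add_zero, zero_lt_one, if_true, one_ne_zero, hmin,
          State.setReg_reg, tab_setReg]
        refine ⟨fun y hy => ?_, htab⟩
        rw [if_neg (by norm_num), le_min_iff, hI y hy]
        constructor
        · rintro ⟨h, hyx⟩ u hiu hux hu hui
          rcases (Nat.lt_succ_iff.1 hux).eq_or_lt with rfl | hux
          exacts [hyx, h u hiu hux hu hui]
        · exact fun h => ⟨fun u hiu hux => h u hiu (by omega), h x hix (by omega) hx'.1 hx'.2⟩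
      · have hz0 : (if (if pos x 0 < pos x x then 1 else 0) + (if pos x i < pos x x then 1 else 0)
            < 1 then 1 else 0) = 0 := by
          by_cases h1 : pos x 0 < pos x x
          · simp [h1]
          · have h2' : pos x i < pos x x := by
              by_contra h; exact hx' ⟨h1, h⟩
            simp [h2']
        simp only [hz0, if_true, State.setReg_reg, tab_setReg]
        refine ⟨fun y hy => ?_, htab⟩
        rw [if_neg (by norm_num)]
        change y ≤ s₁.reg 6 ↔ _
        rw [hI y hy]
        constructor
        · intro h u hiu hux hu hui
          rcases (Nat.lt_succ_iff.1 hux).eq_or_lt with rfl | hux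
          exacts [absurd ⟨hu, hui⟩ hx', h u hiu hux hu hui]
        · exact fun h u hiu hux => h u hiu (by omega)

open Classical in
theorem run_linkCmd (h2 : s.reg 2 = n + 2) (h3 : n + 2 ≤ s.reg 3) (hs : HasTable n pos s)
    (he : HasExtent n pos s) (hz : ∀ k, s.arr 1 k = 0) : HasLinks n pos (linkCmd.run s) := by
  have key := Cmd.run_for_frame h2 (x := 4) (p := .seq (.assign 6 (.reg 3)) linkRowCmd)
    (fun i s₁ => ∀ a b, a < n + 2 → b < n + 2 → s₁.tab (n + 2) 1 a b =
      if a < i ∧ Link pos a b then 1 else 0) ?_ ?_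
  · intro a b ha hb
    rw [linkCmd, key a b ha hb]
    simp [ha]
  · intro a b _ _
    rw [tab_setReg, State.tab, hz]
    simp
  · intro i hi s₁ h4 hr ha hI a b hai hb
    have e3 : s₁.reg 3 = s.reg 3 := hr 3 rfl
    rw [tab_setReg]
    simp only [Cmd.run, Expr.eval]
    rw [run_linkRowCmd (s := s₁.setReg 6 (s₁.reg 3)) hi (by simp [hr 2 rfl, h2]) (by simpa [e3] using h3) (by simpa using h4)
      (hs.congr (ha 2 rfl)) ?_ (fun j hj => by rw [tab_setReg, hI i j hi hj]; simp) a b hai hb]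
    · rw [tab_setReg, hI a b hai hb]
      by_cases hc : a = i
      · subst hc; simp
      · rw [if_neg hc]
        congr 1
        rw [eq_iff_iff]
        refine and_congr_left fun _ => by omega
    · intro u y
      have : (s₁.setReg 6 (s₁.reg 3)).arr 3 = s.arr 3 := ha 3 rfl
      rw [this]
      exact he u y

/-- The preparation common to all problems: positions and links. -/
def prepareCmd : Cmd := .seq tableCmd (.seq extentCmd linkCmd)

/-- The states at the start: input and initialization. -/
structure IsInput (n : ℕ) (pos : ℕ → ℕ → ℕ) (s : State) : Prop where
  reg0 : s.reg 0 = n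
  reg2 : s.reg 2 = n + 2
  reg3 : s.reg 3 = (n + 2) ^ 3
  lists : HasLists n pos s
  zero : ∀ a k, a ≠ 0 → s.arr a k = 0

theorem run_prepareCmd (hT : PrefTable n pos) (hs : IsInput n pos s) :
    HasTable n pos (prepareCmd.run s) ∧ HasLinks n pos (prepareCmd.run s) := by
  have h2 : ∀ c : Cmd, c.keepsReg 2 = true → ∀ s₁ : State, s₁.reg 2 = n + 2 →
      (c.run s₁).reg 2 = n + 2 := fun c hc s₁ h => (Cmd.run_reg hc s₁).trans h
  have t1 := run_tableCmd hT hs.reg0 hs.reg2 hs.lists (fun k => hs.zero 2 k (by norm_num))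
  have t2 : HasTable n pos (extentCmd.run (tableCmd.run s)) := t1.congr (Cmd.run_arr rfl _)
  have e2 := run_extentCmd hT (h2 tableCmd rfl s hs.reg2) t1 (fun k => by
    rw [Cmd.run_arr (c := tableCmd) rfl]; exact hs.zero 3 k (by norm_num))
  refine ⟨t2.congr (Cmd.run_arr (c := linkCmd) rfl _), run_linkCmd (h2 extentCmd rfl _ (h2 tableCmd rfl s hs.reg2))
    ?_ t2 e2 fun k => ?_⟩
  · rw [Cmd.run_reg (c := extentCmd) rfl, Cmd.run_reg (c := tableCmd) rfl, hs.reg3]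
    exact Nat.le_self_pow (by omega) _
  · rw [Cmd.run_arr (c := extentCmd) rfl, Cmd.run_arr (c := tableCmd) rfl]
    exact hs.zero 1 k (by norm_num)

/-! ### Membership -/

/-- Mark in array `a` what can be reached from `src` by links. -/
def spreadCmd (a : ℕ) (src : Expr) : Cmd :=
  .seq (.store a src (.const 1)) (.iter 4 (.iter 5 (.ite (.cell 1 (.reg 5) (.reg 4))
    (.ite (.arr a (.reg 5)) (.store a (.reg 4) (.const 1))))))

/-- Links lead from smaller to larger vertices. One sweep through the heads in increasing order
suffices, because all tails of links to a vertex have received their final marks when the vertex is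
treated. -/
theorem run_spreadCmd {a : ℕ} (ha : a ≠ 1) {src : Expr} {i : ℕ} (hsrc : src.eval s = i)
    (h2 : s.reg 2 = n + 2) (hl : HasLinks n pos s) (hz : ∀ k, s.arr a k = 0) :
    ∀ j < n + 2, ((spreadCmd a src).run s).arr a j ≠ 0 ↔ Reach pos i j := by
  classical
  set s₀ := (Cmd.store a src (.const 1)).run s with hs₀
  have g2 : s₀.reg 2 = n + 2 := h2
  have ga : ∀ j, s₀.arr a j ≠ 0 ↔ j = i := by
    intro j
    simp [hs₀, Cmd.run, Expr.eval, hsrc, hz]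
  have gl : HasLinks n pos s₀ := by
    intro b c hb hc
    rw [← hl b c hb hc, State.tab, State.tab, hs₀]
    simp only [Cmd.run, State.setArr_arr_ne _ _ _ ha.symm]
  have hrow : ∀ j, Reach pos i j ↔ j = i ∨ ∃ k, Reach pos i k ∧ Link pos k j := fun j =>
    Relation.ReflTransGen.cases_tail_iff _ _ _
  have key := Cmd.run_for_frame g2 (x := 4) (p := .iter 5 (.ite (.cell 1 (.reg 5) (.reg 4))
    (.ite (.arr a (.reg 5)) (.store a (.reg 4) (.const 1)))))
    (fun x s₁ => ∀ j, s₁.arr a j ≠ 0 ↔ j = i ∨ j < x ∧ Reach pos i j) ?_ ?_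
  · intro j hj
    change (((Cmd.iter 4 _).run s₀).arr a j ≠ 0) ↔ _
    rw [key j]
    constructor
    · rintro (rfl | h)
      exacts [.refl, h.2]
    · exact fun h => Or.inr ⟨hj, h⟩
  · intro j
    rw [State.setReg_arr, ga]
    simp
  · intro x hx s₁ h4 hr hA hI
    have hA1 : s₁.arr 1 = s₀.arr 1 := hA 1 (by simp [Cmd.keepsArr, ha])
    have inner := Cmd.run_for_frame (s := s₁) ((hr 2 rfl).trans g2) (x := 5)
      (p := .ite (.cell 1 (.reg 5) (.reg 4)) (.ite (.arr a (.reg 5))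
        (.store a (.reg 4) (.const 1))))
      (fun y s₂ => ∀ j, s₂.arr a j ≠ 0 ↔
        j = i ∨ j < x ∧ Reach pos i j ∨ j = x ∧ ∃ k < y, Reach pos i k ∧ Link pos k j) ?_ ?_
    · intro j
      rw [State.setReg_arr, inner j]
      constructor
      · rintro (rfl | h | ⟨rfl, k, -, hk, hkj⟩)
        · exact Or.inl rfl
        · exact Or.inr ⟨by omega, h.2⟩
        · exact Or.inr ⟨by omega, hk.tail hkj⟩
      · rintro (rfl | ⟨hj, h⟩)
        · exact Or.inl rfl
        · rcases (Nat.lt_succ_iff.1 hj).eq_or_lt with rfl | hj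
          · rcases (hrow j).1 h with h | ⟨k, hk, hkj⟩
            · exact Or.inl h
            · exact Or.inr (Or.inr ⟨rfl, k, by have := hkj.1; omega, hk, hkj⟩)
          · exact Or.inr (Or.inl ⟨hj, h⟩)
    · intro j
      rw [State.setReg_arr, hI j]
      simp
    · intro y hy s₂ h5 hr' hA' hI' j
      have e2 : s₂.reg 2 = n + 2 := (hr' 2 rfl).trans ((hr 2 rfl).trans g2)
      have e4 : s₂.reg 4 = x := (hr' 4 rfl).trans h4
      have el : s₂.tab (n + 2) 1 y x = if Link pos y x then 1 else 0 := by
        rw [← gl y x hy hx, State.tab, State.tab, hA' 1 (by simp [Cmd.keepsArr, ha]), hA1]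
      simp only [Cmd.run, State.setReg_arr, Expr.eval, eval_cell e2, e4, h5, el]
      have hy' : Link pos y x → (s₂.arr a y ≠ 0 ↔ Reach pos i y) := by
        intro h
        have := h.1
        rw [hI' y]
        constructor
        · rintro (rfl | h | h)
          · exact .refl
          · exact h.2
          · omega
        · exact fun h => Or.inr (Or.inl ⟨this, h⟩)
      by_cases hc : Link pos y x ∧ Reach pos i y
      · have := (hy' hc.1).2 hc.2
        simp only [hc.1, if_true, one_ne_zero, if_false, this, State.setArr_arr_self]
        by_cases hj : j = x
        · subst hj
          simp only [if_true, ne_eq, one_ne_zero, not_false_eq_true, true_iff]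
          exact Or.inr (Or.inr ⟨trivial, y, by omega, hc.2, hc.1⟩)
        · rw [if_neg hj, hI' j]
          simp [hj]
      · have hno : ∀ s₃ : State, s₃ = s₂ → (s₃.arr a j ≠ 0 ↔ j = i ∨ j < x ∧ Reach pos i j ∨
            j = x ∧ ∃ k < y + 1, Reach pos i k ∧ Link pos k j) := by
          rintro _ rfl
          rw [hI' j]
          refine or_congr_right (or_congr_right (and_congr_right fun hj => ?_))
          subst hj
          refine exists_congr fun k => ⟨fun h => ⟨by omega, h.2⟩, fun h => ⟨?_, h.2⟩⟩
          have : k ≠ y := by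
            rintro rfl
            exact hc ⟨h.2.2, h.2.1⟩
          omega
        refine hno _ ?_
        by_cases h1 : Link pos y x
        · have : s₂.arr a y = 0 := by
            by_contra h
            exact hc ⟨h1, (hy' h1).1 h⟩
          simp [this]
        · simp [h1]

/-- Decide the membership problem for the voter in register `1`. -/
def memberCmd : Cmd :=
  .seq prepareCmd (.seq (spreadCmd 8 (.const 0)) (.seq (spreadCmd 9 (.reg 1))
    (.seq (.assign 10 (.const 0)) (.seq (.ite (.arr 8 (.reg 1))
      (.assign 10 (.lt (.const 0) (.arr 9 (.add (.reg 0) (.const 1)))))) (.assign 0 (.reg 10))))))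

-- Two sweeps decide the two reachability conditions for `i`. The answer waits in register `10`,
-- since register `0` still supplies `n` for the index of the sink.
open Classical in
theorem run_memberCmd (hT : PrefTable n pos) (hs : IsInput n pos s) {i : ℕ} (hi : i < n + 2)
    (h1 : s.reg 1 = i) : (memberCmd.run s).reg 0 =
      if ∃ K, PartialKernel pos (n + 1) K ∧ i ∈ K then 1 else 0 := by
  rw [hT.exists_partialKernel_mem_iff (by omega)]
  obtain ⟨-, hl⟩ := run_prepareCmd hT hs
  set s₁ := prepareCmd.run s with hs₁
  set s₂ := (spreadCmd 8 (.const 0)).run s₁ with hs₂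
  set s₃ := (spreadCmd 9 (.reg 1)).run s₂ with hs₃
  have r1 : ∀ y, y < 4 → s₁.reg y = s.reg y := fun y hy => by
    interval_cases y <;> exact Cmd.run_reg rfl s
  have r2 : ∀ y, y < 4 → s₂.reg y = s.reg y := fun y hy => by
    rw [← r1 y hy]; interval_cases y <;> exact Cmd.run_reg rfl s₁
  have r3 : ∀ y, y < 4 → s₃.reg y = s.reg y := fun y hy => by
    rw [← r2 y hy]; interval_cases y <;> exact Cmd.run_reg rfl s₂
  have z1 : ∀ a, 4 ≤ a → a ≤ 9 → ∀ k, s₁.arr a k = 0 := fun a h4 h9 k => by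
    rw [← hs.zero a k (by omega)]
    interval_cases a <;> exact congrFun (Cmd.run_arr rfl s) k
  have l2 : HasLinks n pos s₂ := by
    intro a b ha hb
    rw [← hl a b ha hb, State.tab, State.tab, hs₂, Cmd.run_arr rfl]
  have k1 := run_spreadCmd (a := 8) (by norm_num) (src := .const 0) (i := 0) rfl
    ((r1 2 (by norm_num)).trans hs.reg2) hl (z1 8 (by norm_num) (by norm_num))
  have k2 := run_spreadCmd (a := 9) (by norm_num) (src := .reg 1) (s := s₂) (i := i)
    ((r2 1 (by norm_num)).trans h1) ((r2 2 (by norm_num)).trans hs.reg2) l2 (fun k => by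
      rw [hs₂, Cmd.run_arr (c := spreadCmd 8 (.const 0)) (b := 9) rfl]
      exact z1 9 (by norm_num) (by norm_num) k)
  have h8 : s₃.arr 8 i ≠ 0 ↔ Reach pos 0 i := by
    rw [hs₃, Cmd.run_arr (c := spreadCmd 9 (.reg 1)) (b := 8) rfl]
    exact k1 i hi
  have h9 : s₃.arr 9 (n + 1) ≠ 0 ↔ Reach pos i (n + 1) := k2 (n + 1) (by omega)
  have e0 : s₃.reg 0 = n := (r3 0 (by norm_num)).trans hs.reg0
  have e1 : s₃.reg 1 = i := (r3 1 (by norm_num)).trans h1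
  simp only [memberCmd, Cmd.run]
  rw [← hs₁, ← hs₂, ← hs₃]
  simp only [Expr.eval, State.setReg_reg, State.setReg_arr, e1, e0]
  rw [← h8, ← h9]
  by_cases c1 : s₃.arr 8 i = 0 <;> by_cases c2 : s₃.arr 9 (n + 1) = 0 <;>
    simp [c1, c2, Nat.pos_iff_ne_zero]

end

section

variable {n : ℕ} {pos : ℕ → ℕ → ℕ} {s : State}

/-! ### Sums of costs -/

/-- Store in table `a` the sums of the costs `e` of register `6` with respect to registers `4`
and `5`. -/
def sumCmd (a : ℕ) (e : Expr) : Cmd :=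
  .iter 4 (.iter 5 (.iter 6 (.put a (.reg 4) (.reg 5) (.clamp (.add (.cell a (.reg 4) (.reg 5)) e)))))

/-- The expression `e` computes `c u i j` if `i`, `j`, `u` are in the registers `4`, `5`, `6`. -/
def Computes (n : ℕ) (pos : ℕ → ℕ → ℕ) (e : Expr) (c : ℕ → ℕ → ℕ → ℕ) : Prop :=
  ∀ s : State, s.reg 0 = n → s.reg 2 = n + 2 → HasTable n pos s → s.reg 4 < n + 2 →
    s.reg 5 < n + 2 → s.reg 6 < n + 2 → e.eval s = c (s.reg 6) (s.reg 4) (s.reg 5)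

theorem run_sumCmd {a : ℕ} (ha : a ≠ 2) {e : Expr} {c : ℕ → ℕ → ℕ → ℕ} (he : Computes n pos e c)
    (hc : ∀ u i j, c u i j ≤ n + 2) (h0 : s.reg 0 = n) (h2 : s.reg 2 = n + 2)
    (h3 : s.reg 3 = (n + 2) ^ 3) (hs : HasTable n pos s) (hz : ∀ k, s.arr a k = 0) :
    ∀ i j, i < n + 2 → j < n + 2 →
      ((sumCmd a e).run s).tab (n + 2) a i j = ∑ u ∈ Finset.range (n + 2), c u i j := by
  -- All partial sums are at most `(n + 2) ^ 2`, so the clamping in the command never changes a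
  -- value.
  have hsum : ∀ x < n + 2, ∀ i j, (∑ u ∈ Finset.range x, c u i j) + c x i j ≤ (n + 2) ^ 3 := by
    intro x hx i j
    rw [← Finset.sum_range_succ]
    calc ∑ u ∈ Finset.range (x + 1), c u i j ≤ (x + 1) * (n + 2) := by
          simpa using Finset.sum_le_card_nsmul (Finset.range (x + 1)) _ _ fun u _ => hc u i j
      _ ≤ (n + 2) * (n + 2) := Nat.mul_le_mul_right _ (by omega)
      _ = (n + 2) ^ 2 := (sq _).symm
      _ ≤ _ := Nat.pow_le_pow_right (by omega) (by omega)
  have key := Cmd.run_for_frame h2 (x := 4) (p := .iter 5 (.iter 6 (.put a (.reg 4) (.reg 5)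
    (.clamp (.add (.cell a (.reg 4) (.reg 5)) e)))))
    (fun x s₁ => ∀ i j, i < n + 2 → j < n + 2 → s₁.tab (n + 2) a i j =
      if i < x then ∑ u ∈ Finset.range (n + 2), c u i j else 0) ?_ ?_
  · intro i j hi hj
    rw [sumCmd, key i j hi hj, if_pos hi]
  · intro i j _ _
    rw [tab_setReg, State.tab, hz]
    simp
  intro i hi s₁ h4 hr hA hI
  have inner := Cmd.run_for_frame (s := s₁) ((hr 2 rfl).trans h2) (x := 5)
    (p := .iter 6 (.put a (.reg 4) (.reg 5) (.clamp (.add (.cell a (.reg 4) (.reg 5)) e))))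
    (fun x s₂ => ∀ k j, k < n + 2 → j < n + 2 → s₂.tab (n + 2) a k j =
      if k < i ∨ k = i ∧ j < x then ∑ u ∈ Finset.range (n + 2), c u k j else 0) ?_ ?_
  · intro k j hk hj
    rw [tab_setReg, inner k j hk hj]
    congr 1
    rw [eq_iff_iff]
    omega
  · intro k j hk hj
    rw [tab_setReg, hI k j hk hj]
    simp
  intro j hj s₂ h5 hr' hA' hI'
  have innermost := Cmd.run_for_frame (s := s₂) ((hr' 2 rfl).trans ((hr 2 rfl).trans h2)) (x := 6)
    (p := .put a (.reg 4) (.reg 5) (.clamp (.add (.cell a (.reg 4) (.reg 5)) e)))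
    (fun x s₃ => ∀ k l, k < n + 2 → l < n + 2 → s₃.tab (n + 2) a k l =
      if k < i ∨ k = i ∧ l < j then ∑ u ∈ Finset.range (n + 2), c u k l else
        if k = i ∧ l = j then ∑ u ∈ Finset.range x, c u k l else 0) ?_ ?_
  · intro k l hk hl
    rw [tab_setReg, innermost k l hk hl]
    by_cases h1 : k < i ∨ k = i ∧ l < j
    · rw [if_pos h1, if_pos (by omega)]
    · rw [if_neg h1]
      congr 1
      rw [eq_iff_iff]
      omega
  · intro k l hk hl
    rw [tab_setReg, hI' k l hk hl]
    simp
  intro x hx s₃ h6 hr'' hA'' hI'' k l hk hl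
  have e0 : s₃.reg 0 = n := (hr'' 0 rfl).trans ((hr' 0 rfl).trans ((hr 0 rfl).trans h0))
  have e2 : s₃.reg 2 = n + 2 := (hr'' 2 rfl).trans ((hr' 2 rfl).trans ((hr 2 rfl).trans h2))
  have e3 : s₃.reg 3 = (n + 2) ^ 3 :=
    (hr'' 3 rfl).trans ((hr' 3 rfl).trans ((hr 3 rfl).trans h3))
  have e4 : s₃.reg 4 = i := (hr'' 4 rfl).trans ((hr' 4 rfl).trans h4)
  have e5 : s₃.reg 5 = j := (hr'' 5 rfl).trans h5
  have hk2 : Cmd.keepsArr 2 (.put a (.reg 4) (.reg 5)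
      (.clamp (.add (.cell a (.reg 4) (.reg 5)) e))) = true := by
    simpa [Cmd.put, Cmd.keepsArr] using ha
  have et : HasTable n pos s₃ :=
    hs.congr ((hA'' 2 hk2).trans ((hA' 2 hk2).trans (hA 2 hk2)))
  have hev : (Expr.add (.cell a (.reg 4) (.reg 5)) e).eval s₃ =
      ∑ u ∈ Finset.range (x + 1), c u i j := by
    simp only [Expr.eval, eval_cell e2, e4, e5]
    rw [he s₃ e0 e2 et (by omega) (by omega) (by omega), h6, e4, e5, hI'' i j hi hj,
      if_neg (by omega), if_pos ⟨rfl, rfl⟩, ← Finset.sum_range_succ fun u => c u i j]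
  rw [tab_setReg, tab_put e2 (by simp only [Expr.eval, e5]; exact hj) hl,
    Expr.eval_clamp _ _ (by rw [hev, e3, Finset.sum_range_succ]; exact hsum x hx i j), hev,
    hI'' k l hk hl]
  simp only [Expr.eval, e4, e5, true_and]
  by_cases hc' : k = i ∧ l = j
  · obtain ⟨rfl, rfl⟩ := hc'
    simp
  · simp only [hc', if_false]

/-! ### Dynamic programming -/

/-- The value of a path through register `6`. -/
def candidate (op : Expr → Expr → Expr) : Expr :=
  op (.cell 6 (.reg 6) (.reg 4)) (.add (.cell 4 (.reg 6) (.reg 4)) (.cell 5 (.reg 4) (.reg 5)))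

/-- Try all predecessors of register `4`. -/
def relaxCmd (op : Expr → Expr → Expr) : Cmd :=
  .iter 6 (.ite (.cell 1 (.reg 6) (.reg 4)) (.ite (.lt (candidate op) (.cell 6 (.reg 4) (.reg 5)))
    (.seq (.put 7 (.reg 4) (.reg 5) (.reg 6)) (.put 6 (.reg 4) (.reg 5) (.clamp (candidate op))))))

/-- Compute the optimal values of paths in table `6` and the predecessors in table `7`. -/
def optimizeCmd (op : Expr → Expr → Expr) : Cmd :=
  .iter 4 (.ite (.reg 4) (.iter 5 (.seq (.put 6 (.reg 4) (.reg 5) (.reg 3)) (relaxCmd op))))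

/-- The entries of the tables `f` of values and `p` of predecessors at `(j, k)` satisfy the
recurrence of dynamic programming, where `M` stands for infinity. -/
structure IsOptimalAt (E : ℕ → ℕ → Prop) (op L R : ℕ → ℕ → ℕ) (M : ℕ) (f p : ℕ → ℕ → ℕ)
    (j k : ℕ) : Prop where
  zero : j = 0 → f j k = 0
  le : ∀ i, E i j → f j k ≤ op (f i j) (L i j + R j k)
  attained : j ≠ 0 → f j k < M → E (p j k) j ∧ f j k = op (f (p j k) j) (L (p j k) j + R j k)

/-- The recurrence at `(j, k)` reads only values in column `j`, at the predecessors of `j`. Later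
writes elsewhere therefore do not destroy it. -/
theorem IsOptimalAt.congr {E : ℕ → ℕ → Prop} {op L R : ℕ → ℕ → ℕ} {M : ℕ} {f p f' p' : ℕ → ℕ → ℕ}
    {j k : ℕ} (h : IsOptimalAt E op L R M f p j k) (hf : f' j k = f j k) (hp : p' j k = p j k)
    (hE : ∀ i, E i j → f' i j = f i j) : IsOptimalAt E op L R M f' p' j k where
  zero h0 := hf.trans (h.zero h0)
  le i hi := by rw [hf, hE i hi]; exact h.le i hi
  attained h0 hlt := by
    rw [hf] at hlt ⊢
    rw [hp]
    have := h.attained h0 hlt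
    exact ⟨this.1, by rw [hE _ this.1]; exact this.2⟩

/-- The lower bound of dynamic programming, by induction along the path; that it is attained follows
from tracing back the predecessors. -/
theorem ValuedPath.ge_of_isOptimalAt {op L R : ℕ → ℕ → ℕ} {M N : ℕ} {f p : ℕ → ℕ → ℕ}
    (hop : ∀ a b c, a ≤ b → op a c ≤ op b c)
    (h : ∀ j k, j < N → k < N → IsOptimalAt (Link pos) op L R M f p j k) {j k v : ℕ} {K : Finset ℕ}
    (hv : ValuedPath (Link pos) op L R j k K v) (hj : j < N) (hk : k < N) : f j k ≤ v := by
  induction hv with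
  | base k => rw [(h 0 k hj hk).zero rfl]
  | step k _ hij ih =>
    exact ((h _ k hj hk).le _ hij).trans (hop _ _ _ (ih (hij.1.trans hj) hj))

theorem run_relaxCmd {op : ℕ → ℕ → ℕ} {opE : Expr → Expr → Expr}
    (hop : ∀ s e f, (opE e f).eval s = op (e.eval s) (f.eval s)) {L R : ℕ → ℕ → ℕ} {j k : ℕ}
    (hj : j < n + 2) (hk : k < n + 2) (h2 : s.reg 2 = n + 2) (h3 : s.reg 3 = (n + 2) ^ 3)
    (h4 : s.reg 4 = j) (h5 : s.reg 5 = k) (hl : HasLinks n pos s) (h0 : j ≠ 0)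
    (hL : ∀ i j, i < n + 2 → j < n + 2 → s.tab (n + 2) 4 i j = L i j)
    (hR : ∀ i j, i < n + 2 → j < n + 2 → s.tab (n + 2) 5 i j = R i j)
    (hM : s.tab (n + 2) 6 j k = (n + 2) ^ 3) :
    IsOptimalAt (Link pos) op L R ((n + 2) ^ 3) (((relaxCmd opE).run s).tab (n + 2) 6)
      (((relaxCmd opE).run s).tab (n + 2) 7) j k ∧
    ∀ a b, a < n + 2 → b < n + 2 → ¬ (a = j ∧ b = k) →
      ((relaxCmd opE).run s).tab (n + 2) 6 a b = s.tab (n + 2) 6 a b ∧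
      ((relaxCmd opE).run s).tab (n + 2) 7 a b = s.tab (n + 2) 7 a b := by
  classical
  have key := Cmd.run_for_frame h2 (x := 6) (p := .ite (.cell 1 (.reg 6) (.reg 4))
    (.ite (.lt (candidate opE) (.cell 6 (.reg 4) (.reg 5)))
    (.seq (.put 7 (.reg 4) (.reg 5) (.reg 6)) (.put 6 (.reg 4) (.reg 5) (.clamp (candidate opE))))))
    (fun x s₁ => (∀ a b, a < n + 2 → b < n + 2 → ¬ (a = j ∧ b = k) →
        s₁.tab (n + 2) 6 a b = s.tab (n + 2) 6 a b ∧
        s₁.tab (n + 2) 7 a b = s.tab (n + 2) 7 a b) ∧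
      s₁.tab (n + 2) 6 j k ≤ (n + 2) ^ 3 ∧
      (∀ i < x, Link pos i j →
        s₁.tab (n + 2) 6 j k ≤ op (s.tab (n + 2) 6 i j) (L i j + R j k)) ∧
      (s₁.tab (n + 2) 6 j k < (n + 2) ^ 3 → Link pos (s₁.tab (n + 2) 7 j k) j ∧
        s₁.tab (n + 2) 6 j k = op (s.tab (n + 2) 6 (s₁.tab (n + 2) 7 j k) j)
          (L (s₁.tab (n + 2) 7 j k) j + R j k))) ?_ ?_
  · obtain ⟨hoth, hle, hopt, hatt⟩ := key
    change ∀ a b, a < n + 2 → b < n + 2 → ¬ (a = j ∧ b = k) →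
      ((relaxCmd opE).run s).tab (n + 2) 6 a b = s.tab (n + 2) 6 a b ∧
      ((relaxCmd opE).run s).tab (n + 2) 7 a b = s.tab (n + 2) 7 a b at hoth
    -- Predecessors are smaller than `j`, so the entries from which the candidates are formed differ
    -- from the one being written.
    have hrow : ∀ i, Link pos i j →
        ((relaxCmd opE).run s).tab (n + 2) 6 i j = s.tab (n + 2) 6 i j := fun i hi => by
      have := hi.1
      exact (hoth i j (by omega) hj (by omega)).1
    refine ⟨⟨fun h => absurd h h0, fun i hi => ?_, fun _ hlt => ?_⟩, hoth⟩
    · rw [hrow i hi]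
      exact hopt i (by have := hi.1; omega) hi
    · obtain ⟨h1, h2⟩ := hatt hlt
      refine ⟨h1, ?_⟩
      exact h2.trans (congrArg (op · _) (hrow _ h1).symm)
  · refine ⟨fun a b _ _ _ => ⟨rfl, rfl⟩, ?_, fun i hi => absurd hi (Nat.not_lt_zero i), ?_⟩
    · rw [tab_setReg, hM]
    · rw [tab_setReg, hM]
      exact fun h => absurd h (lt_irrefl _)
  · intro x hx s₁ h6 hr hA ⟨hoth, hle, hopt, hatt⟩
    have e2 : s₁.reg 2 = n + 2 := (hr 2 rfl).trans h2
    have e3 : s₁.reg 3 = (n + 2) ^ 3 := (hr 3 rfl).trans h3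
    have e4 : s₁.reg 4 = j := (hr 4 rfl).trans h4
    have e5 : s₁.reg 5 = k := (hr 5 rfl).trans h5
    have t1 : s₁.tab (n + 2) 1 x j = if Link pos x j then 1 else 0 := by
      rw [← hl x j hx hj, State.tab, State.tab, hA 1 rfl]
    have t4 : s₁.tab (n + 2) 4 x j = L x j := by
      rw [← hL x j hx hj, State.tab, State.tab, hA 4 rfl]
    have t5 : s₁.tab (n + 2) 5 j k = R j k := by
      rw [← hR j k hj hk, State.tab, State.tab, hA 5 rfl]
    set c := op (s.tab (n + 2) 6 x j) (L x j + R j k) with hc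
    have hcand : ∀ s₂ : State, s₂.reg = s₁.reg → (∀ b, b ≠ 7 → s₂.arr b = s₁.arr b) →
        Link pos x j → (candidate opE).eval s₂ = c := by
      intro s₂ hr2 ha2 hx'
      have hlt := hx'.1
      have g2 : s₂.reg 2 = n + 2 := by rw [hr2, e2]
      simp only [candidate, hop, Expr.eval, eval_cell g2, hr2, e4, e5, h6]
      simp only [State.tab, ha2 4 (by norm_num), ha2 5 (by norm_num), ha2 6 (by norm_num)]
      have := (hoth x j hx hj (by omega)).1
      simp only [State.tab] at this t4 t5
      rw [this, t4, t5]
      rfl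
    by_cases hxj : Link pos x j
    swap
    · have h0 : (Expr.cell 1 (.reg 6) (.reg 4)).eval s₁ = 0 := by
        simp [eval_cell e2, Expr.eval, h6, e4, t1, hxj]
      simp only [Cmd.run, h0, if_true, tab_setReg]
      refine ⟨hoth, hle, fun i hi hij => hopt i ?_ hij, hatt⟩
      have : i ≠ x := by rintro rfl; exact hxj hij
      omega
    have h1 : (Expr.cell 1 (.reg 6) (.reg 4)).eval s₁ ≠ 0 := by
      simp [eval_cell e2, Expr.eval, h6, e4, t1, hxj]
    have hcmp : (Expr.lt (candidate opE) (.cell 6 (.reg 4) (.reg 5))).eval s₁ =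
        if c < s₁.tab (n + 2) 6 j k then 1 else 0 := by
      simp only [Expr.eval, hcand s₁ rfl (fun _ _ => rfl) hxj, eval_cell e2, e4, e5]
    simp only [Cmd.run, if_neg h1, hcmp]
    by_cases hlt : c < s₁.tab (n + 2) 6 j k
    swap
    · simp only [hlt, if_false, if_true, tab_setReg]
      refine ⟨hoth, hle, fun i hi hij => ?_, hatt⟩
      rcases (Nat.lt_succ_iff.1 hi).eq_or_lt with rfl | hi
      exacts [not_lt.1 hlt, hopt i hi hij]
    · simp only [hlt, if_true, one_ne_zero, if_false, tab_setReg]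
      set s₂ := (Cmd.put 7 (.reg 4) (.reg 5) (.reg 6)).run s₁ with hs₂
      have g2 : s₂.reg 2 = n + 2 := e2
      have g3 : s₂.reg 3 = (n + 2) ^ 3 := e3
      have g4 : s₂.reg 4 = j := e4
      have g5 : s₂.reg 5 = k := e5
      have gc : (candidate opE).eval s₂ = c := hcand s₂ rfl
        (fun b hb => by rw [hs₂]; exact State.setArr_arr_ne _ _ _ hb) hxj
      -- The candidate has just beaten an entry that is at most `(n + 2) ^ 3`, so the clamping is
      -- harmless.
      have gcl : (Expr.clamp (candidate opE)).eval s₂ = c := by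
        rw [Expr.eval_clamp _ _ (by rw [gc, g3]; omega), gc]
      have t6 : ∀ a b, b < n + 2 → ((Cmd.put 6 (.reg 4) (.reg 5)
          (.clamp (candidate opE))).run s₂).tab (n + 2) 6 a b =
          if a = j ∧ b = k then c else s₁.tab (n + 2) 6 a b := by
        intro a b hb
        rw [tab_put g2 (by simp only [Expr.eval, g5]; exact hk) hb, gcl, hs₂,
          tab_put e2 (by simp only [Expr.eval, e5]; exact hk) hb]
        simp [Expr.eval, e4, e5]
      have t7 : ∀ a b, b < n + 2 → ((Cmd.put 6 (.reg 4) (.reg 5)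
          (.clamp (candidate opE))).run s₂).tab (n + 2) 7 a b =
          if a = j ∧ b = k then x else s₁.tab (n + 2) 7 a b := by
        intro a b hb
        rw [tab_put g2 (by simp only [Expr.eval, g5]; exact hk) hb, hs₂,
          tab_put e2 (by simp only [Expr.eval, e5]; exact hk) hb]
        simp [Expr.eval, e4, e5, h6]
      rw [t6 j k hk, t7 j k hk, if_pos ⟨rfl, rfl⟩, if_pos ⟨rfl, rfl⟩]
      refine ⟨fun a b ha hb hab => ?_, by omega, fun i hi hij => ?_, fun _ => ⟨hxj, rfl⟩⟩
      · rw [t6 a b hb, t7 a b hb, if_neg hab, if_neg hab]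
        exact hoth a b ha hb hab
      · rcases (Nat.lt_succ_iff.1 hi).eq_or_lt with rfl | hi
        exacts [le_rfl, hlt.le.trans (hopt i hi hij)]

theorem run_optimizeCmd {op : ℕ → ℕ → ℕ} {opE : Expr → Expr → Expr}
    (hop : ∀ s e f, (opE e f).eval s = op (e.eval s) (f.eval s)) {L R : ℕ → ℕ → ℕ}
    (h2 : s.reg 2 = n + 2) (h3 : s.reg 3 = (n + 2) ^ 3) (hl : HasLinks n pos s)
    (hL : ∀ i j, i < n + 2 → j < n + 2 → s.tab (n + 2) 4 i j = L i j)
    (hR : ∀ i j, i < n + 2 → j < n + 2 → s.tab (n + 2) 5 i j = R i j)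
    (hz : ∀ k, s.arr 6 k = 0) :
    ∀ j k, j < n + 2 → k < n + 2 → IsOptimalAt (Link pos) op L R ((n + 2) ^ 3)
      (((optimizeCmd opE).run s).tab (n + 2) 6) (((optimizeCmd opE).run s).tab (n + 2) 7) j k := by
  have key := Cmd.run_for_frame h2 (x := 4) (p := .ite (.reg 4) (.iter 5
    (.seq (.put 6 (.reg 4) (.reg 5) (.reg 3)) (relaxCmd opE))))
    -- Row `0` is skipped by the command: its initial zeros are the values of the trivial path.
    -- Every other row uses earlier rows only, as links go upwards.
    (fun x s₁ => (∀ k, k < n + 2 → s₁.tab (n + 2) 6 0 k = 0) ∧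
      ∀ j k, j < x → j < n + 2 → k < n + 2 → IsOptimalAt (Link pos) op L R ((n + 2) ^ 3)
        (s₁.tab (n + 2) 6) (s₁.tab (n + 2) 7) j k) ?_ ?_
  · exact fun j k hj hk => key.2 j k hj hj hk
  · refine ⟨fun k _ => ?_, fun j k hj => absurd hj (Nat.not_lt_zero j)⟩
    rw [tab_setReg, State.tab, hz]
  intro j hj s₁ h4 hr hA ⟨hI0, hI⟩
  rw [Cmd.run_ite]
  by_cases h0 : j = 0
  · subst h0
    have : (Expr.reg 4).eval s₁ = 0 := h4
    rw [if_pos this]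
    refine ⟨hI0, fun j k hj hj' hk => ?_⟩
    obtain rfl : j = 0 := by omega
    exact ⟨fun _ => hI0 k hk, fun i hi => absurd hi.1 (Nat.not_lt_zero i), fun h => absurd rfl h⟩
  have hne : (Expr.reg 4).eval s₁ ≠ 0 := by simpa only [Expr.eval, h4] using h0
  rw [if_neg hne]
  have inner := Cmd.run_for_frame (s := s₁) ((hr 2 rfl).trans h2) (x := 5)
    (p := .seq (.put 6 (.reg 4) (.reg 5) (.reg 3)) (relaxCmd opE))
    (fun x s₂ => (∀ a b, a < n + 2 → b < n + 2 → a ≠ j →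
        s₂.tab (n + 2) 6 a b = s₁.tab (n + 2) 6 a b ∧
        s₂.tab (n + 2) 7 a b = s₁.tab (n + 2) 7 a b) ∧
      ∀ k, k < x → k < n + 2 → IsOptimalAt (Link pos) op L R ((n + 2) ^ 3)
        (s₂.tab (n + 2) 6) (s₂.tab (n + 2) 7) j k) ?_ ?_
  · obtain ⟨hoth, hopt⟩ := inner
    refine ⟨fun k hk => ?_, fun a k ha ha' hk => ?_⟩
    · rw [tab_setReg, (hoth 0 k (by omega) hk (Ne.symm h0)).1, hI0 k hk]
    · rcases (Nat.lt_succ_iff.1 ha).eq_or_lt with rfl | ha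
      · exact hopt k hk hk
      · exact (hI a k ha ha' hk).congr (hoth a k ha' hk (by omega)).1
          (hoth a k ha' hk (by omega)).2
          fun i hi => (hoth i a (by have := hi.1; omega) ha' (by have := hi.1; omega)).1
  · exact ⟨fun a b _ _ _ => ⟨rfl, rfl⟩, fun k hk => absurd hk (Nat.not_lt_zero k)⟩
  intro k hk s₂ h5 hr' hA' ⟨hoth, hopt⟩
  rw [Cmd.run_seq]
  set s₃ := (Cmd.put 6 (.reg 4) (.reg 5) (.reg 3)).run s₂ with hs₃
  have e2 : s₂.reg 2 = n + 2 := (hr' 2 rfl).trans ((hr 2 rfl).trans h2)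
  have e3 : s₂.reg 3 = (n + 2) ^ 3 := (hr' 3 rfl).trans ((hr 3 rfl).trans h3)
  have e4 : s₂.reg 4 = j := (hr' 4 rfl).trans h4
  have ga : ∀ b, b = 1 ∨ b = 4 ∨ b = 5 → s₃.arr b = s.arr b := by
    intro b hb
    have h6 : s₃.arr b = s₂.arr b := by
      rw [hs₃]; exact State.setArr_arr_ne _ _ _ (by omega)
    rw [h6]
    rcases hb with rfl | rfl | rfl
    exacts [(hA' 1 rfl).trans (hA 1 rfl), (hA' 4 rfl).trans (hA 4 rfl),
      (hA' 5 rfl).trans (hA 5 rfl)]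
  have t6 : ∀ a b, b < n + 2 → s₃.tab (n + 2) 6 a b =
      if a = j ∧ b = k then (n + 2) ^ 3 else s₂.tab (n + 2) 6 a b := by
    intro a b hb
    rw [hs₃, tab_put e2 (by simp only [Expr.eval, h5]; exact hk) hb]
    simp [Expr.eval, e4, h5, e3]
  have t7 : ∀ a b, s₃.tab (n + 2) 7 a b = s₂.tab (n + 2) 7 a b := by
    intro a b
    rw [State.tab, State.tab, hs₃]
    simp only [Cmd.put, Cmd.run]
    rw [State.setArr_arr_ne _ _ _ (by norm_num)]
  obtain ⟨ho, hothers⟩ := run_relaxCmd (s := s₃) hop (L := L) (R := R) hj hk e2 e3 e4 h5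
    (fun a b ha hb => by rw [State.tab, ga 1 (by simp)]; exact hl a b ha hb) h0
    (fun a b ha hb => by rw [State.tab, ga 4 (by simp)]; exact hL a b ha hb)
    (fun a b ha hb => by rw [State.tab, ga 5 (by simp)]; exact hR a b ha hb)
    (by rw [t6 j k hk, if_pos ⟨rfl, rfl⟩])
  have hfin : ∀ a b, a < n + 2 → b < n + 2 → ¬ (a = j ∧ b = k) →
      ((relaxCmd opE).run s₃).tab (n + 2) 6 a b = s₂.tab (n + 2) 6 a b ∧
      ((relaxCmd opE).run s₃).tab (n + 2) 7 a b = s₂.tab (n + 2) 7 a b := by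
    intro a b ha hb hab
    rw [(hothers a b ha hb hab).1, (hothers a b ha hb hab).2, t6 a b hb, if_neg hab, t7]
    exact ⟨rfl, rfl⟩
  refine ⟨fun a b ha hb haj => ?_, fun l hl' hl'' => ?_⟩
  · rw [tab_setReg, tab_setReg, (hfin a b ha hb (by omega)).1, (hfin a b ha hb (by omega)).2]
    exact hoth a b ha hb haj
  · by_cases hlk : l = k
    · subst hlk
      exact ho
    · exact (hopt l (by omega) hl'').congr (hfin j l hj hl'' (by omega)).1
        (hfin j l hj hl'' (by omega)).2
        fun i hi => (hfin i j (by have := hi.1; omega) hj (by have := hi.1; omega)).1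

/-! ### Tracing back an optimal path -/

/-- Follow the predecessors in table `7` from the sink and mark the path in array `8`. -/
def traceCmd : Cmd :=
  .seq (.assign 7 (.sub (.reg 2) (.const 1))) (.seq (.assign 8 (.const 0))
    (.iter 4 (.ite (.reg 7) (.seq (.store 8 (.reg 7) (.const 1))
      (.seq (.assign 9 (.cell 7 (.reg 7) (.reg 8)))
        (.seq (.assign 8 (.reg 7)) (.assign 7 (.reg 9))))))))

/-- Registers `7` and `8` hold the current vertex and its successor, the state of the dynamic
program. The vertex `0` is never marked, hence its separate mention. -/
theorem run_traceCmd {op L R f : ℕ → ℕ → ℕ} (hop : ∀ a b, a ≤ op a b)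
    (h2 : s.reg 2 = n + 2) (hz : ∀ k, s.arr 8 k = 0)
    (hopt : ∀ j k, j < n + 2 → k < n + 2 → IsOptimalAt (Link pos) op L R ((n + 2) ^ 3) f
      (s.tab (n + 2) 7) j k) (hlt : f (n + 1) 0 < (n + 2) ^ 3) :
    ∃ K, ValuedPath (Link pos) op L R (n + 1) 0 K (f (n + 1) 0) ∧
      ∀ g, g ∈ K ↔ g = 0 ∨ (traceCmd.run s).arr 8 g ≠ 0 := by
  classical
  set s₀ := (s.setReg 7 (n + 1)).setReg 8 0 with hs₀
  have key := Cmd.run_for_frame (s := s₀) (W := n + 2) (by simp [hs₀, h2]) (x := 4)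
    (p := .ite (.reg 7) (.seq (.store 8 (.reg 7) (.const 1))
      (.seq (.assign 9 (.cell 7 (.reg 7) (.reg 8)))
        (.seq (.assign 8 (.reg 7)) (.assign 7 (.reg 9))))))
    -- Any path that realizes the value of the current pair is completed by the marked set to one
    -- realizing the value at the sink. The current vertex decreases in every round until it is `0`,
    -- so `n + 2` rounds are enough.
    (fun x s₁ => s₁.reg 7 < n + 2 ∧ s₁.reg 8 < n + 2 ∧ (s₁.reg 7 = 0 ∨ s₁.reg 7 + x ≤ n + 1) ∧ f (s₁.reg 7) (s₁.reg 8) < (n + 2) ^ 3 ∧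
      ∃ S : Finset ℕ, (∀ g, g ∈ S ↔ s₁.arr 8 g ≠ 0) ∧
        ∀ K, ValuedPath (Link pos) op L R (s₁.reg 7) (s₁.reg 8) K (f (s₁.reg 7) (s₁.reg 8)) →
          ValuedPath (Link pos) op L R (n + 1) 0 (S ∪ K) (f (n + 1) 0)) ?_ ?_
  · obtain ⟨-, h8, hle, -, S, hS, hK⟩ := key
    set sf := (Cmd.iter 4 (.ite (.reg 7) (.seq (.store 8 (.reg 7) (.const 1))
      (.seq (.assign 9 (.cell 7 (.reg 7) (.reg 8)))
        (.seq (.assign 8 (.reg 7)) (.assign 7 (.reg 9))))))).run s₀ with hsf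
    have hrun : traceCmd.run s = sf := by
      rw [hsf]
      simp only [traceCmd, Cmd.run, Expr.eval, h2, hs₀]
      rfl
    have h7 : sf.reg 7 = 0 := by
      omega
    rw [h7] at hK
    refine ⟨S ∪ {0}, hK {0} ?_, fun g => ?_⟩
    · rw [(hopt 0 _ (by omega) h8).zero rfl]
      exact .base _
    · rw [hrun, Finset.mem_union, hS, Finset.mem_singleton, or_comm]
  · have e7 : (s₀.setReg 4 0).reg 7 = n + 1 := by simp [hs₀]
    have e8 : (s₀.setReg 4 0).reg 8 = 0 := by simp [hs₀]
    rw [e7, e8]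
    refine ⟨by omega, by omega, by omega, hlt, ∅, fun g => ?_, fun K hK => by simpa using hK⟩
    simp [hs₀, hz]
  · intro x hx s₁ _ hr hA ⟨h7, h8, hle, hf, S, hS, hK⟩
    rw [Cmd.run_ite]
    by_cases h0 : s₁.reg 7 = 0
    · have : (Expr.reg 7).eval s₁ = 0 := h0
      rw [if_pos this]
      simp only [State.setReg_reg, State.setReg_arr, Nat.reduceEqDiff, if_false]
      refine ⟨h7, h8, Or.inl h0, hf, S, hS, hK⟩
    · have hne : (Expr.reg 7).eval s₁ ≠ 0 := h0
      have e2 : s₁.reg 2 = n + 2 := (hr 2 rfl).trans (by simp [hs₀, h2])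
      simp only [if_neg hne, Cmd.run]
      obtain ⟨hlink, hval⟩ := (hopt _ _ h7 h8).attained h0 hf
      have e7 : s₁.tab (n + 2) 7 (s₁.reg 7) (s₁.reg 8) =
          s.tab (n + 2) 7 (s₁.reg 7) (s₁.reg 8) := by
        rw [State.tab, State.tab, hA 7 rfl]; rfl
      set p := s.tab (n + 2) 7 (s₁.reg 7) (s₁.reg 8) with hp
      have ht : (s₁.setArr 8 (s₁.reg 7) 1).tab (n + 2) 7 (s₁.reg 7) (s₁.reg 8) = p := by
        rw [State.tab, State.setArr_arr_ne _ _ _ (by norm_num)]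
        exact e7
      have hc : (Expr.cell 7 (.reg 7) (.reg 8)).eval (s₁.setArr 8 (s₁.reg 7) 1) = p := by
        rw [eval_cell (by simpa using e2)]
        exact ht
      simp only [Expr.eval, hc, State.setReg_reg, State.setReg_arr, State.setArr_reg,
        Nat.reduceEqDiff, if_false, if_true]
      have hpl := hlink.1
      refine ⟨by omega, h7, by omega, ?_, insert (s₁.reg 7) S, fun g => ?_, fun K hK' => ?_⟩
      -- Values do not increase backwards along the path, so they remain finite and a predecessor is
      -- recorded at each nonzero vertex.
      · calc f p (s₁.reg 7) ≤ _ := hop _ _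
          _ = f (s₁.reg 7) (s₁.reg 8) := hval.symm
          _ < _ := hf
      · rw [Finset.mem_insert, hS, State.setArr_arr_self]
        by_cases hg : g = s₁.reg 7 <;> simp [hg]
      · have := hK _ (hval ▸ ValuedPath.step (s₁.reg 8) hK' hlink)
        rwa [Finset.union_insert, ← Finset.insert_union] at this

/-! ### The delegations -/

/-- Let every voter delegate to her best element of the set marked in array `8` (or abstain). -/
def delegateCmd : Cmd :=
  .iter 4 (.ite (.lt (.reg 4) (.reg 0)) (.seq (.assign 6 (.const 0)) (.seq
    (.iter 5 (.ite (.arr 8 (.reg 5)) (.ite (.lt (.cell 2 (.add (.reg 4) (.const 1)) (.reg 5))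
      (.cell 2 (.add (.reg 4) (.const 1)) (.reg 6))) (.assign 6 (.reg 5)))))
    (.store 1 (.reg 4) (.reg 6)))))

/-- The search starts at abstention and replaces the current choice only by a strictly better one. A
choice other than `0` is thus strictly better than abstention and cannot be the sink. -/
theorem run_delegateCmd (h0 : s.reg 0 = n) (h2 : s.reg 2 = n + 2) (hs : HasTable n pos s) :
    ∀ u < n, ∃ b, (delegateCmd.run s).arr 1 u = b ∧ b < n + 2 ∧
      (b = 0 ∨ s.arr 8 b ≠ 0 ∧ pos (u + 1) b < pos (u + 1) 0) ∧ pos (u + 1) b ≤ pos (u + 1) 0 ∧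
      ∀ g < n + 2, s.arr 8 g ≠ 0 → pos (u + 1) b ≤ pos (u + 1) g := by
  have key := Cmd.run_for_frame h2 (x := 4) (p := .ite (.lt (.reg 4) (.reg 0))
    (.seq (.assign 6 (.const 0)) (.seq
    (.iter 5 (.ite (.arr 8 (.reg 5)) (.ite (.lt (.cell 2 (.add (.reg 4) (.const 1)) (.reg 5))
      (.cell 2 (.add (.reg 4) (.const 1)) (.reg 6))) (.assign 6 (.reg 5)))))
    (.store 1 (.reg 4) (.reg 6)))))
    (fun x s₁ => ∀ u < n, u < x → ∃ b, s₁.arr 1 u = b ∧ b < n + 2 ∧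
      (b = 0 ∨ s.arr 8 b ≠ 0 ∧ pos (u + 1) b < pos (u + 1) 0) ∧ pos (u + 1) b ≤ pos (u + 1) 0 ∧
      ∀ g < n + 2, s.arr 8 g ≠ 0 → pos (u + 1) b ≤ pos (u + 1) g) ?_ ?_
  · exact fun u hu => key u hu (by omega)
  · exact fun u _ hu => absurd hu (Nat.not_lt_zero u)
  intro v hv s₁ h4 hr hA hI
  have e0 : s₁.reg 0 = n := (hr 0 rfl).trans h0
  simp only [Cmd.run_ite, Cmd.run_seq, Cmd.run_assign, Cmd.run_store, Expr.eval, h4, e0]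
  by_cases hvn : v < n
  swap
  · simp only [hvn, if_false, if_true, State.setReg_arr]
    exact fun u hu _ => hI u hu (by omega)
  simp only [hvn, if_true, one_ne_zero, if_false]
  have inner := Cmd.run_for_frame (s := s₁.setReg 6 0) (W := n + 2)
    (by simp [hr 2 rfl, h2]) (x := 5)
    (p := .ite (.arr 8 (.reg 5)) (.ite (.lt (.cell 2 (.add (.reg 4) (.const 1)) (.reg 5))
      (.cell 2 (.add (.reg 4) (.const 1)) (.reg 6))) (.assign 6 (.reg 5))))
    (fun x s₂ => s₂.reg 6 < n + 2 ∧ (s₂.reg 6 = 0 ∨ s.arr 8 (s₂.reg 6) ≠ 0 ∧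
        pos (v + 1) (s₂.reg 6) < pos (v + 1) 0) ∧ pos (v + 1) (s₂.reg 6) ≤ pos (v + 1) 0 ∧
      ∀ g < x, s.arr 8 g ≠ 0 → pos (v + 1) (s₂.reg 6) ≤ pos (v + 1) g) ?_ ?_
  · set s₂ := (Cmd.iter 5 (.ite (.arr 8 (.reg 5))
      (.ite (.lt (.cell 2 (.add (.reg 4) (.const 1)) (.reg 5))
      (.cell 2 (.add (.reg 4) (.const 1)) (.reg 6))) (.assign 6 (.reg 5))))).run
      (s₁.setReg 6 0) with hs₂
    have g4 : s₂.reg 4 = v := by rw [hs₂, Cmd.run_reg rfl]; simpa using h4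
    have g1 : s₂.arr 1 = s₁.arr 1 := by rw [hs₂, Cmd.run_arr rfl]; rfl
    have hfin : ∀ u < n, u < v + 1 → ∃ b, (s₂.setArr 1 (s₂.reg 4) (s₂.reg 6)).arr 1 u = b ∧
        b < n + 2 ∧ (b = 0 ∨ s.arr 8 b ≠ 0 ∧ pos (u + 1) b < pos (u + 1) 0) ∧
        pos (u + 1) b ≤ pos (u + 1) 0 ∧
        ∀ g < n + 2, s.arr 8 g ≠ 0 → pos (u + 1) b ≤ pos (u + 1) g := by
      intro u hu huv
      rw [State.setArr_arr_self, g4, g1]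
      by_cases h : u = v
      · subst h
        rw [if_pos rfl]
        exact ⟨_, rfl, inner⟩
      · rw [if_neg h]
        exact hI u hu (by omega)
    exact hfin
  · simp
  intro x hx s₂ h5 hr' hA' hI'
  have f2 : s₂.reg 2 = n + 2 := (hr' 2 rfl).trans (by simp [hr 2 rfl, h2])
  have f4 : s₂.reg 4 = v := (hr' 4 rfl).trans (by simpa using h4)
  have f8 : s₂.arr 8 = s.arr 8 := (hA' 8 rfl).trans (hA 8 rfl)
  have ft : HasTable n pos s₂ := hs.congr ((hA' 2 rfl).trans (hA 2 rfl))
  simp only [Cmd.run, Expr.eval, eval_cell f2, f4, h5, f8, ft (v + 1) x (by omega) hx,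
    ft (v + 1) (s₂.reg 6) (by omega) hI'.1]
  obtain ⟨h1, h2', h3, h4'⟩ := hI'
  by_cases hx8 : s.arr 8 x = 0
  · simp only [hx8, if_true, State.setReg_reg, Nat.reduceEqDiff, if_false]
    refine ⟨h1, h2', h3, fun g hg hg8 => h4' g ?_ hg8⟩
    have : g ≠ x := by rintro rfl; exact hg8 hx8
    omega
  · by_cases hlt : pos (v + 1) x < pos (v + 1) (s₂.reg 6)
    · simp only [hx8, hlt, if_true, one_ne_zero, if_false, State.setReg_reg, Nat.reduceEqDiff]
      refine ⟨hx, Or.inr ⟨hx8, hlt.trans_le h3⟩, (hlt.trans_le h3).le, fun g hg hg8 => ?_⟩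
      rcases (Nat.lt_succ_iff.1 hg).eq_or_lt with rfl | hg
      exacts [le_rfl, hlt.le.trans (h4' g hg hg8)]
    · simp only [hx8, hlt, if_true, if_false, State.setReg_reg, Nat.reduceEqDiff]
      refine ⟨h1, h2', h3, fun g hg hg8 => ?_⟩
      rcases (Nat.lt_succ_iff.1 hg).eq_or_lt with rfl | hg
      exacts [not_lt.1 hlt, h4' g hg hg8]

/-! ### The optimization problems -/

/-- The algorithm for the optimization problems: `op` combines the contributions to the measure,
and `l` and `r` are the costs of the voters that precede and succeed a guru. -/
def optimalCmd (op : Expr → Expr → Expr) (l r : Expr) : Cmd :=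
  .seq prepareCmd (.seq (sumCmd 4 l) (.seq (sumCmd 5 r) (.seq (optimizeCmd op)
    (.seq traceCmd delegateCmd))))

/-- The value at the sink is a lower bound for every kernel. As some kernel exists and has measure
below `(n + 2) ^ 3`, this value is finite, and tracing back yields a kernel that attains it. -/
theorem run_optimalCmd (hT : PrefTable n pos) (hs : IsInput n pos s) {op : ℕ → ℕ → ℕ}
    {opE : Expr → Expr → Expr} (hopE : ∀ s e f, (opE e f).eval s = op (e.eval s) (f.eval s))
    (hmono : ∀ a b c, a ≤ b → op a c ≤ op b c) (hle : ∀ a b, a ≤ op a b) {l r : Expr}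
    {cl cr : ℕ → ℕ → ℕ → ℕ} (hl : Computes n pos l cl) (hr : Computes n pos r cr)
    (hcl : ∀ u i j, cl u i j ≤ n + 2) (hcr : ∀ u i j, cr u i j ≤ n + 2)
    {m : ℕ → ℕ → Finset ℕ → ℕ} (hm : PathMeasure n pos op
      (fun i j => ∑ u ∈ Finset.range (n + 2), cl u i j)
      (fun i j => ∑ u ∈ Finset.range (n + 2), cr u i j) m)
    (hlt : ∀ K, PartialKernel pos (n + 1) K → m (n + 1) 0 K < (n + 2) ^ 3) :
    ∃ K, PartialKernel pos (n + 1) K ∧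
      (∀ K', PartialKernel pos (n + 1) K' → m (n + 1) 0 K ≤ m (n + 1) 0 K') ∧
      ∀ u < n, ∃ b ∈ K, ((optimalCmd opE l r).run s).arr 1 u = b ∧ b ≤ n ∧
        ∀ g ∈ K, pos (u + 1) b ≤ pos (u + 1) g := by
  obtain ⟨ht, hlk⟩ := run_prepareCmd hT hs
  have hz1 : ∀ a, 4 ≤ a → a ≤ 8 → ∀ k, (prepareCmd.run s).arr a k = 0 := fun a h4 h9 k => by
    rw [← hs.zero a k (by omega)]
    interval_cases a <;> exact congrFun (Cmd.run_arr rfl s) k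
  have hr1 : ∀ y, y < 4 → (prepareCmd.run s).reg y = s.reg y := fun y hy => by
    interval_cases y <;> exact Cmd.run_reg rfl s
  set s₁ := prepareCmd.run s with hs₁
  set s₂ := (sumCmd 4 l).run s₁ with hs₂
  set s₃ := (sumCmd 5 r).run s₂ with hs₃
  set s₄ := (optimizeCmd opE).run s₃ with hs₄
  set s₅ := traceCmd.run s₄ with hs₅
  have r2 : ∀ y, y < 4 → s₂.reg y = s.reg y := fun y hy => by
    rw [← hr1 y hy]; interval_cases y <;> exact Cmd.run_reg rfl s₁
  have r3 : ∀ y, y < 4 → s₃.reg y = s.reg y := fun y hy => by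
    rw [← r2 y hy]; interval_cases y <;> exact Cmd.run_reg rfl s₂
  have r4 : ∀ y, y < 4 → s₄.reg y = s.reg y := fun y hy => by
    rw [← r3 y hy]; interval_cases y <;> exact Cmd.run_reg rfl s₃
  have r5 : ∀ y, y < 4 → s₅.reg y = s.reg y := fun y hy => by
    rw [← r4 y hy]; interval_cases y <;> exact Cmd.run_reg rfl s₄
  have a2 : ∀ b, b ≠ 4 → s₂.arr b = s₁.arr b := fun b hb =>
    Cmd.run_arr (by simpa [sumCmd, Cmd.put, Cmd.keepsArr] using hb.symm) s₁
  have a3 : ∀ b, b ≠ 5 → s₃.arr b = s₂.arr b := fun b hb =>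
    Cmd.run_arr (by simpa [sumCmd, Cmd.put, Cmd.keepsArr] using hb.symm) s₂
  have a4 : ∀ b, b ≠ 6 → b ≠ 7 → s₄.arr b = s₃.arr b := fun b hb hb' =>
    Cmd.run_arr (by
      simp [optimizeCmd, relaxCmd, Cmd.put, Cmd.keepsArr, hb.symm, hb'.symm]) s₃
  have t2 : HasTable n pos s₂ := ht.congr (a2 2 (by norm_num))
  have t3 : HasTable n pos s₃ := t2.congr (a3 2 (by norm_num))
  have t5 : HasTable n pos s₅ := (t3.congr (a4 2 (by norm_num) (by norm_num))).congr
    (Cmd.run_arr rfl s₄)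
  have hL := run_sumCmd (a := 4) (by norm_num) hl hcl ((hr1 0 (by norm_num)).trans hs.reg0)
    ((hr1 2 (by norm_num)).trans hs.reg2) ((hr1 3 (by norm_num)).trans hs.reg3) ht
    (hz1 4 (by norm_num) (by norm_num))
  have hR := run_sumCmd (s := s₂) (a := 5) (by norm_num) hr hcr
    ((r2 0 (by norm_num)).trans hs.reg0)
    ((r2 2 (by norm_num)).trans hs.reg2) ((r2 3 (by norm_num)).trans hs.reg3) t2
    (fun k => by rw [a2 5 (by norm_num)]; exact hz1 5 (by norm_num) (by norm_num) k)
  have hopt := run_optimizeCmd (s := s₃) hopE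
    (L := fun i j => ∑ u ∈ Finset.range (n + 2), cl u i j)
    (R := fun i j => ∑ u ∈ Finset.range (n + 2), cr u i j) ((r3 2 (by norm_num)).trans hs.reg2)
    ((r3 3 (by norm_num)).trans hs.reg3)
    (fun i j hi hj => by
      rw [State.tab, a3 1 (by norm_num), a2 1 (by norm_num)]; exact hlk i j hi hj)
    (fun i j hi hj => by rw [State.tab, a3 4 (by norm_num)]; exact hL i j hi hj) hR
    (fun k => by
      rw [a3 6 (by norm_num), a2 6 (by norm_num)]; exact hz1 6 (by norm_num) (by norm_num) k)
  have hbound : ∀ K, PartialKernel pos (n + 1) K → s₄.tab (n + 2) 6 (n + 1) 0 ≤ m (n + 1) 0 K :=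
    fun K hK => (hK.valuedPath hT hm le_rfl (Nat.zero_le _) (Or.inr rfl)).ge_of_isOptimalAt hmono
      hopt (by omega) (by omega)
  obtain ⟨K₀, hK₀⟩ := hT.exists_partialKernel
  obtain ⟨K, hpath, hmark⟩ := run_traceCmd (s := s₄) hle ((r4 2 (by norm_num)).trans hs.reg2)
    (fun k => by
      rw [a4 8 (by norm_num) (by norm_num), a3 8 (by norm_num), a2 8 (by norm_num)]
      exact hz1 8 (by norm_num) (by norm_num) k)
    hopt ((hbound K₀ hK₀).trans_lt (hlt K₀ hK₀))
  obtain ⟨hK, hval⟩ := hpath.partialKernel hT hm le_rfl (Nat.zero_le _) (Or.inr rfl)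
  refine ⟨K, hK, fun K' hK' => hval ▸ hbound K' hK', fun u hu => ?_⟩
  obtain ⟨b, hb, hbn, hb0, hbt, hbest⟩ := run_delegateCmd (s := s₅)
    ((r5 0 (by norm_num)).trans hs.reg0) ((r5 2 (by norm_num)).trans hs.reg2) t5 u hu
  refine ⟨b, (hmark b).2 (hb0.imp id And.left), hb, ?_, fun g hg => ?_⟩
  · rcases hb0 with rfl | h
    · omega
    · have : b ≠ n + 1 := by
        rintro rfl
        rw [hT.top] at h
        exact lt_irrefl _ h.2
      omega
  · rcases (hmark g).1 hg with rfl | h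
    · exact hbt
    · exact hbest g (by have := hK.le g hg; omega) h

end

/-! ### Profiles and their tables -/

/-- The inverse of `code`; all numbers above `n` stand for abstention, too. -/
def decode (n g : ℕ) : Option (Fin n) :=
  if h : 0 < g ∧ g ≤ n then some ⟨g - 1, by omega⟩ else none

/-- The table of the positions in the preference lists. -/
def Profile.table {n : ℕ} (P : Profile n) (u g : ℕ) : ℕ :=
  match decode n u with
  | none => 0
  | some i => P.pos i (decode n g)

section

variable {n : ℕ} {P : Profile n}

theorem decode_succ (i : Fin n) : decode n (i + 1) = some i := by
  have := i.2
  simp only [decode]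
  rw [dif_pos (by omega)]
  simp

theorem decode_of_outside {g : ℕ} (h : g = 0 ∨ n < g) : decode n g = none := by
  simp only [decode]
  rw [dif_neg (by omega)]

theorem decode_code (g : Option (Fin n)) : decode n (code g) = g := by
  cases g with
  | none => exact decode_of_outside (Or.inl rfl)
  | some i => exact decode_succ i

theorem code_le (g : Option (Fin n)) : code g ≤ n := by
  cases g with
  | none => exact Nat.zero_le _
  | some i => exact i.2

theorem code_decode {g : ℕ} (hg : g ≤ n) : code (decode n g) = g := by
  simp only [decode]
  split_ifs with h
  · simp only [code]; omega
  · simp only [code]; omega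

theorem exists_succ_eq {u : ℕ} (h0 : 0 < u) (hn : u ≤ n) : ∃ i : Fin n, (i : ℕ) + 1 = u :=
  ⟨⟨u - 1, by omega⟩, by simp only []; omega⟩

theorem table_succ (i : Fin n) (g : ℕ) : P.table (i + 1) g = P.pos i (decode n g) := by
  rw [Profile.table, decode_succ]

theorem table_code (i : Fin n) (g : Option (Fin n)) : P.table (i + 1) (code g) = P.pos i g := by
  rw [table_succ, decode_code]

theorem table_zero (i : Fin n) : P.table (i + 1) 0 = P.pos i none := table_code i none

theorem table_voter (i j : Fin n) : P.table (i + 1) (j + 1) = P.pos i (some j) :=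
  table_code i (some j)

theorem Profile.SinglePeaked.prefTable (hP : P.SinglePeaked) : PrefTable n P.table where
  outside u g hu := by rw [Profile.table, decode_of_outside hu]
  top u := by
    simp only [Profile.table]
    rw [decode_of_outside (n := n) (g := n + 1) (by omega),
      decode_of_outside (n := n) (g := 0) (by omega)]
  right u j k h0 huj hjk hk := by
    obtain ⟨u, rfl⟩ := exists_succ_eq (n := n) h0 (by omega)
    obtain ⟨j, rfl⟩ := exists_succ_eq (n := n) (u := j) (by omega) (by omega)
    obtain ⟨k, rfl⟩ := exists_succ_eq (n := n) (u := k) (by omega) hk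
    rw [table_voter, table_voter]
    exact hP u j k (Or.inl ⟨by rw [Fin.lt_def]; omega, by rw [Fin.lt_def]; omega⟩)
  left u j k h0 hkj hju hu := by
    obtain ⟨u, rfl⟩ := exists_succ_eq (n := n) (u := u) (by omega) hu
    obtain ⟨j, rfl⟩ := exists_succ_eq (n := n) (u := j) (by omega) (by omega)
    obtain ⟨k, rfl⟩ := exists_succ_eq (n := n) h0 (by omega)
    rw [table_voter, table_voter]
    exact hP u j k (Or.inr ⟨by rw [Fin.lt_def]; omega, by rw [Fin.lt_def]; omega⟩)
  inj u g h h0 hn hg hh e := by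
    obtain ⟨u, rfl⟩ := exists_succ_eq (n := n) h0 hn
    rw [table_succ, table_succ] at e
    have := (P.pos u).injective (Fin.ext e)
    rw [← code_decode hg, this, code_decode hh]
  le u g := by
    rw [Profile.table]
    split
    · exact Nat.zero_le _
    · exact Nat.lt_succ_iff.1 (Fin.is_lt _)

theorem active_succ_iff (i : Fin n) : Active P.table (i + 1) ↔ ¬ P.IsAbstainer i := by
  rw [Active, table_zero, table_voter]
  rfl

/-- A non-abstainer ranks herself above abstention, so whoever beats herself beats abstention; the
second condition of acceptability is automatic. -/
theorem arc_succ_iff (i : Fin n) (hi : ¬ P.IsAbstainer i) (j : Fin n) :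
    Arc P.table (i + 1) (j + 1) ↔ j ∈ P.acc i := by
  rw [Arc, table_voter, table_voter]
  refine ⟨fun h => ⟨h, lt_of_lt_of_le h (not_lt.1 hi)⟩, fun h => h.1⟩

/-! ### The auxiliary digraph of a profile -/

theorem not_arc_zero {i : Fin n} (hi : Active P.table (i + 1)) : ¬ Arc P.table (i + 1) 0 := hi

theorem link_voter_iff (i j : Fin n) : Link P.table (i + 1) (j + 1) ↔
    AuxArc P (.voter i) (.voter j) := by
  constructor
  · rintro ⟨hij, hi, hj, hnij, hnji, hgap⟩
    rw [active_succ_iff] at hi hj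
    rw [arc_succ_iff _ hi] at hnij
    rw [arc_succ_iff _ hj] at hnji
    have hlt : (⟨i, hi⟩ : NonAbstainer P) < ⟨j, hj⟩ := by
      rw [Subtype.mk_lt_mk, Fin.lt_def]; omega
    refine .inner ⟨i, hi⟩ ⟨j, hj⟩ hlt ⟨?_, ?_, ?_⟩
    · rintro x (rfl | rfl)
      exacts [⟨le_rfl, hlt.le⟩, ⟨hlt.le, le_rfl⟩]
    · rintro u (rfl | rfl) v (rfl | rfl)
      exacts [fun h => lt_irrefl _ h.1, hnij, hnji, fun h => lt_irrefl _ h.1]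
    · rintro ⟨u, hu⟩ ⟨h1, h2⟩ hn
      simp only [Set.mem_insert_iff, Set.mem_singleton_iff, not_or, Subtype.mk.injEq] at hn
      have h1' : i ≤ u := h1
      have h2' : u ≤ j := h2
      rcases hgap (u + 1) (by have := lt_of_le_of_ne h1' (Ne.symm hn.1); omega)
        (by have := lt_of_le_of_ne h2' hn.2; omega) ((active_succ_iff u).2 hu) with h | h
      · exact ⟨⟨i, hi⟩, by simp, (arc_succ_iff u hu i).1 h⟩
      · exact ⟨⟨j, hj⟩, by simp, (arc_succ_iff u hu j).1 h⟩
  · rintro (⟨⟨i, hi⟩, ⟨j, hj⟩, hij, -, hind, habs⟩)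
    have hlt : i < j := hij
    refine ⟨Nat.succ_lt_succ hlt, (active_succ_iff i).2 hi,
      (active_succ_iff j).2 hj, ?_, ?_, fun u hu huj ha => ?_⟩
    · rw [arc_succ_iff _ hi]
      exact hind ⟨i, hi⟩ (by simp) ⟨j, hj⟩ (by simp)
    · rw [arc_succ_iff _ hj]
      exact hind ⟨j, hj⟩ (by simp) ⟨i, hi⟩ (by simp)
    · obtain ⟨u, rfl⟩ := exists_succ_eq (n := n) (u := u) (by omega) (by omega)
      simp only [] at hu huj
      have hu1 : i < u := by rw [Fin.lt_def]; omega
      have hu2 : u < j := by rw [Fin.lt_def]; omega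
      rw [active_succ_iff] at ha
      obtain ⟨k, hk, h⟩ := habs ⟨u, ha⟩ ⟨hu1.le, hu2.le⟩ (by
        simp only [Set.mem_insert_iff, Set.mem_singleton_iff, not_or, Subtype.mk.injEq]
        exact ⟨hu1.ne', hu2.ne⟩)
      rcases hk with rfl | rfl
      · exact Or.inl ((arc_succ_iff u ha _).2 h)
      · exact Or.inr ((arc_succ_iff u ha _).2 h)

/-- No active voter has an arc to abstention, so the voters before `j` must all be absorbed by `j`
itself. The sink is treated likewise. -/
theorem link_source_iff (hP : P.SinglePeaked) (j : Fin n) : Link P.table 0 (j + 1) ↔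
    AuxArc P .source (.voter j) := by
  have hT := hP.prefTable
  constructor
  · rintro ⟨-, -, hj, -, -, hgap⟩
    rw [active_succ_iff] at hj
    refine .first ⟨j, hj⟩ ⟨by simp, ?_, ?_⟩
    · rintro u rfl v rfl
      exact fun h => lt_irrefl _ h.1
    · rintro ⟨u, hu⟩ h hn
      simp only [Set.mem_singleton_iff, Subtype.mk.injEq] at hn
      have h' : u ≤ j := h
      have ha := (active_succ_iff u).2 hu
      rcases hgap (u + 1) (by omega) (by have := lt_of_le_of_ne h' hn; omega) ha with h | h
      · exact absurd h (not_arc_zero ha)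
      · exact ⟨⟨j, hj⟩, by simp, (arc_succ_iff u hu j).1 h⟩
  · rintro (_ | ⟨⟨j, hj⟩, -, -, habs⟩)
    have ha := (active_succ_iff j).2 hj
    refine ⟨by omega, hT.active_outside (Or.inl rfl), ha, hT.not_arc_outside (Or.inl rfl),
      not_arc_zero ha, fun u hu huj ha => ?_⟩
    obtain ⟨u, rfl⟩ := exists_succ_eq (n := n) (u := u) (by omega) (by omega)
    simp only [] at huj
    have hu2 : u < j := by rw [Fin.lt_def]; omega
    rw [active_succ_iff] at ha
    obtain ⟨k, rfl, h⟩ := habs ⟨u, ha⟩ hu2.le (by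
      simp only [Set.mem_singleton_iff, Subtype.mk.injEq]
      exact hu2.ne)
    exact Or.inr ((arc_succ_iff u ha _).2 h)

theorem link_sink_iff (hP : P.SinglePeaked) (i : Fin n) : Link P.table (i + 1) (n + 1) ↔
    AuxArc P (.voter i) .sink := by
  have hT := hP.prefTable
  have htop : ∀ {u}, Active P.table u → ¬ Arc P.table u (n + 1) := by
    intro u hu h
    rw [Arc, hT.top] at h
    exact hu h
  constructor
  · rintro ⟨-, hi, -, -, -, hgap⟩
    rw [active_succ_iff] at hi
    refine .last ⟨i, hi⟩ ⟨by simp, ?_, ?_⟩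
    · rintro u rfl v rfl
      exact fun h => lt_irrefl _ h.1
    · rintro ⟨u, hu⟩ h hn
      simp only [Set.mem_singleton_iff, Subtype.mk.injEq] at hn
      have h' : i ≤ u := h
      have ha := (active_succ_iff u).2 hu
      rcases hgap (u + 1) (by have := lt_of_le_of_ne h' (Ne.symm hn); omega)
        (by have := u.2; omega) ha with h | h
      · exact ⟨⟨i, hi⟩, by simp, (arc_succ_iff u hu i).1 h⟩
      · exact absurd h (htop ha)
  · rintro (_ | _ | ⟨⟨i, hi⟩, -, -, habs⟩)
    have ha := (active_succ_iff i).2 hi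
    refine ⟨by have := i.2; omega, ha, hT.active_outside (by omega), htop ha,
      hT.not_arc_outside (by omega), fun u hu huj ha => ?_⟩
    obtain ⟨u, rfl⟩ := exists_succ_eq (n := n) (u := u) (by omega) (by omega)
    simp only [] at hu
    have hu1 : i < u := by rw [Fin.lt_def]; omega
    rw [active_succ_iff] at ha
    obtain ⟨k, rfl, h⟩ := habs ⟨u, ha⟩ hu1.le (by
      simp only [Set.mem_singleton_iff, Subtype.mk.injEq]
      exact hu1.ne')
    exact Or.inl ((arc_succ_iff u ha _).2 h)

/-- The excluded pair is the link from source to sink. It is kept among the links so that the empty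
kernel, too, is a path. -/
theorem auxDigraph_adj_iff (hP : P.SinglePeaked) (u v : AuxVertex n) :
    (auxDigraph P).Adj u v ↔ Link P.table u.code v.code ∧ ¬ (u.code = 0 ∧ v.code = n + 1) := by
  change AuxArc P u v ↔ _
  cases u with
  | source =>
    cases v with
    | source => exact ⟨fun h => (by cases h), fun h => absurd h.1.1 (lt_irrefl _)⟩
    | voter j =>
      rw [← link_source_iff hP]
      have := j.2
      simp only [AuxVertex.code]
      exact ⟨fun h => ⟨h, by omega⟩, fun h => h.1⟩
    | sink => exact ⟨fun h => (by cases h), fun h => absurd ⟨rfl, rfl⟩ h.2⟩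
  | voter i =>
    cases v with
    | source => exact ⟨fun h => (by cases h), fun h => absurd h.1.1 (Nat.not_lt_zero _)⟩
    | voter j =>
      rw [← link_voter_iff]
      simp [AuxVertex.code]
    | sink =>
      rw [← link_sink_iff hP]
      simp [AuxVertex.code]
  | sink =>
    refine ⟨fun h => (by cases h), fun h => absurd h.1.1 ?_⟩
    cases v with
    | source => simp [AuxVertex.code]
    | voter j => have := j.2; simp only [AuxVertex.code]; omega
    | sink => simp [AuxVertex.code]

/-! ### Equilibria and kernels -/

/-- The codes of the gurus, the source and the sink. -/
def Delegation.kernel (d : Delegation n) : Finset ℕ :=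
  insert 0 (insert (n + 1) (d.gurus.image fun i : Fin n => (i : ℕ) + 1))

theorem Delegation.mem_kernel {d : Delegation n} {g : ℕ} :
    g ∈ d.kernel ↔ g = 0 ∨ g = n + 1 ∨ ∃ i ∈ d.gurus, (i : ℕ) + 1 = g := by
  simp [Delegation.kernel]

theorem Delegation.succ_mem_kernel {d : Delegation n} {i : Fin n} :
    (i : ℕ) + 1 ∈ d.kernel ↔ i ∈ d.gurus := by
  rw [Delegation.mem_kernel]
  constructor
  · rintro (h | h | ⟨j, hj, h⟩)
    · omega
    · have := i.2; omega
    · have : j = i := Fin.ext (by omega)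
      exact this ▸ hj
  · exact fun h => Or.inr (Or.inr ⟨i, h, rfl⟩)

theorem Delegation.guru_of_mem_gurus {d : Delegation n} {i : Fin n} (hi : i ∈ d.gurus) :
    d.guru i = some i :=
  (d.guru_eq_some_iff i i).2 ⟨hi, 0, rfl⟩

theorem Delegation.code_guru_mem_kernel (d : Delegation n) (i : Fin n) :
    code (d.guru i) ∈ d.kernel := by
  cases h : d.guru i with
  | none => exact Delegation.mem_kernel.2 (Or.inl rfl)
  | some j => exact Delegation.succ_mem_kernel.2 ((d.guru_eq_some_iff i j).1 h).1

theorem Delegation.IsEquilibrium.table_guru_lt {d : Delegation n} (hd : d.IsEquilibrium P)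
    (i : Fin n) {g : ℕ} (hg : g ∈ d.kernel)
    (hne : decode n g ≠ d.guru i) : P.table (i + 1) (code (d.guru i)) < P.table (i + 1) g := by
  rw [table_code, table_succ]
  refine hd i _ ?_ hne
  rcases Delegation.mem_kernel.1 hg with rfl | rfl | ⟨k, hk, rfl⟩
  · exact Or.inl (decode_of_outside (Or.inl rfl))
  · exact Or.inl (decode_of_outside (Or.inr (by omega)))
  · exact Or.inr (Or.inr ⟨k, hk, decode_succ k⟩)

theorem Delegation.IsEquilibrium.table_guru_le {d : Delegation n} (hd : d.IsEquilibrium P)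
    (i : Fin n) {g : ℕ} (hg : g ∈ d.kernel) :
    P.table (i + 1) (code (d.guru i)) ≤ P.table (i + 1) g := by
  by_cases h : decode n g = d.guru i
  · rw [table_code, table_succ, h]
  · exact (hd.table_guru_lt i hg h).le

/-- Stability against abstaining keeps abstainers out, stability of gurus against the other gurus
gives independence, and stability against voting oneself gives absorption. -/
theorem Delegation.IsEquilibrium.partialKernel {d : Delegation n} (hd : d.IsEquilibrium P)
    (hP : P.SinglePeaked) : PartialKernel P.table (n + 1) d.kernel := by
  have hT := hP.prefTable
  have hact : ∀ k ∈ d.kernel, Active P.table k := by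
    intro k hk
    rcases Delegation.mem_kernel.1 hk with rfl | rfl | ⟨i, hi, rfl⟩
    · exact hT.active_outside (Or.inl rfl)
    · exact hT.active_outside (Or.inr (by omega))
    · rw [active_succ_iff]
      have := hd i none (Or.inl rfl) (by rw [Delegation.guru_of_mem_gurus hi]; simp)
      rw [Delegation.guru_of_mem_gurus hi] at this
      exact fun h => lt_asymm h this
  refine ⟨Delegation.mem_kernel.2 (Or.inl rfl), Delegation.mem_kernel.2 (Or.inr (Or.inl rfl)),
    fun k hk => ?_, hact, fun k hk l hl => ?_, fun u hu ha hn => ?_⟩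
  · rcases Delegation.mem_kernel.1 hk with rfl | rfl | ⟨i, hi, rfl⟩
    · omega
    · omega
    · have := i.2; omega
  · by_cases hout : k = 0 ∨ n < k
    · exact hT.not_arc_outside hout
    · obtain ⟨i, rfl⟩ := exists_succ_eq (n := n) (u := k) (by omega) (by omega)
      have hi := Delegation.succ_mem_kernel.1 hk
      have := hd.table_guru_le i hl
      rw [Delegation.guru_of_mem_gurus hi] at this
      exact not_lt.2 this
  · have hout : ¬ (u = 0 ∨ n < u) := fun h => hn (Delegation.mem_kernel.2 (by omega))
    obtain ⟨i, rfl⟩ := exists_succ_eq (n := n) (u := u) (by omega) (by omega)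
    rw [Delegation.succ_mem_kernel] at hn
    refine ⟨_, d.code_guru_mem_kernel i, ?_⟩
    rw [Arc, table_code, table_voter]
    exact hd i (some i) (Or.inr (Or.inl rfl))
      fun h => hn ((d.guru_eq_some_iff i i).1 h.symm).1

theorem PartialKernel.isEquilibrium (hP : P.SinglePeaked) {K : Finset ℕ}
    (hK : PartialKernel P.table (n + 1) K) {d : Delegation n} (hmem : ∀ i, code (d i) ∈ K)
    (hbest : ∀ i : Fin n, ∀ g ∈ K, P.table (i + 1) (code (d i)) ≤ P.table (i + 1) g) :
    d.IsEquilibrium P ∧ d.kernel = K := by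
  have hT := hP.prefTable
  have hgu : ∀ i : Fin n, i ∈ d.gurus ↔ (i : ℕ) + 1 ∈ K := by
    intro i
    simp only [Delegation.gurus, Finset.mem_filter, Finset.mem_univ, true_and]
    constructor
    · intro h
      have := hmem i
      rwa [h] at this
    · intro h
      -- An element of `K` has no arc to her best element of `K`; the positions agree, so that
      -- element is herself.
      have h1 := hbest i _ h
      have h2 : ¬ Arc P.table (i + 1) (code (d i)) := hK.indep _ h _ (hmem i)
      have h3 := hT.inj (i + 1) (code (d i)) (i + 1) (by omega) i.2 (code_le _) i.2
        (le_antisymm h1 (not_lt.1 h2))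
      rw [← decode_code (d i), h3, decode_succ]
  -- Delegations have length at most one, since every target is itself a guru.
  have hguru : ∀ i, d.guru i = d i := by
    intro i
    cases h : d i with
    | none =>
      rw [Option.eq_none_iff_forall_ne_some]
      intro j hj
      obtain ⟨hjg, m, hm⟩ := (d.guru_eq_some_iff i j).1 hj
      cases m with
      | zero =>
        have : i = j := Option.some.inj hm
        subst this
        simp [Delegation.gurus, h] at hjg
      | succ m =>
        have hfix : d.step none = none := rfl
        rw [Function.iterate_succ_apply, show d.step (some i) = none from h,
          Function.iterate_fixed hfix] at hm
        cases hm
    | some j =>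
      refine (d.guru_eq_some_iff i j).2 ⟨(hgu j).2 ?_, 1, h⟩
      have := hmem i
      rwa [h] at this
  constructor
  · intro i g hg hne
    rw [hguru] at hne ⊢
    have hle : P.pos i (d i) ≤ P.pos i g := by
      have key : ∀ g', code g' ∈ K → P.pos i (d i) ≤ P.pos i g' := by
        intro g' hg'
        have := hbest i _ hg'
        rw [table_code, table_code] at this
        exact this
      rcases hg with rfl | rfl | ⟨k, hk, rfl⟩
      · exact key none hK.zero_mem
      -- Voting herself does not help a voter outside `K`: an abstainer prefers to abstain, and any
      -- other voter is absorbed by `K`.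
      · by_cases hiK : (i : ℕ) + 1 ∈ K
        · exact key (some i) hiK
        · by_cases ha : P.IsAbstainer i
          · exact (key none hK.zero_mem).trans (le_of_lt ha)
          · obtain ⟨k, hk, hak⟩ := hK.absorb (i + 1) (by have := i.2; omega)
              ((active_succ_iff i).2 ha) hiK
            have h1 := (hbest i k hk).trans (le_of_lt hak)
            rw [table_code, table_voter] at h1
            exact h1
      · exact key (some k) ((hgu k).1 hk)
    exact lt_of_le_of_ne hle fun h => hne ((P.pos i).injective h).symm
  · ext g
    rw [Delegation.mem_kernel]
    constructor
    · rintro (rfl | rfl | ⟨i, hi, rfl⟩)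
      exacts [hK.zero_mem, hK.mem, (hgu i).1 hi]
    · intro hg
      have := hK.le g hg
      by_cases h : g = 0 ∨ g = n + 1
      · exact h.imp id Or.inl
      · obtain ⟨i, rfl⟩ := exists_succ_eq (n := n) (u := g) (by omega) (by omega)
        exact Or.inr (Or.inr ⟨i, (hgu i).2 hg, rfl⟩)

theorem PartialKernel.exists_isEquilibrium (hP : P.SinglePeaked) {K : Finset ℕ}
    (hK : PartialKernel P.table (n + 1) K) :
    ∃ d : Delegation n, d.IsEquilibrium P ∧ d.kernel = K := by
  have hT := hP.prefTable
  have hex : ∀ i : Fin n, ∃ b ∈ K, ∀ g ∈ K, P.table (i + 1) b ≤ P.table (i + 1) g := fun i =>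
    K.exists_min_image _ ⟨0, hK.zero_mem⟩
  choose b hb hmin using hex
  have htab : ∀ i : Fin n, code (decode n (b i)) ∈ K ∧
      P.table (i + 1) (code (decode n (b i))) = P.table (i + 1) (b i) := by
    intro i
    by_cases h : b i ≤ n
    · rw [code_decode h]; exact ⟨hb i, rfl⟩
    · have hbi : b i = n + 1 := by have := hK.le _ (hb i); omega
      rw [decode_of_outside (Or.inr (by omega)), hbi, hT.top]
      exact ⟨hK.zero_mem, rfl⟩
  exact ⟨_, hK.isEquilibrium hP (d := fun i => decode n (b i)) (fun i => (htab i).1)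
    fun i g hg => (htab i).2.trans_le (hmin i g hg)⟩

/-! ### The measures of an equilibrium -/

theorem sum_voters_eq (f : ℕ → ℕ) (p : ℕ → Prop) [DecidablePred p]
    (hp : ∀ u, 0 < u → u ≤ n → p u) :
    ∑ u ∈ (Finset.range (n + 2)).filter (fun u => 0 < u ∧ u ≤ n ∧ p u), f u =
      ∑ i : Fin n, f (i + 1) := by
  symm
  refine Finset.sum_bij (fun i _ => (i : ℕ) + 1) (fun i _ => ?_) (fun i _ j _ h => ?_)
    (fun u hu => ?_) fun i _ => rfl
  · have := i.2
    rw [Finset.mem_filter, Finset.mem_range]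
    exact ⟨by omega, by omega, i.2, hp _ (by omega) i.2⟩
  · exact Fin.ext (by simpa using h)
  · rw [Finset.mem_filter] at hu
    obtain ⟨i, hi⟩ := exists_succ_eq (n := n) hu.2.1 hu.2.2.1
    exact ⟨i, Finset.mem_univ _, hi⟩

theorem Delegation.IsEquilibrium.bestPos_kernel {d : Delegation n} (hd : d.IsEquilibrium P)
    (i : Fin n) :
    bestPos P.table (i + 1) d.kernel = P.pos i (d.guru i) := by
  rw [← table_code]
  refine le_antisymm ?_ (le_bestPos.2 ⟨?_, fun g hg => hd.table_guru_le i hg⟩)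
  · exact (le_bestPos.1 le_rfl).2 _ (d.code_guru_mem_kernel i)
  · exact hd.table_guru_le i (Delegation.mem_kernel.2 (Or.inl rfl))

theorem Delegation.IsEquilibrium.sumMeasure_kernel {d : Delegation n} (hd : d.IsEquilibrium P)
    (φ : ℕ → ℕ → ℕ) : sumMeasure n P.table φ (n + 1) 0 d.kernel =
      ∑ i : Fin n, φ (i + 1) (P.pos i (d.guru i)) := by
  rw [sumMeasure, sum_voters_eq _ _ fun u _ hu => by omega]
  simp only [hd.bestPos_kernel]

theorem Delegation.IsEquilibrium.dissatisfaction_eq {d : Delegation n}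
    (hd : d.IsEquilibrium P) :
    d.dissatisfaction P = sumMeasure n P.table (fun _ v => v) (n + 1) 0 d.kernel := by
  rw [hd.sumMeasure_kernel]
  simp [Delegation.dissatisfaction, Profile.rank]

/-- The guru is never worse than abstention, so a voter abstains exactly if her best position is not
before that of abstention. -/
theorem Delegation.IsEquilibrium.abstentions_eq {d : Delegation n} (hd : d.IsEquilibrium P) :
    d.abstentions =
      sumMeasure n P.table (fun u v => if P.table u 0 ≤ v then 1 else 0) (n + 1) 0 d.kernel := by
  classical
  rw [hd.sumMeasure_kernel, Delegation.abstentions, Finset.card_filter]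
  refine Finset.sum_congr rfl fun i _ => ?_
  have hle := hd.table_guru_le i (g := 0) (Delegation.mem_kernel.2 (Or.inl rfl))
  rw [table_code, table_zero] at hle
  rw [table_zero]
  by_cases h : d.guru i = none
  · rw [if_pos h, if_pos (by rw [h])]
  · rw [if_neg h, if_neg]
    intro h'
    exact h ((P.pos i).injective (le_antisymm (Fin.le_def.2 hle) (Fin.le_def.2 h')))

/-- Nash-stability is strict: the guru beats abstention and every other kernel element strictly,
which is what counting supporters requires. -/
theorem Delegation.IsEquilibrium.power_kernel {d : Delegation n} (hd : d.IsEquilibrium P)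
    (hP : P.SinglePeaked) {i : Fin n} (hi : i ∈ d.gurus) :
    power n P.table (n + 1) 0 (i + 1) d.kernel = d.votingPower i := by
  classical
  have h0 : 0 ∈ d.kernel := Delegation.mem_kernel.2 (Or.inl rfl)
  have hbest : ∀ j : Fin n, Best P.table (j + 1) (i + 1) (insert 0 d.kernel) ↔
      d.guru j = some i := by
    intro j
    rw [Finset.insert_eq_of_mem h0]
    constructor
    · intro hb
      by_contra hne
      have h1 := hb.2 _ (d.code_guru_mem_kernel j) fun h => hne (by
        rw [← decode_code (d.guru j), h, decode_succ])
      exact not_lt.2 (hd.table_guru_le j (Delegation.succ_mem_kernel.2 hi)) h1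
    · intro hj
      have hne : ∀ g, g ≤ n ∧ g ≠ i + 1 ∨ g = n + 1 → decode n g ≠ d.guru j := by
        rintro g (⟨hg, hgi⟩ | rfl) h
        · rw [hj, ← decode_succ i] at h
          apply hgi
          rw [← code_decode hg, h, decode_succ]
          rfl
        · rw [decode_of_outside (Or.inr (by omega)), hj] at h
          cases h
      have hcode : code (d.guru j) = i + 1 := by rw [hj]; rfl
      rw [Best, ← hcode]
      refine ⟨hd.table_guru_lt j h0 (hne 0 (by omega)), fun g hg hgi => ?_⟩
      refine hd.table_guru_lt j hg (hne g ?_)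
      have := (hd.partialKernel hP).le g hg
      rw [hcode] at hgi
      omega
  rw [power, Delegation.votingPower, Finset.card_filter, Finset.card_filter,
    ← Finset.card_filter, Finset.card_eq_sum_ones]
  have hfil : (Finset.range (n + 2)).filter (fun u => 0 < u ∧ u ≤ n ∧ (u ≤ n + 1 ∨ u < 0) ∧
      Best P.table u (i + 1) (insert 0 d.kernel)) =
      ((Finset.range (n + 2)).filter (fun u => 0 < u ∧ u ≤ n ∧ (u ≤ n + 1 ∨ u < 0))).filter
        (fun u => Best P.table u (i + 1) (insert 0 d.kernel)) := by
    rw [Finset.filter_filter]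
    exact Finset.filter_congr fun u _ => by tauto
  rw [hfil, Finset.sum_filter, sum_voters_eq _ _ fun u _ hu => by omega]
  exact Finset.sum_congr rfl fun j _ => by simp only [hbest j]

/-- The two ends are tied with abstention in every row and have power `0`. They do not affect the
maximum, and they give `0` if nobody votes. -/
theorem Delegation.IsEquilibrium.maxVotingPower_eq {d : Delegation n} (hd : d.IsEquilibrium P)
    (hP : P.SinglePeaked) : d.maxVotingPower = powerMeasure n P.table (n + 1) 0 d.kernel := by
  have hT := hP.prefTable
  have hzero : ∀ x, (∀ u, P.table u x = P.table u 0) → power n P.table (n + 1) 0 x d.kernel = 0 := by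
    intro x hx
    rw [power, Finset.card_eq_zero, Finset.filter_eq_empty_iff]
    rintro u - ⟨-, -, -, hb, -⟩
    rw [hx u] at hb
    exact lt_irrefl _ hb
  rw [powerMeasure, Delegation.maxVotingPower]
  refine le_antisymm (Finset.sup_le fun i hi => ?_) (Finset.sup_le fun x hx => ?_)
  · rw [← hd.power_kernel hP hi]
    exact Finset.le_sup (f := fun x => power n P.table (n + 1) 0 x d.kernel)
      (Delegation.succ_mem_kernel.2 hi)
  · rcases Delegation.mem_kernel.1 hx with rfl | rfl | ⟨i, hi, rfl⟩
    · rw [hzero 0 fun _ => rfl]; exact Nat.zero_le _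
    · rw [hzero (n + 1) hT.top]; exact Nat.zero_le _
    · rw [hd.power_kernel hP hi]
      exact Finset.le_sup (f := d.votingPower) hi

/-! ### The input states -/

theorem prefCell_eq (P : Profile n) {u r : ℕ} (hu : u < n) (hr : r < n + 1) :
    prefCell P (u * (n + 1) + r) = code ((P.pos ⟨u, hu⟩).symm ⟨r, hr⟩) := by
  have h1 : (u * (n + 1) + r) / (n + 1) = u := by
    rw [mul_comm, Nat.mul_add_div (by omega), Nat.div_eq_of_lt hr, add_zero]
  have h2 : (u * (n + 1) + r) % (n + 1) = r := by
    rw [mul_comm, Nat.mul_add_mod, Nat.mod_eq_of_lt hr]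
  simp only [prefCell, h1, h2]
  rw [dif_pos hu]

theorem prefCell_le (P : Profile n) (k : ℕ) : prefCell P k ≤ n := by
  rw [prefCell]
  split_ifs
  · exact code_le _
  · exact Nat.zero_le _

theorem isInput_of_arr {s : State} (h0 : s.reg 0 = n)
    (ha : s.arr = (profileInput n P).arr) : IsInput n P.table s.setup where
  reg0 := by simp [State.setup, h0]
  reg2 := by simp [State.setup, h0]
  reg3 := by simp [State.setup, h0]
  lists u r hu hr := by
    have : s.setup.arr 0 (u * (n + 1) + r) = prefCell P (u * (n + 1) + r) := by
      simp [State.setup, ha, profileInput]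
    rw [this, prefCell_eq P hu hr]
    refine ⟨code_le _, ?_⟩
    have := table_code (P := P) ⟨u, hu⟩ ((P.pos ⟨u, hu⟩).symm ⟨r, hr⟩)
    simpa using this
  zero a k h := by simp [State.setup, ha, profileInput, h]

theorem profileInput_boundedBy (P : Profile n) : (profileInput n P).BoundedBy (n + 1) := by
  refine ⟨fun x => ?_, fun a k => ?_⟩
  · simp only [profileInput]; split_ifs <;> omega
  · have := prefCell_le P k
    simp only [profileInput]; split_ifs <;> omega

end

/-! ### The algorithms -/

section

variable {n : ℕ} {pos : ℕ → ℕ → ℕ}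

/-- The test whether the voter in register `6` lies after register `4` and not after register `5`. -/
def leftGuard : Expr :=
  .mul (.lt (.reg 6) (.add (.reg 0) (.const 1)))
    (.mul (.lt (.reg 4) (.reg 6)) (.lt (.reg 6) (.add (.reg 5) (.const 1))))

/-- The test whether the voter in register `6` lies strictly between registers `4` and `5`. -/
def rightGuard : Expr :=
  .mul (.lt (.reg 6) (.add (.reg 0) (.const 1)))
    (.mul (.lt (.reg 4) (.reg 6)) (.lt (.reg 6) (.reg 5)))

theorem Computes.leftGuard_mul {e : Expr} {c : ℕ → ℕ → ℕ → ℕ} (he : Computes n pos e c) :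
    Computes n pos (.mul leftGuard e) fun u i j => if u ≤ n ∧ i < u ∧ u ≤ j then c u i j else 0 := by
  intro s h0 h2 ht h4 h5 h6
  simp only [Expr.eval, leftGuard, he s h0 h2 ht h4 h5 h6, h0, Nat.lt_succ_iff]
  by_cases h1 : s.reg 6 ≤ n <;> by_cases h2 : s.reg 4 < s.reg 6 <;>
    by_cases h3 : s.reg 6 ≤ s.reg 5 <;> simp [h1, h2, h3]

theorem Computes.rightGuard_mul {e : Expr} {c : ℕ → ℕ → ℕ → ℕ} (he : Computes n pos e c) :
    Computes n pos (.mul rightGuard e)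
      fun u i j => if u ≤ n ∧ i < u ∧ u < j then c u i j else 0 := by
  intro s h0 h2 ht h4 h5 h6
  simp only [Expr.eval, rightGuard, he s h0 h2 ht h4 h5 h6, h0, Nat.lt_succ_iff]
  by_cases h1 : s.reg 6 ≤ n <;> by_cases h2 : s.reg 4 < s.reg 6 <;>
    by_cases h3 : s.reg 6 < s.reg 5 <;> simp [h1, h2, h3]

/-- The position of the best of abstention and the alternatives in registers `4` and `5`. -/
def minExpr : Expr :=
  .min (.cell 2 (.reg 6) (.const 0)) (.min (.cell 2 (.reg 6) (.reg 4)) (.cell 2 (.reg 6) (.reg 5)))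

theorem computes_minExpr : Computes n pos minExpr (localCost pos fun _ v => v) := by
  intro s _ h2 ht h4 h5 h6
  simp only [minExpr, Expr.eval_min, eval_cell h2, Expr.eval, localCost]
  rw [ht _ _ h6 (by omega), ht _ _ h6 h4, ht _ _ h6 h5]

/-- The test whether the voter in register `6` abstains. -/
def abstainExpr : Expr := .sub (.const 1) (.lt minExpr (.cell 2 (.reg 6) (.const 0)))

theorem computes_abstainExpr :
    Computes n pos abstainExpr (localCost pos fun u v => if pos u 0 ≤ v then 1 else 0) := by
  intro s h0 h2 ht h4 h5 h6
  simp only [abstainExpr, Expr.eval, computes_minExpr s h0 h2 ht h4 h5 h6, eval_cell h2, localCost]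
  rw [ht _ _ h6 (by omega)]
  split_ifs <;> omega

/-- The test whether the voter in register `6` supports the voter in register `x`. -/
def supportExpr (x y : ℕ) : Expr :=
  .mul (.lt (.cell 2 (.reg 6) (.reg x)) (.cell 2 (.reg 6) (.const 0)))
    (.lt (.cell 2 (.reg 6) (.reg x)) (.cell 2 (.reg 6) (.reg y)))

theorem computes_supportExpr_left :
    Computes n pos (supportExpr 5 4) fun u i j => support pos u j i := by
  intro s h0 h2 ht h4 h5 h6
  simp only [supportExpr, Expr.eval, eval_cell h2, support]
  rw [ht _ _ h6 (Nat.succ_pos (n + 1)), ht _ _ h6 h4, ht _ _ h6 h5]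
  split_ifs <;> simp_all

theorem computes_supportExpr_right : Computes n pos (supportExpr 4 5) (support pos) := by
  intro s h0 h2 ht h4 h5 h6
  simp only [supportExpr, Expr.eval, eval_cell h2, support]
  rw [ht _ _ h6 (Nat.succ_pos (n + 1)), ht _ _ h6 h4, ht _ _ h6 h5]
  split_ifs <;> simp_all

theorem sumLeft_eq (c : ℕ → ℕ → ℕ → ℕ) : sumLeft n c = fun i j =>
    ∑ u ∈ Finset.range (n + 2), if u ≤ n ∧ i < u ∧ u ≤ j then c u i j else 0 := by
  funext i j
  rw [sumLeft, Finset.sum_filter]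

theorem sumRight_eq (c : ℕ → ℕ → ℕ → ℕ) : sumRight n c = fun i j =>
    ∑ u ∈ Finset.range (n + 2), if u ≤ n ∧ i < u ∧ u < j then c u i j else 0 := by
  funext i j
  rw [sumRight, Finset.sum_filter]

theorem support_le_one (u x y : ℕ) : support pos u x y ≤ 1 := by
  rw [support]; split_ifs <;> omega

theorem PrefTable.localCost_le (hT : PrefTable n pos) {φ : ℕ → ℕ → ℕ}
    (hφ : ∀ u v, v ≤ n → φ u v ≤ n + 1) (u i j : ℕ) : localCost pos φ u i j ≤ n + 1 :=
  hφ _ _ ((min_le_left _ _).trans (hT.le u 0))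

theorem PrefTable.sumMeasure_lt (hT : PrefTable n pos) {φ : ℕ → ℕ → ℕ}
    (hφ : ∀ u v, v ≤ n → φ u v ≤ n + 1) (j k : ℕ) (K : Finset ℕ) :
    sumMeasure n pos φ j k K < (n + 2) ^ 3 := by
  have hcard : ((Finset.range (n + 2)).filter (fun u => 0 < u ∧ u ≤ n ∧ u ≤ j)).card ≤ n + 2 := by
    simpa using Finset.card_filter_le (Finset.range (n + 2)) _
  calc sumMeasure n pos φ j k K ≤ _ • (n + 1) :=
        Finset.sum_le_card_nsmul _ _ (n + 1) fun u _ =>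
          hφ _ _ (((le_bestPos.1 le_rfl).1).trans (hT.le u 0))
    _ ≤ (n + 2) * (n + 1) := by rw [smul_eq_mul]; exact Nat.mul_le_mul_right _ hcard
    _ < (n + 2) * (n + 2) := Nat.mul_lt_mul_of_pos_left (by omega) (by omega)
    _ = (n + 2) ^ 2 := (sq _).symm
    _ ≤ (n + 2) ^ 3 := Nat.pow_le_pow_right (by omega) (by omega)

theorem powerMeasure_lt (j k : ℕ) (K : Finset ℕ) : powerMeasure n pos j k K < (n + 2) ^ 3 := by
  have h1 : powerMeasure n pos j k K ≤ n + 2 := Finset.sup_le fun x _ => by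
    simpa [power] using Finset.card_filter_le (Finset.range (n + 2)) _
  have h2 : (n + 2) ^ 1 < (n + 2) ^ 3 := Nat.pow_lt_pow_right (by omega) (by norm_num)
  rw [pow_one] at h2
  omega

end

/-! ### From kernels to correct outputs -/

section

variable {n : ℕ} {P : Profile n}

theorem outputsOptimal_of_kernel (hP : P.SinglePeaked) {measure : Delegation n → ℕ}
    {m : Finset ℕ → ℕ} (hm : ∀ d : Delegation n, d.IsEquilibrium P → measure d = m d.kernel)
    {s : State} (h : ∃ K, PartialKernel P.table (n + 1) K ∧
      (∀ K', PartialKernel P.table (n + 1) K' → m K ≤ m K') ∧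
      ∀ u < n, ∃ b ∈ K, s.arr 1 u = b ∧ b ≤ n ∧ ∀ g ∈ K, P.table (u + 1) b ≤ P.table (u + 1) g) :
    OutputsOptimal n P measure s := by
  obtain ⟨K, hK, hmin, hout⟩ := h
  choose b hbK hb hbn hbest using hout
  have hcode : ∀ i : Fin n, code (decode n (b i i.2)) = b i i.2 := fun i => code_decode (hbn i i.2)
  obtain ⟨hd, hker⟩ := hK.isEquilibrium hP (d := fun i => decode n (b i i.2))
    (fun i => by rw [hcode]; exact hbK i i.2)
    (fun i g hg => by rw [hcode]; exact hbest i i.2 g hg)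
  refine ⟨_, fun i => (hb i i.2).trans (hcode i).symm, hd, fun d₁ hd₁ => ?_⟩
  rw [hm _ hd, hm _ hd₁, hker]
  exact hmin _ (hd₁.partialKernel hP)

/-- Minimize an additive cost of the voters. -/
def sumOptimalCmd (e : Expr) : Cmd := optimalCmd .add (.mul leftGuard e) (.const 0)

theorem outputsOptimal_sumOptimalCmd (hP : P.SinglePeaked) {φ : ℕ → ℕ → ℕ}
    (hφ : ∀ u v, v ≤ n → φ u v ≤ n + 1) {e : Expr}
    (he : Computes n P.table e (localCost P.table φ)) {measure : Delegation n → ℕ}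
    (hm : ∀ d : Delegation n, d.IsEquilibrium P →
      measure d = sumMeasure n P.table φ (n + 1) 0 d.kernel) :
    OutputsOptimal n P measure ((sumOptimalCmd e).run (profileInput n P).setup) := by
  have hT := hP.prefTable
  have hpm := hT.pathMeasure_sum φ
  rw [sumLeft_eq, sumRight_eq] at hpm
  refine outputsOptimal_of_kernel hP hm (run_optimalCmd hT (isInput_of_arr rfl rfl)
    (fun _ _ _ => rfl) (fun a b c h => Nat.add_le_add_right h c) (fun a b => Nat.le_add_right a b)
    he.leftGuard_mul (fun s _ _ _ _ _ _ => ?_) (fun u i j => ?_) (fun u i j => ?_) hpm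
    fun K _ => hT.sumMeasure_lt hφ _ _ _)
  · simp [Expr.eval]
  · split_ifs
    · exact (hT.localCost_le hφ u i j).trans (by omega)
    · exact Nat.zero_le _
  · simp

/-- Minimize the maximal voting power. -/
def powerOptimalCmd : Cmd :=
  optimalCmd .max (.mul leftGuard (supportExpr 5 4)) (.mul rightGuard (supportExpr 4 5))

theorem outputsOptimal_powerOptimalCmd (hP : P.SinglePeaked) :
    OutputsOptimal n P Delegation.maxVotingPower
      (powerOptimalCmd.run (profileInput n P).setup) := by
  have hT := hP.prefTable
  have hpm := hT.pathMeasure_power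
  rw [sumLeft_eq, sumRight_eq] at hpm
  refine outputsOptimal_of_kernel hP (fun d hd => hd.maxVotingPower_eq hP)
    (run_optimalCmd hT (isInput_of_arr rfl rfl) (fun s e f => Expr.eval_max s e f)
    (fun a b c h => max_le_max_right c h) (fun a b => le_max_left a b)
    computes_supportExpr_left.leftGuard_mul computes_supportExpr_right.rightGuard_mul
    (fun u i j => ?_) (fun u i j => ?_) hpm fun K _ => powerMeasure_lt _ _ _)
  · have := support_le_one (pos := P.table) u j i
    split_ifs <;> omega
  · have := support_le_one (pos := P.table) u i j
    split_ifs <;> omega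

/-- Compute the auxiliary digraph. -/
def auxCmd : Cmd := .seq prepareCmd (.store 1 (.add (.reg 0) (.const 1)) (.const 0))

theorem AuxVertex.code_lt (u : AuxVertex n) : u.code < n + 2 := by
  cases u with
  | source => simp [AuxVertex.code]
  | voter i => have := i.2; simp only [AuxVertex.code]; omega
  | sink => simp [AuxVertex.code]

/-- The matrix of links can differ from the required one only in row `0`, column `n + 1`. This is
cell `n + 1` of the array, which the final store clears. -/
theorem outputsAuxDigraph_auxCmd (hP : P.SinglePeaked) :
    OutputsAuxDigraph n P (auxCmd.run (profileInput n P).setup) := by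
  classical
  have hT := hP.prefTable
  have hin : IsInput n P.table (profileInput n P).setup := isInput_of_arr rfl rfl
  obtain ⟨-, hl⟩ := run_prepareCmd hT hin
  intro u v
  have hr0 : (prepareCmd.run (profileInput n P).setup).reg 0 = n :=
    (Cmd.run_reg rfl _).trans hin.reg0
  rw [auxCmd, Cmd.run_seq, Cmd.run_store, State.setArr_arr_self]
  simp only [Expr.eval, hr0]
  have hidx : u.code * (n + 2) + v.code = n + 1 ↔ u.code = 0 ∧ v.code = n + 1 := by
    have := mul_add_inj_of_lt (i := u.code) (k := 0) (l := n + 1) v.code_lt (by omega)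
    simpa using this
  have hL := hl u.code v.code u.code_lt v.code_lt
  rw [State.tab] at hL
  rw [hL]
  by_cases hst : u.code = 0 ∧ v.code = n + 1
  · rw [if_pos (hidx.2 hst), if_neg fun h => ((auxDigraph_adj_iff hP u v).1 h).2 hst]
  · rw [if_neg fun h => hst (hidx.1 h)]
    by_cases h : Link P.table u.code v.code
    · rw [if_pos h, if_pos ((auxDigraph_adj_iff hP u v).2 ⟨h, hst⟩)]
    · rw [if_neg h, if_neg fun h' => h ((auxDigraph_adj_iff hP u v).1 h').1]

theorem outputsMembership_memberCmd (hP : P.SinglePeaked) (i : Fin n) :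
    OutputsMembership n P i (memberCmd.run (memberInput n P i).setup) := by
  classical
  have hT := hP.prefTable
  have hin : IsInput n P.table (memberInput n P i).setup := isInput_of_arr rfl rfl
  have hi : (i : ℕ) + 1 < n + 2 := by have := i.2; omega
  rw [OutputsMembership, run_memberCmd hT hin hi rfl]
  congr 1
  rw [eq_iff_iff]
  constructor
  · rintro ⟨K, hK, hiK⟩
    obtain ⟨d, hd, rfl⟩ := hK.exists_isEquilibrium hP
    exact ⟨d, hd, Delegation.succ_mem_kernel.1 hiK⟩
  · rintro ⟨d, hd, hi⟩
    exact ⟨d.kernel, hd.partialKernel hP, Delegation.succ_mem_kernel.2 hi⟩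

end

end LiquidDemocracy

theorem mainTheorem3 :
    -- the auxiliary digraph is computable in quadratic time
    LiquidDemocracy.SolvableInTime LiquidDemocracy.SPProfile
      (fun n P => LiquidDemocracy.profileInput n P.1)
      (fun n P s => LiquidDemocracy.OutputsAuxDigraph n P.1 s)
      (fun n => (n : ℝ) ^ 2) ∧
    -- MEMB
    LiquidDemocracy.SolvableInTime LiquidDemocracy.MemberInstance
      (fun n x => LiquidDemocracy.memberInput n x.1.1 x.2.1)
      (fun n x s => LiquidDemocracy.OutputsMembership n x.1.1 x.2.1 s)
      (fun n => (n : ℝ) ^ 2) ∧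
    -- MINDIS
    LiquidDemocracy.SolvableInTime LiquidDemocracy.SPProfile
      (fun n P => LiquidDemocracy.profileInput n P.1)
      (fun n P s => LiquidDemocracy.OutputsOptimal n P.1
        (LiquidDemocracy.Delegation.dissatisfaction P.1) s)
      (fun n => (n : ℝ) ^ 3) ∧
    -- MINMAXVP
    LiquidDemocracy.SolvableInTime LiquidDemocracy.SPProfile
      (fun n P => LiquidDemocracy.profileInput n P.1)
      (fun n P s => LiquidDemocracy.OutputsOptimal n P.1
        LiquidDemocracy.Delegation.maxVotingPower s)
      (fun n => (n : ℝ) ^ 3) ∧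
    -- MINABST
    LiquidDemocracy.SolvableInTime LiquidDemocracy.SPProfile
      (fun n P => LiquidDemocracy.profileInput n P.1)
      (fun n P s => LiquidDemocracy.OutputsOptimal n P.1
        LiquidDemocracy.Delegation.abstentions s)
      (fun n => (n : ℝ) ^ 3) := by
  open LiquidDemocracy in
  have hin : ∀ (n : ℕ) (P : SPProfile n), (profileInput n P.1).BoundedBy (n + 1) :=
    fun n P => profileInput_boundedBy P.1
  -- `decide` bounds the nesting depth of the loops: at most two for the digraph and MEMB, at most
  -- three for the optimization problems.
  refine ⟨solvableInTime_of_cmd auxCmd rfl rfl (by decide) (fun _ _ => rfl) hin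
      fun n P => outputsAuxDigraph_auxCmd P.2,
    solvableInTime_of_cmd memberCmd rfl rfl (by decide) (fun _ _ => rfl) (fun n x => ?_)
      fun n x => outputsMembership_memberCmd x.1.2 x.2.1,
    solvableInTime_of_cmd (sumOptimalCmd minExpr) rfl rfl (by decide) (fun _ _ => rfl) hin
      fun n P => outputsOptimal_sumOptimalCmd P.2 (fun _ _ h => by omega) computes_minExpr
        fun d hd => hd.dissatisfaction_eq,
    solvableInTime_of_cmd powerOptimalCmd rfl rfl (by decide) (fun _ _ => rfl) hin
      fun n P => outputsOptimal_powerOptimalCmd P.2,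
    solvableInTime_of_cmd (sumOptimalCmd abstainExpr) rfl rfl (by decide) (fun _ _ => rfl) hin
      fun n P => outputsOptimal_sumOptimalCmd P.2 (fun _ _ _ => by split_ifs <;> omega)
        computes_abstainExpr fun d hd => hd.abstentions_eq⟩
  exact (profileInput_boundedBy x.1.1).setReg ((code_le _).trans (by omega))
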